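/- Let $\mathbb{T}=\mathbb{R}/(2\pi\mathbb{Z})$ and $v(\theta)=(\cos\theta,\sin\theta)$ for $\theta\in\mathbb{T}$. Let $Q(s,h|h')$, for $s\in\mathbb{R}$ and $h,h'\in[-1,1]$, be the transition kernel of the two-dimensional periodic Lorentz gas in the Boltzmann–Grad limit: if $|h'|\le h$, $$Q(s,h|h')=\frac{6}{\pi^2}\begin{cases}1,&0\le s\le\frac1{1+h},\\ \dfrac{\frac1s-(1+h')}{h-h'},&\frac1{1+h}<s\le\frac1{1+h'},\\ 0,&s<0\text{ or }s>\frac1{1+h'}\end{cases}$$ (with $\frac{1}{1+h'}=+\infty$ if $h'=-1$), and $Q$ is extended to all $h,h'\in[-1,1]$ by the symmetries $Q(s,h|h')=Q(s,h'|h)=Q(s,-h|-h')$. Let $\mu_0\in L^1(\mathbb{R}^2\times\mathbb{T}\times[0,\infty)\times[-1,1])$ be real-valued, and let $\mu_t$, $t\ge0$, be the mild solution with initial datum $\mu_0$ of $$\partial_t\mu_t+v(\theta)\cdot\nabla_x\mu_t-\partial_s\mu_t=\int_{-1}^1Q(s,h|h')\,\mu_t(x,\theta+\pi-2\arcsin h',0,h')\,dh',$$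 that is, the function such that, for every $t\ge0$ and almost every $(x,\theta,s,h)$, $$\mu_t(x,\theta,s,h)=\mu_0(x-tv(\theta),\theta,s+t,h)+\int_0^t\!\int_{-1}^1Q(s+t-t',h|h')\,\mu_{t'}\big(x-(t-t')v(\theta),\theta+\pi-2\arcsin h',0,h'\big)\,dh'\,dt',$$ where the trace $(x,\theta,t,h)\mapsto\mu_t(x,\theta,0,h)$ belongs to $L^1(\mathbb{R}^2\times\mathbb{T}\times[0,T]\times[-1,1])$ for every $T>0$ and satisfies the same identity with $s=0$ for almost every $(x,\theta,t,h)$. Then $\mu_t\in L^1(\mathbb{R}^2\times\mathbb{T}\times[0,\infty)\times[-1,1])$ for every $t\ge0$, and for every (complex-valued) Schwartz function $\eta\in\mathcal{S}(\mathbb{R}^2)$, $$\left\|\int_{\mathbb{R}^2}\eta(x)\,\mu_t(x,\cdot,\cdot,\cdot)\,dx\right\|_{L^1(\mathbb{T}\times[0,\infty)\times[-1,1])}\longrightarrow0\qquad\text{as }t\to+\infty .$$ -/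

import Mathlib

open MeasureTheory Set Filter Topology
open scoped Real SchwartzMap

noncomputable section

namespace PeriodicLorentz

/-- The plane `ℝ²` with its Euclidean norm and Lebesgue measure. -/
abbrev Plane : Type := EuclideanSpace ℝ (Fin 2)

/-- The circle `ℝ / 2πℤ`, whose `volume` is the Lebesgue measure, of total mass `2π`. -/
abbrev Circ : Type := AddCircle (2 * π)

instance factTwoPiPos : Fact (0 < 2 * π) := ⟨Real.two_pi_pos⟩

/-- The kernel `Q(s,h|h')` in the region `|h'| ≤ h`. The bounds `s ≤ 1/(1+h)` and `s ≤ 1/(1+h')`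
are written without division, so that `1/(1+h') = +∞` when `h' = -1`. -/
def kernelBase (s h h' : ℝ) : ℝ :=
  6 / π ^ 2 *
    (if s < 0 then 0
    else if s * (1 + h) ≤ 1 then 1
    else if s * (1 + h') ≤ 1 then (1 / s - (1 + h')) / (h - h')
    else 0)

/-- The transition kernel `Q(s,h|h')`, extended from `|h'| ≤ h` to all `h, h' ∈ [-1,1]` by the
symmetries `Q(s,h|h') = Q(s,h'|h) = Q(s,-h|-h')`. -/
def Q (s h h' : ℝ) : ℝ :=
  if |h'| ≤ h then kernelBase s h h'
  else if |h'| ≤ -h then kernelBase s (-h) (-h')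
  else if |h| ≤ h' then kernelBase s h' h
  else kernelBase s (-h') (-h)

/-- The unit velocity `v(θ) = (cos θ, sin θ)`. -/
def vel (θ : Circ) : Plane := !₂[Real.Angle.cos θ, Real.Angle.sin θ]

/-- Lebesgue measure on `[-1,1]`. -/
def impactMeasure : Measure ℝ := volume.restrict (Icc (-1) 1)

/-- Lebesgue measure on `𝕋 × S × [-1,1]`, for `S ⊆ ℝ`. -/
def angularMeasure (S : Set ℝ) : Measure (Circ × ℝ × ℝ) :=
  (volume : Measure Circ).prod ((volume.restrict S).prod impactMeasure)

/-- Lebesgue measure on `ℝ² × 𝕋 × S × [-1,1]`, for `S ⊆ ℝ`. -/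
def phaseMeasure (S : Set ℝ) : Measure (Plane × Circ × ℝ × ℝ) :=
  (volume : Measure Plane).prod (angularMeasure S)

/-- The right-hand side of the integral (Duhamel) form of the kinetic equation, at time `t` and at
the point `(x, θ, s, h)`. -/
def duhamel (μ₀ : Plane × Circ × ℝ × ℝ → ℝ) (μ : ℝ → Plane × Circ × ℝ × ℝ → ℝ)
    (t : ℝ) (x : Plane) (θ : Circ) (s h : ℝ) : ℝ :=
  μ₀ (x - t • vel θ, θ, s + t, h) +
    ∫ t' in (0 : ℝ)..t, ∫ h' in (-1 : ℝ)..1,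
      Q (s + t - t') h h' *
        μ t' (x - (t - t') • vel θ, θ + ((π - 2 * Real.arcsin h' : ℝ) : Circ), 0, h')

/-- `μ` is the mild solution on the plane with initial datum `μ₀`. As elements of `L¹` are involved,
the integral equation is required almost everywhere. The values at `s = 0`, which are the ones that
enter the integral, form a function of `(x, θ, t, h)` of their own: it is locally integrable in
time (the class in which the mild solution is unique) and satisfies the equation at `s = 0` almost
everywhere. -/
structure IsMildSolution (μ₀ : Plane × Circ × ℝ × ℝ → ℝ)
    (μ : ℝ → Plane × Circ × ℝ × ℝ → ℝ) : Prop where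
  trace_integrable : ∀ T : ℝ, 0 < T →
    Integrable (fun z : Plane × Circ × ℝ × ℝ ↦ μ z.2.2.1 (z.1, z.2.1, 0, z.2.2.2))
      (phaseMeasure (Icc 0 T))
  trace_eq : ∀ᵐ z ∂(phaseMeasure (Ici 0)),
    μ z.2.2.1 (z.1, z.2.1, 0, z.2.2.2) = duhamel μ₀ μ z.2.2.1 z.1 z.2.1 0 z.2.2.2
  eq : ∀ t : ℝ, 0 ≤ t → ∀ᵐ z ∂(phaseMeasure (Ici 0)),
    μ t z = duhamel μ₀ μ t z.1 z.2.1 z.2.2.1 z.2.2.2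

end PeriodicLorentz

end

/-!
The proof follows the particles in *collision coordinates*: `(x, θ, s, h)` records the place, the
direction, the time and the impact parameter of the next collision. Free flight does not change
these coordinates, so the collisions of a particle form a Markov chain (`jump`), and the state at
time `t` is the first collision at or after `t` (`hit`). Counting time afresh gives a semigroup of
kernels `flow t`.

*Mass.* The total mass of `Q(·, · | h')` is at most one (`lintegral_lintegral_rate_le_one`).
Integration in `s` gives difference quotients of `log`, and the remaining integral in `h` is Euler's
reflection formula for the dilogarithm, whose constant is `π² / 6`. Consequently `flow` consists of
sub-probability kernels, and the measure `equilibrium`, with density the mass of the flights longer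
than `s`, is subinvariant. Hence `flow` acts on `L²(equilibrium)` as a semigroup of contractions.

*Weak decay.* By Foguel's argument (`tendsto_inner_of_contraction_semigroup`), such a semigroup
tends weakly to zero if no nonzero vector has an infinite past along which the semigroup is
isometric. Equality in Jensen's inequality makes such a vector `y` constant along almost all
transitions. Paths with two collisions then show that `y` is invariant under translations of `x`: if
a particle turns from direction `α` to direction `β`, sliding the place of this collision by `r`
moves the final position by `r (v(α) - v(β))` and changes nothing else. A square integrable function
on the plane with a nontrivial period vanishes (`ae_eq_zero_of_ae_flow_const`). No spectral
information on `Q` is used, only its positivity for short flights.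

*The solution.* The trace at `s = 0` is the density of collisions, and it satisfies the collision
balance. By transposition (`lintegral_add_jumpDual_mul_le_hit`), the absolute value of the solution
at time `t` is dominated by the evolution of the absolute value of the initial datum. With the
observable `1` this gives integrability. With the observable `|η|`, which is bounded and square
integrable for `equilibrium` because the mean free path is finite, it bounds the norm in question by
a quantity which tends to zero by weak decay; densities which are merely integrable are approximated
by bounded ones.
-/

namespace PeriodicLorentz

open ProbabilityTheory
open scoped ENNReal InnerProductSpace

/-! ### Euler's reflection formula for the dilogarithm -/

/-- The function `log u / (u - 1)`, extended by its limit `1` at `u = 1`. -/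
noncomputable def logQuot (u : ℝ) : ℝ := dslope Real.log 1 u

lemma logQuot_of_ne {u : ℝ} (hu : u ≠ 1) : logQuot u = Real.log u / (u - 1) := by
  rw [logQuot, dslope_of_ne _ hu, slope_def_field, Real.log_one, sub_zero]

lemma logQuot_one : logQuot 1 = 1 := by
  rw [logQuot, dslope_same, Real.deriv_log, inv_one]

lemma continuousOn_logQuot : ContinuousOn logQuot (Ioi 0) := by
  refine (continuousOn_dslope (Ioi_mem_nhds one_pos)).2
    ⟨Real.continuousOn_log.mono fun x hx ↦ ?_, Real.differentiableAt_log one_ne_zero⟩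
  exact (ne_of_gt hx)

lemma measurable_logQuot : Measurable logQuot := by
  have : logQuot = fun u ↦ if u = 1 then 1 else Real.log u / (u - 1) := by
    ext u
    split_ifs with h
    · rw [h, logQuot_one]
    · exact logQuot_of_ne h
  rw [this]
  exact Measurable.ite (measurableSet_singleton 1) measurable_const (by fun_prop)

lemma logQuot_nonneg {u : ℝ} (hu : 0 < u) : 0 ≤ logQuot u := by
  rcases eq_or_ne u 1 with rfl | h1
  · rw [logQuot_one]; exact zero_le_one
  rw [logQuot_of_ne h1]
  rcases lt_or_gt_of_ne h1 with h | h
  · exact div_nonneg_of_nonpos (Real.log_nonpos hu.le h.le) (by linarith)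
  · exact div_nonneg (Real.log_nonneg h.le) (by linarith)

lemma intervalIntegrable_logQuot {a b : ℝ} (ha : 0 < a) (hb : 0 < b) :
    IntervalIntegrable logQuot volume a b := by
  refine (continuousOn_logQuot.mono fun x hx ↦ ?_).intervalIntegrable
  exact lt_of_lt_of_le (lt_min ha hb) hx.1

lemma logQuot_le_one {u : ℝ} (hu : 1 ≤ u) : logQuot u ≤ 1 := by
  rcases eq_or_ne u 1 with rfl | h1
  · rw [logQuot_one]
  have h : 1 < u := lt_of_le_of_ne hu h1.symm
  rw [logQuot_of_ne h1, div_le_one (by linarith)]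
  exact Real.log_le_sub_one_of_pos (by linarith)

lemma logQuot_le_of_sq_le {N u : ℝ} (hN : 1 ≤ N) (hu : N ^ 2 ≤ u) : logQuot u ≤ 2 / N := by
  have hu1 : 1 ≤ u := le_trans (by nlinarith) hu
  rcases eq_or_ne u 1 with rfl | h1
  · have : N = 1 := by nlinarith
    subst this; rw [logQuot_one]; norm_num
  have h : 1 < u := lt_of_le_of_ne hu1 h1.symm
  have hsq : N ≤ √u := Real.le_sqrt_of_sq_le hu
  have hs : √u * √u = u := Real.mul_self_sqrt (by linarith)
  have hlog : Real.log u ≤ 2 * (√u - 1) := by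
    have := Real.log_le_sub_one_of_pos (x := √u) (by linarith)
    rw [Real.log_sqrt (by linarith)] at this
    linarith
  rw [logQuot_of_ne h1, div_le_div_iff₀ (by linarith) (by linarith)]
  nlinarith

lemma integral_logQuot_le {x : ℝ} (hx : 0 < x) (hx1 : x ≤ 1) :
    ∫ u in x..1, logQuot u ≤ π ^ 2 / 6 := by
  have hzeta : HasSum (fun n : ℕ ↦ 1 / ((n : ℝ) + 1) ^ 2) (π ^ 2 / 6) := by
    have := (hasSum_nat_add_iff' (f := fun n : ℕ ↦ (1 : ℝ) / (n : ℝ) ^ 2) 1).2 hasSum_zeta_two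
    simpa using this
  have hser : ∀ u ∈ Ioo x 1, HasSum (fun n : ℕ ↦ (1 - u) ^ n / (n + 1)) (logQuot u) := by
    intro u hu
    have h1 : |1 - u| < 1 := by rw [abs_lt]; constructor <;> linarith [hu.1, hu.2]
    have h2 := (Real.hasSum_pow_div_log_of_abs_lt_one h1).div_const (1 - u)
    rw [logQuot_of_ne hu.2.ne]
    have h3 : 1 - u ≠ 0 := by linarith [hu.2]
    convert! h2 using 1
    · ext n; field_simp; ring
    · rw [sub_sub_cancel, neg_div, ← div_neg, neg_sub]
  have hnn : ∀ u ∈ Ioo x 1, 0 ≤ logQuot u := fun u hu ↦ logQuot_nonneg (hx.trans hu.1)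
  rw [intervalIntegral.integral_of_le hx1, integral_Ioc_eq_integral_Ioo,
    integral_eq_lintegral_of_nonneg_ae
      ((ae_restrict_iff' measurableSet_Ioo).2 (Eventually.of_forall hnn))
      ((continuousOn_logQuot.mono fun u hu ↦ hx.trans hu.1).aestronglyMeasurable
        measurableSet_Ioo)]
  refine ENNReal.toReal_le_of_le_ofReal (by positivity) ?_
  calc ∫⁻ u in Ioo x 1, ENNReal.ofReal (logQuot u)
      = ∫⁻ u in Ioo x 1, ∑' n : ℕ, ENNReal.ofReal ((1 - u) ^ n / (n + 1)) := by
        refine setLIntegral_congr_fun measurableSet_Ioo fun u hu ↦ ?_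
        rw [← ENNReal.ofReal_tsum_of_nonneg _ (hser u hu).summable, (hser u hu).tsum_eq]
        intro n
        have : 0 ≤ 1 - u := by linarith [hu.2]
        positivity
    _ = ∑' n : ℕ, ∫⁻ u in Ioo x 1, ENNReal.ofReal ((1 - u) ^ n / (n + 1)) :=
        lintegral_tsum fun n ↦ by fun_prop
    _ ≤ ∑' n : ℕ, ENNReal.ofReal (1 / ((n : ℝ) + 1) ^ 2) := by
        refine ENNReal.tsum_le_tsum fun n ↦ ?_
        rw [← ofReal_integral_eq_lintegral_ofReal, ← integral_Ioc_eq_integral_Ioo,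
          ← intervalIntegral.integral_of_le hx1]
        · refine ENNReal.ofReal_le_ofReal ?_
          rw [intervalIntegral.integral_div,
            intervalIntegral.integral_comp_sub_left (fun u ↦ u ^ n), integral_pow, div_div, sq]
          gcongr
          have : 0 ≤ (1 - x) ^ (n + 1) := pow_nonneg (by linarith) _
          have : (1 - x) ^ (n + 1) ≤ 1 := pow_le_one₀ (by linarith) (by linarith)
          simpa using this
        · refine (Continuous.integrableOn_Icc (a := x) (b := 1) (by fun_prop)).mono_set
            Ioo_subset_Icc_self
        · refine (ae_restrict_iff' measurableSet_Ioo).2 (Eventually.of_forall fun u hu ↦ ?_)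
          have : 0 ≤ 1 - u := by linarith [hu.2]
          positivity
    _ = ENNReal.ofReal (π ^ 2 / 6) := by
        rw [← ENNReal.ofReal_tsum_of_nonneg (fun n ↦ by positivity) hzeta.summable, hzeta.tsum_eq]

/-- A sum of two integrals of `log u / (u - 1)` which does not depend on `a ∈ (0, 1)`: this is
Euler's reflection formula for the dilogarithm. -/
noncomputable def eulerReflection (a : ℝ) : ℝ :=
  (∫ u in (1 - a) / a..1 / a, logQuot u) + ∫ u in a / (1 - a)..1 / (1 - a), logQuot u

lemma hasDerivAt_integral_logQuot {x : ℝ} (hx : 0 < x) :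
    HasDerivAt (fun x ↦ ∫ u in (1 : ℝ)..x, logQuot u) (logQuot x) x := by
  refine intervalIntegral.integral_hasDerivAt_right (intervalIntegrable_logQuot one_pos hx) ?_ ?_
  · exact continuousOn_logQuot.stronglyMeasurableAtFilter isOpen_Ioi x hx
  · exact continuousOn_logQuot.continuousAt (Ioi_mem_nhds hx)

lemma eulerReflection_eq {a : ℝ} (ha : a ∈ Ioo (0 : ℝ) 1) :
    eulerReflection a
      = (∫ u in (1 : ℝ)..1 / a, logQuot u) - (∫ u in (1 : ℝ)..(1 - a) / a, logQuot u)
        + ((∫ u in (1 : ℝ)..1 / (1 - a), logQuot u) - ∫ u in (1 : ℝ)..a / (1 - a), logQuot u) := by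
  have h0 := ha.1
  have h1 : 0 < 1 - a := by linarith [ha.2]
  rw [eulerReflection, intervalIntegral.integral_interval_sub_left,
    intervalIntegral.integral_interval_sub_left] <;>
  exact intervalIntegrable_logQuot (by positivity) (by positivity)

lemma hasDerivAt_eulerReflection {a : ℝ} (ha : a ∈ Ioo (0 : ℝ) 1) :
    HasDerivAt eulerReflection 0 a := by
  have h0 := ha.1
  have h1 : 0 < 1 - a := by linarith [ha.2]
  have hd1 : HasDerivAt (fun a : ℝ ↦ 1 / a) (-1 / a ^ 2) a := by
    simpa [neg_div] using hasDerivAt_inv h0.ne'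
  have hd0 : HasDerivAt (fun a : ℝ ↦ 1 - a) (-1) a := by
    simpa using (hasDerivAt_id a).const_sub 1
  have hd2 : HasDerivAt (fun a : ℝ ↦ (1 - a) / a) ((-1 * a - (1 - a) * 1) / a ^ 2) a :=
    hd0.fun_div (hasDerivAt_id' a) h0.ne'
  have hd3 : HasDerivAt (fun a : ℝ ↦ 1 / (1 - a)) ((0 * (1 - a) - 1 * -1) / (1 - a) ^ 2) a :=
    (hasDerivAt_const a (1 : ℝ)).fun_div hd0 h1.ne'
  have hd4 : HasDerivAt (fun a : ℝ ↦ a / (1 - a)) ((1 * (1 - a) - a * -1) / (1 - a) ^ 2) a :=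
    (hasDerivAt_id' a).fun_div hd0 h1.ne'
  have e1 := (hasDerivAt_integral_logQuot (x := 1 / a) (by positivity)).comp
    (h := fun a ↦ 1 / a) a hd1
  have e2 := (hasDerivAt_integral_logQuot (x := (1 - a) / a) (by positivity)).comp
    (h := fun a ↦ (1 - a) / a) a hd2
  have e3 := (hasDerivAt_integral_logQuot (x := 1 / (1 - a)) (by positivity)).comp
    (h := fun a ↦ 1 / (1 - a)) a hd3
  have e4 := (hasDerivAt_integral_logQuot (x := a / (1 - a)) (by positivity)).comp
    (h := fun a ↦ a / (1 - a)) a hd4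
  have e := (e1.sub e2).add (e3.sub e4)
  refine (e.congr_of_eventuallyEq ?_).congr_deriv ?_
  · filter_upwards [isOpen_Ioo.mem_nhds ha] with b hb
    exact eulerReflection_eq hb
  · rcases eq_or_ne a (1 / 2) with rfl | hne
    · norm_num [logQuot_one]
    have hne' : 1 - 2 * a ≠ 0 := fun h ↦ hne (by linarith)
    have hne2 : a ≠ 1 - a := fun h ↦ hne (by linarith)
    rw [logQuot_of_ne, logQuot_of_ne, logQuot_of_ne, logQuot_of_ne, one_div, Real.log_inv,
      one_div, Real.log_inv, Real.log_div h1.ne' h0.ne', Real.log_div h0.ne' h1.ne']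
    · have k1 : a⁻¹ - 1 = (1 - a) / a := by field_simp
      have k2 : (1 - a) / a - 1 = (1 - 2 * a) / a := by field_simp; ring
      have k3 : (1 - a)⁻¹ - 1 = a / (1 - a) := by field_simp; ring
      have k4 : a / (1 - a) - 1 = -(1 - 2 * a) / (1 - a) := by field_simp; ring
      rw [k1, k2, k3, k4]
      generalize Real.log a = x
      generalize Real.log (1 - a) = y
      have h1' := h1.ne'
      have h0' := h0.ne'
      obtain ⟨d, hd⟩ : ∃ d, d = 1 - 2 * a := ⟨_, rfl⟩
      rw [← hd] at hne' ⊢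
      field_simp
      rw [hd]
      ring
    · rw [Ne, div_eq_one_iff_eq h1.ne']; exact hne2
    · rw [Ne, div_eq_one_iff_eq h1.ne']; linarith
    · rw [Ne, div_eq_one_iff_eq h0.ne']; exact hne2.symm
    · rw [Ne, div_eq_one_iff_eq h0.ne']; linarith [ha.2]

/-- The constant value of `eulerReflection` is bounded by its limit as `a → 0`, where the first
integral disappears and the second one becomes `∑ 1 / n ^ 2`. -/
lemma eulerReflection_le {a : ℝ} (ha : a ∈ Ioo (0 : ℝ) 1) : eulerReflection a ≤ π ^ 2 / 6 := by
  have hconst : ∀ b ∈ Ioo (0 : ℝ) 1, eulerReflection a = eulerReflection b := by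
    intro b hb
    exact isOpen_Ioo.is_const_of_deriv_eq_zero isPreconnected_Ioo
      (fun x hx ↦ (hasDerivAt_eulerReflection hx).differentiableAt.differentiableWithinAt)
      (fun x hx ↦ (hasDerivAt_eulerReflection hx).deriv) ha hb
  have hbound : ∀ N : ℕ, eulerReflection a ≤ π ^ 2 / 6 + 2 / ((N : ℝ) + 1)
      + 1 / ((N : ℝ) + 1) := by
    intro N
    set M : ℝ := (N : ℝ) + 1 with hM
    have hM1 : 1 ≤ M := by rw [hM]; linarith [(Nat.cast_nonneg N : (0 : ℝ) ≤ N)]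
    have hM2 : 1 ≤ M ^ 2 := by nlinarith
    have hb : 1 / (M ^ 2 + 1) ∈ Ioo (0 : ℝ) 1 :=
      ⟨by positivity, by rw [div_lt_one (by positivity)]; linarith⟩
    rw [hconst _ hb, eulerReflection]
    have k1 : (1 - 1 / (M ^ 2 + 1)) / (1 / (M ^ 2 + 1)) = M ^ 2 := by field_simp; ring
    have k2 : 1 / (1 / (M ^ 2 + 1)) = M ^ 2 + 1 := by field_simp
    have k3 : 1 / (M ^ 2 + 1) / (1 - 1 / (M ^ 2 + 1)) = 1 / M ^ 2 := by
      have : 1 - 1 / (M ^ 2 + 1) = M ^ 2 / (M ^ 2 + 1) := by field_simp; ring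
      rw [this]; field_simp
    have k4 : 1 / (1 - 1 / (M ^ 2 + 1)) = 1 + 1 / M ^ 2 := by
      have : 1 - 1 / (M ^ 2 + 1) = M ^ 2 / (M ^ 2 + 1) := by field_simp; ring
      rw [this]; field_simp
    rw [k1, k2, k3, k4]
    have i1 : ∫ u in M ^ 2..M ^ 2 + 1, logQuot u ≤ 2 / M := by
      have := intervalIntegral.integral_mono_on (a := M ^ 2) (b := M ^ 2 + 1) (by linarith)
        (intervalIntegrable_logQuot (by positivity) (by positivity))
        (intervalIntegrable_const (c := 2 / M)) fun u hu ↦ logQuot_le_of_sq_le hM1 hu.1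
      simpa using this
    have i2 : ∫ u in (1 : ℝ)..1 + 1 / M ^ 2, logQuot u ≤ 1 / M := by
      have h := intervalIntegral.integral_mono_on (a := 1) (b := 1 + 1 / M ^ 2)
        (by linarith [show 0 < 1 / M ^ 2 by positivity])
        (intervalIntegrable_logQuot (by positivity) (by positivity))
        (intervalIntegrable_const (c := 1)) fun u hu ↦ logQuot_le_one hu.1
      have h' : 1 / M ^ 2 ≤ 1 / M := one_div_le_one_div_of_le (by positivity) (by nlinarith)
      simp at h h' ⊢
      linarith
    have i3 := integral_logQuot_le (x := 1 / M ^ 2) (by positivity)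
      (by rw [div_le_one (by positivity)]; exact hM2)
    have i4 := intervalIntegral.integral_add_adjacent_intervals
      (intervalIntegrable_logQuot (a := 1 / M ^ 2) (b := 1) (by positivity) (by positivity))
      (intervalIntegrable_logQuot (a := 1) (b := 1 + 1 / M ^ 2) (by positivity) (by positivity))
    linarith
  have hlim : Tendsto (fun N : ℕ ↦ π ^ 2 / 6 + 2 / ((N : ℝ) + 1) + 1 / ((N : ℝ) + 1)) atTop
      (𝓝 (π ^ 2 / 6 + 0 + 0)) := by
    refine (tendsto_const_nhds.add ?_).add tendsto_one_div_add_atTop_nhds_zero_nat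
    simpa [div_eq_mul_inv] using
      (tendsto_one_div_add_atTop_nhds_zero_nat (𝕜 := ℝ)).const_mul 2
  rw [add_zero, add_zero] at hlim
  exact ge_of_tendsto' hlim hbound

/-! ### The transition kernel -/

lemma Q_eq_of_add_nonneg (s : ℝ) {h h' : ℝ} (hh : 0 ≤ h + h') :
    Q s h h' = kernelBase s (max h h') (min h h') := by
  unfold Q
  split_ifs with h1 h2 h3
  · rw [max_eq_left (abs_le.1 h1).2, min_eq_right (abs_le.1 h1).2]
  · have e : h' = -h := le_antisymm (abs_le.1 h2).2 (by linarith)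
    have : 0 ≤ -h := (abs_nonneg _).trans h2
    rw [max_eq_right (by linarith), min_eq_left (by linarith), e, neg_neg]
  · rw [max_eq_right (abs_le.1 h3).2, min_eq_left (abs_le.1 h3).2]
  · exfalso
    rcases le_total h' h with h4 | h4
    · exact h1 (abs_le.2 ⟨by linarith, h4⟩)
    · exact h3 (abs_le.2 ⟨by linarith, h4⟩)

lemma Q_eq_of_add_nonpos (s : ℝ) {h h' : ℝ} (hh : h + h' ≤ 0) :
    Q s h h' = kernelBase s (max (-h) (-h')) (min (-h) (-h')) := by
  unfold Q
  split_ifs with h1 h2 h3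
  · have e : h' = -h := le_antisymm (by linarith) (abs_le.1 h1).1
    have : 0 ≤ h := (abs_nonneg _).trans h1
    rw [e, neg_neg, max_eq_right (by linarith), min_eq_left (by linarith)]
  · have := (abs_le.1 h2).1
    rw [max_eq_left (by linarith), min_eq_right (by linarith)]
  · have e : h' = -h := by linarith [(abs_le.1 h3).1]
    have : 0 ≤ h' := (abs_nonneg _).trans h3
    have h4 : h = -h' := by linarith
    rw [h4, neg_neg, max_eq_left (by linarith), min_eq_right (by linarith)]
  · rcases le_total h h' with h4 | h4
    · exact absurd (abs_le.2 ⟨by linarith, by linarith⟩) h2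
    · rw [max_eq_right (by linarith), min_eq_left (by linarith)]

lemma Q_symm (s h h' : ℝ) : Q s h h' = Q s h' h := by
  rcases le_total 0 (h + h') with hh | hh
  · rw [Q_eq_of_add_nonneg s hh, Q_eq_of_add_nonneg s (by linarith), max_comm, min_comm]
  · rw [Q_eq_of_add_nonpos s hh, Q_eq_of_add_nonpos s (by linarith), max_comm, min_comm]

lemma kernelBase_of_neg {s : ℝ} (hs : s < 0) (p q : ℝ) : kernelBase s p q = 0 := by
  simp [kernelBase, hs]

lemma Q_of_neg {s : ℝ} (hs : s < 0) (h h' : ℝ) : Q s h h' = 0 := by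
  unfold Q; split_ifs <;> exact kernelBase_of_neg hs _ _

lemma kernelBase_nonneg {p q : ℝ} (hqp : q ≤ p) (s : ℝ) : 0 ≤ kernelBase s p q := by
  unfold kernelBase
  refine mul_nonneg (by positivity) ?_
  split_ifs with h1 h2 h3
  · exact le_rfl
  · exact zero_le_one
  · have hs : 0 < s := by
      rcases (not_lt.1 h1).eq_or_lt with h | h
      · subst h; simp at h2
      · exact h
    refine div_nonneg ?_ (by linarith)
    rw [sub_nonneg, le_div_iff₀ hs]; linarith
  · exact le_rfl

/-- The mean free path is finite because of this bound: where `s` is large, the kernel decays like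
`1 / s` until it vanishes at `s = 1 / (1 + q)`. -/
lemma mul_kernelBase_le {p q s : ℝ} (hp : 0 ≤ p) (hqp : q ≤ p) (hq : -1 < q) :
    s * kernelBase s p q ≤ if s ∈ Ioc 0 (1 / (1 + q)) then 6 / π ^ 2 else 0 := by
  have hq' : 0 < 1 + q := by linarith
  have hiff : s ≤ 1 / (1 + q) ↔ s * (1 + q) ≤ 1 := le_div_iff₀ hq'
  unfold kernelBase
  split_ifs with h1 h2 h3 h4 h5 h6 h7
  · linarith [h2.1]
  · simp
  · have : s ≤ 1 := by nlinarith [h4.1]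
    have h6 : 0 ≤ 6 / π ^ 2 := by positivity
    nlinarith
  · rcases (not_lt.1 h1).eq_or_lt with h | h
    · subst h; simp
    · exact absurd ⟨h, hiff.2 (by nlinarith)⟩ h4
  · have hs := h6.1
    have hpq : 0 < p - q := by nlinarith
    have : s * ((1 / s - (1 + q)) / (p - q)) ≤ 1 := by
      rw [mul_div_assoc', div_le_one hpq, mul_sub, mul_one_div_cancel hs.ne']
      nlinarith
    have h6 : 0 ≤ 6 / π ^ 2 := by positivity
    nlinarith
  · rcases (not_lt.1 h1).eq_or_lt with h | h
    · subst h; simp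
    · exact absurd ⟨h, hiff.2 h5⟩ h6
  · rw [mul_zero, mul_zero]; positivity
  · simp

lemma kernelBase_of_le_half {p q s : ℝ} (hs0 : 0 ≤ s) (hs : s ≤ 1 / 2)
    (hp1 : p ≤ 1) : kernelBase s p q = 6 / π ^ 2 := by
  rw [kernelBase, if_neg (not_lt.2 hs0), if_pos (by nlinarith), mul_one]

lemma Q_nonneg (s h h' : ℝ) : 0 ≤ Q s h h' := by
  rcases le_total 0 (h + h') with hh | hh
  · rw [Q_eq_of_add_nonneg s hh]; exact kernelBase_nonneg min_le_max _
  · rw [Q_eq_of_add_nonpos s hh]; exact kernelBase_nonneg min_le_max _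

lemma Q_of_le_half {s h h' : ℝ} (hs0 : 0 ≤ s) (hs : s ≤ 1 / 2) (hh : h ∈ Ioo (-1 : ℝ) 1)
    (hh' : h' ∈ Ioo (-1 : ℝ) 1) : Q s h h' = 6 / π ^ 2 := by
  rcases le_total 0 (h + h') with k | k
  · rw [Q_eq_of_add_nonneg s k]
    exact kernelBase_of_le_half hs0 hs (max_le hh.2.le hh'.2.le)
  · rw [Q_eq_of_add_nonpos s k]
    exact kernelBase_of_le_half hs0 hs (max_le (by linarith [hh.1]) (by linarith [hh'.1]))

lemma measurable_kernelBase :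
    Measurable fun p : ℝ × ℝ × ℝ ↦ kernelBase p.1 p.2.1 p.2.2 := by
  unfold kernelBase
  refine measurable_const.mul (Measurable.ite ?_ measurable_const (Measurable.ite ?_
    measurable_const (Measurable.ite ?_ ?_ measurable_const)))
  · exact measurableSet_lt (by fun_prop) (by fun_prop)
  · exact measurableSet_le (by fun_prop) (by fun_prop)
  · exact measurableSet_le (by fun_prop) (by fun_prop)
  · fun_prop

lemma measurable_Q : Measurable fun p : ℝ × ℝ × ℝ ↦ Q p.1 p.2.1 p.2.2 := by
  have key : ∀ f : ℝ × ℝ × ℝ → ℝ × ℝ × ℝ, Measurable f →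
      Measurable fun p ↦ kernelBase (f p).1 (f p).2.1 (f p).2.2 :=
    fun f hf ↦ measurable_kernelBase.comp hf
  have habs : Measurable fun x : ℝ ↦ |x| := measurable_norm
  unfold Q
  refine Measurable.ite ?_ measurable_kernelBase (Measurable.ite ?_
    (key (fun p ↦ (p.1, -p.2.1, -p.2.2)) (by fun_prop)) (Measurable.ite ?_
    (key (fun p ↦ (p.1, p.2.2, p.2.1)) (by fun_prop))
    (key (fun p ↦ (p.1, -p.2.2, -p.2.1)) (by fun_prop))))
  all_goals exact measurableSet_le (by fun_prop) (by fun_prop)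

/-- The distribution of the free flight times: `∫ Q ds` is a difference quotient of `log`. -/
lemma lintegral_kernelBase_le {p q : ℝ} (hq : -1 < q) (hqp : q < p) :
    ∫⁻ s, ENNReal.ofReal (kernelBase s p q)
      ≤ ENNReal.ofReal (6 / π ^ 2 * ((Real.log (1 + p) - Real.log (1 + q)) / (p - q))) := by
  have hb : 0 < 1 + q := by linarith
  have ha : 0 < 1 + p := by linarith
  have hab : 1 / (1 + p) ≤ 1 / (1 + q) := one_div_le_one_div_of_le hb (by linarith)
  have hpq : 0 < p - q := by linarith
  set c : ℝ := 6 / π ^ 2 with hc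
  have hc0 : 0 ≤ c := by positivity
  set k : ℝ → ℝ := fun s ↦ c * ((1 / s - (1 + q)) / (p - q)) with hk
  have hcont : ContinuousOn k (Icc (1 / (1 + p)) (1 / (1 + q))) := by
    refine ContinuousOn.mul continuousOn_const (ContinuousOn.div_const
      (ContinuousOn.sub (continuousOn_const.div continuousOn_id fun s hs ↦ ?_)
        continuousOn_const) _)
    exact (lt_of_lt_of_le (by positivity) hs.1).ne'
  have hknn : ∀ s ∈ Ioc (1 / (1 + p)) (1 / (1 + q)), 0 ≤ k s := by
    intro s hs
    have hs0 : 0 < s := lt_trans (by positivity) hs.1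
    refine mul_nonneg hc0 (div_nonneg ?_ hpq.le)
    rw [sub_nonneg, le_div_iff₀ hs0, mul_comm, ← le_div_iff₀ hb]
    exact hs.2
  have hpt : ∀ s, ENNReal.ofReal (kernelBase s p q)
      ≤ (Icc 0 (1 / (1 + p))).indicator (fun _ ↦ ENNReal.ofReal c) s
        + (Ioc (1 / (1 + p)) (1 / (1 + q))).indicator (fun s ↦ ENNReal.ofReal (k s)) s := by
    intro s
    unfold kernelBase
    split_ifs with h1 h2 h3
    · simp
    · rw [indicator_of_mem (show s ∈ Icc 0 (1 / (1 + p)) from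
        ⟨not_lt.1 h1, (le_div_iff₀ ha).2 h2⟩), mul_one]
      exact le_self_add
    · rw [indicator_of_mem (show s ∈ Ioc (1 / (1 + p)) (1 / (1 + q)) from
        ⟨(div_lt_iff₀ ha).2 (not_le.1 h2), (le_div_iff₀ hb).2 h3⟩)]
      exact le_add_self
    · simp
  calc ∫⁻ s, ENNReal.ofReal (kernelBase s p q)
      ≤ ∫⁻ s, ((Icc 0 (1 / (1 + p))).indicator (fun _ ↦ ENNReal.ofReal c) s
        + (Ioc (1 / (1 + p)) (1 / (1 + q))).indicator (fun s ↦ ENNReal.ofReal (k s)) s) :=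
        lintegral_mono hpt
    _ = ENNReal.ofReal c * ENNReal.ofReal (1 / (1 + p))
        + ENNReal.ofReal (∫ s in 1 / (1 + p)..1 / (1 + q), k s) := by
        rw [lintegral_add_left (measurable_const.indicator measurableSet_Icc),
          lintegral_indicator_const measurableSet_Icc, Real.volume_Icc, sub_zero,
          lintegral_indicator measurableSet_Ioc, intervalIntegral.integral_of_le hab,
          ofReal_integral_eq_lintegral_ofReal]
        · exact (hcont.integrableOn_Icc).mono_set Ioc_subset_Icc_self
        · exact (ae_restrict_iff' measurableSet_Ioc).2 (Eventually.of_forall hknn)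
    _ = _ := by
        have h0 : ∫ s in 1 / (1 + p)..1 / (1 + q), k s
            = c * ((Real.log (1 + p) - Real.log (1 + q) - (1 - (1 + q) / (1 + p))) / (p - q)) := by
          have hmem : (0 : ℝ) ∉ uIcc (1 / (1 + p)) (1 / (1 + q)) := by
            rw [uIcc_of_le hab]
            exact fun h ↦ absurd h.1 (not_le.2 (by positivity))
          rw [hk, intervalIntegral.integral_const_mul, intervalIntegral.integral_div,
            intervalIntegral.integral_sub _ (intervalIntegrable_const), integral_one_div hmem,
            intervalIntegral.integral_const]
          · congr 2
            rw [div_div_div_cancel_left' _ _ one_ne_zero, Real.log_div ha.ne' hb.ne', smul_eq_mul,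
              sub_mul, one_div_mul_cancel hb.ne', one_div_mul_eq_div]
          · exact intervalIntegral.intervalIntegrable_one_div (fun s hs h ↦ hmem (h ▸ hs))
              continuousOn_id
        rw [← ENNReal.ofReal_mul hc0, ← ENNReal.ofReal_add (by positivity), h0]
        · congr 1
          field_simp
          ring
        · exact intervalIntegral.integral_nonneg_of_ae_restrict hab
            ((ae_restrict_iff' measurableSet_Icc).2 ((Ioc_ae_eq_Icc (a := 1 / (1 + p))
              (b := 1 / (1 + q)) (μ := volume)).mem_iff.mono fun s hs hs' ↦ hknn s (hs.2 hs')))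

/-! ### Mass and first moment of the transition rates -/

/-- The transition density `Q(s,h|h')` with values in `[0, ∞]`, set to zero unless both impact
parameters are in the open interval `(-1, 1)`. -/
noncomputable def rate (s h h' : ℝ) : ℝ≥0∞ :=
  if h ∈ Ioo (-1 : ℝ) 1 ∧ h' ∈ Ioo (-1 : ℝ) 1 then ENNReal.ofReal (Q s h h') else 0

lemma rate_symm (s h h' : ℝ) : rate s h h' = rate s h' h := by
  simp only [rate, Q_symm s h h', and_comm]

lemma rate_of_neg {s : ℝ} (hs : s < 0) (h h' : ℝ) : rate s h h' = 0 := by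
  simp [rate, Q_of_neg hs]

lemma rate_of_notMem {h : ℝ} (hh : h ∉ Ioo (-1 : ℝ) 1) (s h' : ℝ) : rate s h h' = 0 :=
  if_neg fun H ↦ hh H.1

lemma rate_of_le_half {s h h' : ℝ} (hs0 : 0 ≤ s) (hs : s ≤ 1 / 2) (hh : h ∈ Ioo (-1 : ℝ) 1)
    (hh' : h' ∈ Ioo (-1 : ℝ) 1) : rate s h h' = ENNReal.ofReal (6 / π ^ 2) := by
  rw [rate, if_pos ⟨hh, hh'⟩, Q_of_le_half hs0 hs hh hh']

lemma measurable_rate : Measurable fun p : ℝ × ℝ × ℝ ↦ rate p.1 p.2.1 p.2.2 := by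
  refine Measurable.ite ?_ measurable_Q.ennreal_ofReal measurable_const
  exact (measurable_snd.fst measurableSet_Ioo).inter (measurable_snd.snd measurableSet_Ioo)

@[fun_prop]
lemma _root_.Measurable.rate {α : Type*} [MeasurableSpace α] {f g k : α → ℝ} (hf : Measurable f)
    (hg : Measurable g) (hk : Measurable k) : Measurable fun a ↦ rate (f a) (g a) (k a) :=
  measurable_rate.comp (hf.prodMk (hg.prodMk hk))

lemma lintegral_rate_le_of_pos {h h' : ℝ} (hh : h ∈ Ioo (-h') 1) (hh' : h' ∈ Ioo (-1 : ℝ) 1)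
    (hne : h ≠ h') : ∫⁻ s, rate s h h'
      ≤ ENNReal.ofReal (6 / π ^ 2 * (logQuot ((1 + h) / (1 + h')) / (1 + h'))) := by
  have h1 : h ∈ Ioo (-1 : ℝ) 1 := ⟨by linarith [hh.1, hh'.2], hh.2⟩
  have h2 : 0 < 1 + h := by linarith [h1.1]
  have h3 : 0 < 1 + h' := by linarith [hh'.1]
  simp only [rate, if_pos (And.intro h1 hh'), Q_eq_of_add_nonneg _
    (show 0 ≤ h + h' by linarith [hh.1])]
  refine (lintegral_kernelBase_le (lt_min h1.1 hh'.1) (min_lt_max.2 hne)).trans_eq ?_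
  congr 2
  have h5 : (1 + h) / (1 + h') ≠ 1 := fun H ↦ hne (by rw [div_eq_one_iff_eq h3.ne'] at H; linarith)
  rw [logQuot_of_ne h5, Real.log_div h2.ne' h3.ne']
  have h6 : (1 + h) / (1 + h') - 1 = (h - h') / (1 + h') := by field_simp; ring
  rw [h6, div_div, div_mul_cancel₀ _ h3.ne']
  rcases lt_or_gt_of_ne hne with h7 | h7
  · rw [max_eq_right h7.le, min_eq_left h7.le, ← neg_sub (Real.log (1 + h)), ← neg_sub h,
      neg_div_neg_eq]
  · rw [max_eq_left h7.le, min_eq_right h7.le]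

lemma rate_neg_neg {s h h' : ℝ} (hh : h + h' ≠ 0) : rate s (-h) (-h') = rate s h h' := by
  have e : ∀ x : ℝ, -x ∈ Ioo (-1 : ℝ) 1 ↔ x ∈ Ioo (-1 : ℝ) 1 := fun x ↦
    ⟨fun H ↦ ⟨by linarith [H.2], by linarith [H.1]⟩, fun H ↦ ⟨by linarith [H.2], by linarith [H.1]⟩⟩
  simp only [rate, e]
  rcases lt_or_gt_of_ne hh with k | k
  · rw [Q_eq_of_add_nonpos s k.le, Q_eq_of_add_nonneg s (by linarith)]
  · rw [Q_eq_of_add_nonneg s k.le, Q_eq_of_add_nonpos s (by linarith), neg_neg, neg_neg]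

lemma lintegral_logQuot_div_eq {b : ℝ} (hb : b ∈ Ioo (-1 : ℝ) 1) :
    ∫⁻ h in Ioo (-b) 1, ENNReal.ofReal (6 / π ^ 2 * (logQuot ((1 + h) / (1 + b)) / (1 + b)))
      = ENNReal.ofReal (6 / π ^ 2 * ∫ u in (1 - b) / (1 + b)..2 / (1 + b), logQuot u) := by
  have h3 : 0 < 1 + b := by linarith [hb.1]
  have h4 : 0 < 1 - b := by linarith [hb.2]
  have h0 : -b ≤ 1 := by linarith [hb.1]
  have hcont : ContinuousOn (fun h ↦ 6 / π ^ 2 * (logQuot ((1 + h) / (1 + b)) / (1 + b)))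
      (Icc (-b) 1) := by
    refine continuousOn_const.mul (ContinuousOn.div_const (continuousOn_logQuot.comp
      (by fun_prop) fun h hh ↦ ?_) _)
    exact div_pos (by linarith [hh.1]) h3
  rw [← ofReal_integral_eq_lintegral_ofReal, ← integral_Ioc_eq_integral_Ioo,
    ← intervalIntegral.integral_of_le h0, intervalIntegral.integral_const_mul,
    intervalIntegral.integral_div]
  · congr 2
    have := intervalIntegral.integral_comp_add_mul (a := -b) (b := 1) logQuot
      (inv_pos.2 h3).ne' (1 + b)⁻¹
    have e : ∀ h, (1 + b)⁻¹ + (1 + b)⁻¹ * h = (1 + h) / (1 + b) := fun h ↦ by field_simp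
    simp only [e] at this
    rw [this, inv_inv, smul_eq_mul, mul_div_cancel_left₀ _ h3.ne']
    norm_num [sub_eq_add_neg]
  · exact (hcont.integrableOn_Icc).mono_set Ioo_subset_Icc_self
  · refine (ae_restrict_iff' measurableSet_Ioo).2 (Eventually.of_forall fun h hh ↦ ?_)
    exact mul_nonneg (by positivity) (div_nonneg
      (logQuot_nonneg (div_pos (by linarith [hh.1, hb.2]) h3)) h3.le)

lemma integral_logQuot_nonneg {a b : ℝ} (ha : 0 < a) (hab : a ≤ b) :
    0 ≤ ∫ u in a..b, logQuot u :=
  intervalIntegral.integral_nonneg hab fun _ hu ↦ logQuot_nonneg (ha.trans_le hu.1)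

/-- The total mass of the transition kernel is at most one. (It is equal to one.) -/
lemma lintegral_lintegral_rate_le_one (h' : ℝ) : ∫⁻ h, ∫⁻ s, rate s h h' ≤ 1 := by
  by_cases hh' : h' ∈ Ioo (-1 : ℝ) 1
  swap
  · simp [rate_symm _ _ h', rate_of_notMem hh']
  have h3 : 0 < 1 + h' := by linarith [hh'.1]
  have h4 : 0 < 1 - h' := by linarith [hh'.2]
  have hneg : -h' ∈ Ioo (-1 : ℝ) 1 := ⟨by linarith, by linarith⟩
  set K : ℝ → ℝ → ℝ≥0∞ := fun b h ↦
    ENNReal.ofReal (6 / π ^ 2 * (logQuot ((1 + h) / (1 + b)) / (1 + b))) with hK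
  have hmeas : ∀ b : ℝ, Measurable ((Ioo (-b) 1).indicator (K b)) := by
    intro b
    have := measurable_logQuot
    exact Measurable.indicator (by fun_prop) measurableSet_Ioo
  have hae : ∀ᵐ h : ℝ, ∫⁻ s, rate s h h' ≤ (Ioo (-h') 1).indicator (K h') h
      + (Ioo (- -h') 1).indicator (K (-h')) (-h) := by
    filter_upwards [compl_mem_ae_iff.2 (measure_singleton (h' : ℝ)),
      compl_mem_ae_iff.2 (measure_singleton (-h' : ℝ))] with h e1 e2
    have e1 : h ≠ h' := e1
    have e2 : h ≠ -h' := e2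
    by_cases hh : h ∈ Ioo (-1 : ℝ) 1
    swap
    · simp [rate_of_notMem hh]
    rcases lt_or_gt_of_ne e2 with k | k
    · rw [indicator_of_mem (show -h ∈ Ioo (- -h') 1 from ⟨by linarith, by linarith [hh.1]⟩)]
      refine le_trans ?_ le_add_self
      have := lintegral_rate_le_of_pos (h := -h) (h' := -h') ⟨by linarith, by linarith [hh.1]⟩ hneg
        (fun H ↦ e1 (neg_injective H))
      simpa only [rate_neg_neg (show h + h' ≠ 0 from fun H ↦ e2 (by linarith))] using this
    · rw [indicator_of_mem (show h ∈ Ioo (-h') 1 from ⟨k, hh.2⟩)]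
      exact (lintegral_rate_le_of_pos ⟨k, hh.2⟩ hh' e1).trans le_self_add
  calc ∫⁻ h, ∫⁻ s, rate s h h'
      ≤ ∫⁻ h, ((Ioo (-h') 1).indicator (K h') h + (Ioo (- -h') 1).indicator (K (-h')) (-h)) :=
        lintegral_mono_ae hae
    _ = (∫⁻ h, (Ioo (-h') 1).indicator (K h') h)
          + ∫⁻ h, (Ioo (- -h') 1).indicator (K (-h')) h := by
        rw [lintegral_add_left (hmeas _),
          lintegral_neg_eq_self (fun h ↦ (Ioo (- -h') 1).indicator (K (-h')) h)]
    _ = ENNReal.ofReal (6 / π ^ 2 * eulerReflection ((1 + h') / 2)) := by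
        rw [lintegral_indicator measurableSet_Ioo, lintegral_indicator measurableSet_Ioo,
          lintegral_logQuot_div_eq hh', lintegral_logQuot_div_eq hneg,
          ← ENNReal.ofReal_add, ← mul_add]
        · have i1 : 1 - (1 + h') / 2 = (1 - h') / 2 := by ring
          rw [eulerReflection, i1]
          have k1 : (1 - h') / 2 / ((1 + h') / 2) = (1 - h') / (1 + h') := by field_simp
          have k2 : 1 / ((1 + h') / 2) = 2 / (1 + h') := by field_simp
          have k3 : (1 + h') / 2 / ((1 - h') / 2) = (1 - -h') / (1 + -h') := by
            rw [← sub_eq_add_neg, sub_neg_eq_add]; field_simp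
          have k4 : 1 / ((1 - h') / 2) = 2 / (1 + -h') := by
            rw [← sub_eq_add_neg]; field_simp
          rw [k1, k2, k3, k4]
        · exact mul_nonneg (by positivity) (integral_logQuot_nonneg (by positivity)
            (by gcongr; linarith [hh'.1]))
        · have : 0 < 1 + -h' := by linarith
          refine mul_nonneg (by positivity) (integral_logQuot_nonneg (div_pos (by linarith) this)
            (by gcongr; linarith))
    _ ≤ ENNReal.ofReal (6 / π ^ 2 * (π ^ 2 / 6)) := by
        gcongr
        exact eulerReflection_le ⟨by linarith, by linarith⟩
    _ = 1 := by
        have : 6 / π ^ 2 * (π ^ 2 / 6) = 1 := by field_simp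
        rw [this, ENNReal.ofReal_one]

lemma lintegral_mul_kernelBase_le {p q : ℝ} (hp : 0 ≤ p) (hqp : q ≤ p) (hq : -1 < q) :
    ∫⁻ s, ENNReal.ofReal s * ENNReal.ofReal (kernelBase s p q)
      ≤ ENNReal.ofReal (6 / π ^ 2) * ENNReal.ofReal (1 / (1 + q)) := by
  calc ∫⁻ s, ENNReal.ofReal s * ENNReal.ofReal (kernelBase s p q)
      ≤ ∫⁻ s, (Ioc 0 (1 / (1 + q))).indicator (fun _ ↦ ENNReal.ofReal (6 / π ^ 2)) s := by
        refine lintegral_mono fun s ↦ ?_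
        rcases le_total s 0 with hs | hs
        · simp [ENNReal.ofReal_of_nonpos hs]
        rw [← ENNReal.ofReal_mul hs]
        refine (ENNReal.ofReal_le_ofReal (mul_kernelBase_le hp hqp hq)).trans_eq ?_
        by_cases h : s ∈ Ioc 0 (1 / (1 + q)) <;> simp only [h, if_true, if_false,
          indicator_of_mem, indicator_of_notMem, not_false_eq_true, ENNReal.ofReal_zero]
    _ = _ := by
        rw [lintegral_indicator_const measurableSet_Ioc, Real.volume_Ioc, sub_zero]

lemma one_div_one_add_le {p q : ℝ} (hq1 : -1 < q) (hq : |q| ≤ p) (hp : p < 1) :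
    1 / (1 + q) ≤ 2 * (√(1 - p ^ 2)⁻¹ * √(1 - q ^ 2)⁻¹) := by
  have hsq : q ^ 2 ≤ p ^ 2 := by
    rw [← sq_abs q]; exact pow_le_pow_left₀ (abs_nonneg q) hq 2
  have h0 : 0 ≤ p := (abs_nonneg q).trans hq
  have h1 : 0 < 1 - p ^ 2 := by nlinarith
  have h2 : 0 < 1 - q ^ 2 := by linarith
  rw [← Real.sqrt_mul (inv_nonneg.2 h1.le), ← mul_inv, Real.sqrt_inv, ← div_eq_mul_inv]
  have h3 : √((1 - p ^ 2) * (1 - q ^ 2)) ≤ 1 - q ^ 2 := Real.sqrt_le_iff.2 ⟨h2.le, by nlinarith⟩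
  have h4 : 0 < √((1 - p ^ 2) * (1 - q ^ 2)) := Real.sqrt_pos.2 (by positivity)
  rw [div_le_div_iff₀ (by linarith) h4]
  nlinarith [(abs_le.1 hq).2]

lemma lintegral_mul_rate_le (h h' : ℝ) :
    ∫⁻ s, ENNReal.ofReal s * rate s h h'
      ≤ ENNReal.ofReal (6 / π ^ 2) * (2 *
        ((Ioo (-1 : ℝ) 1).indicator (fun h ↦ ENNReal.ofReal √(1 - h ^ 2)⁻¹) h *
        (Ioo (-1 : ℝ) 1).indicator (fun h ↦ ENNReal.ofReal √(1 - h ^ 2)⁻¹) h')) := by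
  by_cases hh : h ∈ Ioo (-1 : ℝ) 1 ∧ h' ∈ Ioo (-1 : ℝ) 1
  swap
  · simp only [rate, if_neg hh, mul_zero, lintegral_zero, zero_le]
  have main : ∀ p q : ℝ, -1 < q → |q| ≤ p → p < 1 →
      ∫⁻ s, ENNReal.ofReal s * ENNReal.ofReal (kernelBase s p q) ≤ ENNReal.ofReal (6 / π ^ 2) *
        (2 * (ENNReal.ofReal √(1 - p ^ 2)⁻¹ * ENNReal.ofReal √(1 - q ^ 2)⁻¹)) := by
    intro p q hq hqp hp
    refine (lintegral_mul_kernelBase_le ((abs_nonneg q).trans hqp) (abs_le.1 hqp).2 hq).trans ?_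
    gcongr
    rw [← ENNReal.ofReal_mul (by positivity), ← ENNReal.ofReal_ofNat 2,
      ← ENNReal.ofReal_mul (by positivity)]
    exact ENNReal.ofReal_le_ofReal (one_div_one_add_le hq hqp hp)
  rw [indicator_of_mem hh.1, indicator_of_mem hh.2]
  simp only [rate, if_pos hh]
  obtain ⟨⟨a1, a2⟩, a3, a4⟩ := hh
  rcases le_total 0 (h + h') with k | k
  · simp only [Q_eq_of_add_nonneg _ k]
    rcases le_total h h' with l | l
    · rw [max_eq_right l, min_eq_left l, mul_comm (ENNReal.ofReal √(1 - h ^ 2)⁻¹)]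
      exact main _ _ a1 (abs_le.2 ⟨by linarith, l⟩) a4
    · rw [max_eq_left l, min_eq_right l]
      exact main _ _ a3 (abs_le.2 ⟨by linarith, l⟩) a2
  · simp only [Q_eq_of_add_nonpos _ k]
    rcases le_total h h' with l | l
    · rw [max_eq_left (neg_le_neg l), min_eq_right (neg_le_neg l), ← neg_sq h, ← neg_sq h']
      exact main _ _ (by linarith) (abs_le.2 ⟨by linarith, by linarith⟩) (by linarith)
    · rw [max_eq_right (neg_le_neg l), min_eq_left (neg_le_neg l),
        mul_comm (ENNReal.ofReal √(1 - h ^ 2)⁻¹), ← neg_sq h, ← neg_sq h']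
      exact main _ _ (by linarith) (abs_le.2 ⟨by linarith, by linarith⟩) (by linarith)

/-- The mean free path is finite. -/
lemma lintegral_mul_rate_lt_top :
    ∫⁻ h, ∫⁻ h', ∫⁻ s, ENNReal.ofReal s * rate s h h' < ∞ := by
  set g : ℝ → ℝ≥0∞ := (Ioo (-1 : ℝ) 1).indicator (fun h ↦ ENNReal.ofReal √(1 - h ^ 2)⁻¹) with hg
  have hgm : Measurable g := by
    refine Measurable.indicator ?_ measurableSet_Ioo
    fun_prop
  have hgi : ∫⁻ h, g h < ∞ := by
    rw [hg, lintegral_indicator measurableSet_Ioo]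
    have := Polynomial.Chebyshev.intervalIntegrable_sqrt_one_sub_sq_inv
    rw [intervalIntegrable_iff, uIoc_of_le (by norm_num)] at this
    exact (this.mono_set Ioo_subset_Ioc_self).lintegral_lt_top
  calc ∫⁻ h, ∫⁻ h', ∫⁻ s, ENNReal.ofReal s * rate s h h'
      ≤ ∫⁻ h, ∫⁻ h', ENNReal.ofReal (6 / π ^ 2) * (2 * (g h * g h')) :=
        lintegral_mono fun h ↦ lintegral_mono fun h' ↦ lintegral_mul_rate_le h h'
    _ = ENNReal.ofReal (6 / π ^ 2) * (2 * ((∫⁻ h, g h) * ∫⁻ h, g h)) := by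
        simp_rw [lintegral_const_mul' _ _ ENNReal.ofReal_ne_top,
          lintegral_const_mul' _ _ ENNReal.ofNat_ne_top]
        congr 2
        simp_rw [lintegral_const_mul _ hgm]
        rw [lintegral_mul_const _ hgm]
    _ < ∞ := ENNReal.mul_lt_top ENNReal.ofReal_lt_top
        (ENNReal.mul_lt_top ENNReal.ofNat_lt_top (ENNReal.mul_lt_top hgi hgi))

/-! ### Weak convergence of contraction semigroups -/

section Foguel

variable {H : Type*} [NormedAddCommGroup H] [InnerProductSpace ℝ H] [CompleteSpace H]

/-- Bounded families in a Hilbert space have weak limits along ultrafilters. -/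
lemma exists_weak_limit {ι : Type*} (U : Ultrafilter ι) (x : ι → H) (C : ℝ)
    (hx : ∀ᶠ i in (U : Filter ι), ‖x i‖ ≤ C) :
    ∃ y : H, ∀ g : H, Tendsto (fun i ↦ ⟪g, x i⟫_ℝ) U (𝓝 ⟪g, y⟫_ℝ) := by
  set K : Set (WeakDual ℝ H) := WeakDual.toStrongDual ⁻¹' Metric.closedBall 0 C
  have hK : IsCompact K := WeakDual.isCompact_closedBall 0 C
  set X : ι → WeakDual ℝ H :=
    fun i ↦ StrongDual.toWeakDual (InnerProductSpace.toDual ℝ H (x i)) with hX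
  have hmem : ∀ᶠ i in (U : Filter ι), X i ∈ K := by
    filter_upwards [hx] with i hi
    simp only [K, mem_preimage, mem_closedBall_zero_iff]
    exact (LinearIsometryEquiv.norm_map (InnerProductSpace.toDual ℝ H) (x i)).trans_le hi
  obtain ⟨l, -, hl⟩ := hK.ultrafilter_le_nhds' (U.map X) hmem
  refine ⟨(InnerProductSpace.toDual ℝ H).symm (WeakDual.toStrongDual l), fun g ↦ ?_⟩
  have h1 : Tendsto X U (𝓝 l) := hl
  have h2 := ((WeakDual.eval_continuous g).tendsto l).comp h1
  have h3 : ⟪g, (InnerProductSpace.toDual ℝ H).symm (WeakDual.toStrongDual l)⟫_ℝ = l g := by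
    rw [real_inner_comm, InnerProductSpace.toDual_symm_apply]
    rfl
  rw [h3]
  refine h2.congr fun i ↦ ?_
  exact real_inner_comm g (x i)

/-- For a contraction `A`, the defect of `A* A` at `v` is controlled by the loss of norm. -/
lemma norm_adjoint_comp_sub_sq_le (A : H →L[ℝ] H) (hA : ‖A‖ ≤ 1) (v : H) :
    ‖A.adjoint (A v) - v‖ ^ 2 ≤ ‖v‖ ^ 2 - ‖A v‖ ^ 2 := by
  have h1 : ⟪A.adjoint (A v), v⟫_ℝ = ‖A v‖ ^ 2 := by
    rw [ContinuousLinearMap.adjoint_inner_left, real_inner_self_eq_norm_sq]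
  have h2 : ‖A.adjoint (A v)‖ ≤ ‖A v‖ := by
    have := A.adjoint.le_opNorm (A v)
    rw [LinearIsometryEquiv.norm_map] at this
    nlinarith [norm_nonneg (A v)]
  rw [norm_sub_sq_real, h1]
  nlinarith [norm_nonneg (A.adjoint (A v)), norm_nonneg (A v)]

/-- Every weak limit point, as `t → ∞`, of an orbit of a semigroup of contractions is a vector on
which the semigroup is isometric: `T s* T s - 1` tends to zero along the orbit, because the norm
converges, and this bounded operator is weakly continuous. -/
lemma norm_eq_of_weak_limit {T : ℝ → H →L[ℝ] H} (hT : ∀ t, 0 ≤ t → ‖T t‖ ≤ 1)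
    (hadd : ∀ s t, 0 ≤ s → 0 ≤ t → T (s + t) = T s ∘L T t) {U : Ultrafilter ℝ}
    (hU : (U : Filter ℝ) ≤ atTop) (φ y : H)
    (hy : ∀ g : H, Tendsto (fun t ↦ ⟪g, T t φ⟫_ℝ) U (𝓝 ⟪g, y⟫_ℝ)) {s : ℝ} (hs : 0 ≤ s) :
    ‖T s y‖ = ‖y‖ := by
  have hle : ∀ t, 0 ≤ t → ∀ v, ‖T t v‖ ≤ ‖v‖ := fun t ht v ↦ by
    simpa using (T t).le_of_opNorm_le (hT t ht) v
  -- the norm converges along the orbit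
  obtain ⟨L, hL⟩ : ∃ L, Tendsto (fun t ↦ ‖T t φ‖ ^ 2) atTop (𝓝 L) := by
    have hanti : Antitone fun t : ℝ ↦ ‖T (max t 0) φ‖ ^ 2 := by
      intro a b hab
      have h0 : (0 : ℝ) ≤ max a 0 := le_max_right _ _
      have h1 : max b 0 = (max b 0 - max a 0) + max a 0 := by ring
      have h2 : 0 ≤ max b 0 - max a 0 := sub_nonneg.2 (max_le_max_right _ hab)
      simp only
      rw [h1, hadd _ _ h2 h0]
      exact pow_le_pow_left₀ (norm_nonneg _) (hle _ h2 _) 2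
    refine ⟨_, (tendsto_atTop_ciInf hanti ⟨0, ?_⟩).congr' ?_⟩
    · rintro _ ⟨t, rfl⟩; positivity
    · filter_upwards [eventually_ge_atTop 0] with t ht
      rw [max_eq_left ht]
  have hdef : Tendsto (fun t ↦ (T s).adjoint (T s (T t φ)) - T t φ) atTop (𝓝 0) := by
    have h1 : Tendsto (fun t ↦ ‖T t φ‖ ^ 2 - ‖T (s + t) φ‖ ^ 2) atTop (𝓝 0) := by
      have := hL.sub (hL.comp (tendsto_atTop_add_const_left atTop s tendsto_id))
      rwa [sub_self] at this
    have h2 : Tendsto (fun t ↦ ‖(T s).adjoint (T s (T t φ)) - T t φ‖ ^ 2) atTop (𝓝 0) := by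
      refine tendsto_of_tendsto_of_tendsto_of_le_of_le' tendsto_const_nhds h1
        (Eventually.of_forall fun t ↦ by positivity) ?_
      filter_upwards [eventually_ge_atTop 0] with t ht
      rw [hadd s t hs ht]
      exact norm_adjoint_comp_sub_sq_le _ (hT s hs) _
    rw [tendsto_zero_iff_norm_tendsto_zero]
    have h3 := h2.sqrt
    simpa [Real.sqrt_sq] using h3
  have hfix : (T s).adjoint (T s y) = y := by
    refine ext_inner_left ℝ fun g ↦ ?_
    have h1 := hy ((T s).adjoint (T s g))
    have h2 : Tendsto (fun t ↦ ⟪(T s).adjoint (T s g), T t φ⟫_ℝ) U (𝓝 ⟪g, y⟫_ℝ) := by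
      have h3 : Tendsto (fun t ↦ ⟪g, T t φ⟫_ℝ + ⟪g, (T s).adjoint (T s (T t φ)) - T t φ⟫_ℝ) U
          (𝓝 (⟪g, y⟫_ℝ + ⟪g, (0 : H)⟫_ℝ)) :=
        (hy g).add (tendsto_const_nhds.inner (hdef.mono_left hU))
      rw [inner_zero_right, add_zero] at h3
      refine h3.congr fun t ↦ ?_
      rw [← inner_add_right, add_sub_cancel, ContinuousLinearMap.adjoint_inner_left,
        ContinuousLinearMap.adjoint_inner_right]
    rw [← tendsto_nhds_unique h1 h2, ContinuousLinearMap.adjoint_inner_left,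
      ContinuousLinearMap.adjoint_inner_right]
  have h1 : ‖T s y‖ ^ 2 = ‖y‖ ^ 2 := by
    rw [← real_inner_self_eq_norm_sq, ← ContinuousLinearMap.adjoint_inner_right, hfix,
      real_inner_self_eq_norm_sq]
  exact (pow_left_inj₀ (norm_nonneg _) (norm_nonneg _) two_ne_zero).1 h1

/-- **Foguel's theorem.** A semigroup of contractions of a Hilbert space tends weakly to zero if
zero is the only vector with an infinite past along which the semigroup is isometric. -/
theorem tendsto_inner_of_contraction_semigroup {T : ℝ → H →L[ℝ] H}
    (hT : ∀ t, 0 ≤ t → ‖T t‖ ≤ 1) (hadd : ∀ s t, 0 ≤ s → 0 ≤ t → T (s + t) = T s ∘L T t)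
    (hrig : ∀ y : H, (∀ k, 0 ≤ k → ∃ z, T k z = y ∧ ∀ s, 0 ≤ s → ‖T s z‖ = ‖z‖) → y = 0)
    (g φ : H) : Tendsto (fun t ↦ ⟪g, T t φ⟫_ℝ) atTop (𝓝 0) := by
  rw [tendsto_iff_ultrafilter]
  intro U hU
  have hbdd : ∀ k : ℝ, ∀ᶠ t in (U : Filter ℝ), ‖T (t - k) φ‖ ≤ ‖φ‖ := by
    intro k
    filter_upwards [hU (eventually_ge_atTop k)] with t ht
    simpa using (T (t - k)).le_of_opNorm_le (hT _ (sub_nonneg.2 ht)) φ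
  have hlim : ∀ k : ℝ, ∃ y : H, ∀ g : H,
      Tendsto (fun t ↦ ⟪g, T (t - k) φ⟫_ℝ) U (𝓝 ⟪g, y⟫_ℝ) :=
    fun k ↦ exists_weak_limit U _ _ (hbdd k)
  obtain ⟨y, hy⟩ := hlim 0
  simp only [sub_zero] at hy
  have h0 : y = 0 := by
    refine hrig y fun k hk ↦ ?_
    obtain ⟨z, hz⟩ := hlim k
    refine ⟨z, ?_, fun s hs ↦ ?_⟩
    · refine ext_inner_left ℝ fun g ↦ ?_
      have h1 := hz ((T k).adjoint g)
      refine tendsto_nhds_unique ?_ (hy g)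
      rw [← ContinuousLinearMap.adjoint_inner_left]
      refine h1.congr' ?_
      filter_upwards [hU (eventually_ge_atTop k)] with t ht
      rw [ContinuousLinearMap.adjoint_inner_left]
      have := hadd k (t - k) hk (sub_nonneg.2 ht)
      rw [add_sub_cancel] at this
      rw [this]
      rfl
    · have hV : ((U.map fun t ↦ t - k : Ultrafilter ℝ) : Filter ℝ) ≤ atTop :=
        (tendsto_atTop_add_const_right atTop (-k) tendsto_id).mono_left hU
      exact norm_eq_of_weak_limit hT hadd hV φ z (fun g ↦ tendsto_map'_iff.2 (hz g)) hs
  have := hy g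
  rwa [h0, inner_zero_right] at this

end Foguel

/-! ### Contraction kernels as operators on `L²` -/

section Koopman

variable {α : Type*} [MeasurableSpace α]

lemma lintegral_enorm_sq_ne_top {E : Type*} [NormedAddCommGroup E] {m : Measure α}
    {f : α → E} (hf : MemLp f 2 m) : ∫⁻ a, ‖f a‖ₑ ^ 2 ∂m ≠ ∞ := by
  have h := hf.2
  rw [eLpNorm_lt_top_iff_lintegral_rpow_enorm_lt_top two_ne_zero ENNReal.ofNat_ne_top] at h
  simpa using h.ne

/-- A kernel is a contraction of the measure `m` if its masses are at most one and `m` is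
subinvariant. -/
structure IsContractionKernel (κ : Kernel α α) (m : Measure α) : Prop where
  measure_univ_le : ∀ a, κ a univ ≤ 1
  lintegral_le : ∀ f : α → ℝ≥0∞, Measurable f → ∫⁻ a, ∫⁻ b, f b ∂κ a ∂m ≤ ∫⁻ a, f a ∂m

namespace IsContractionKernel

variable {κ : Kernel α α} {m : Measure α}

lemma isFiniteMeasure (hκ : IsContractionKernel κ m) (a : α) : IsFiniteMeasure (κ a) :=
  ⟨(hκ.measure_univ_le a).trans_lt ENNReal.one_lt_top⟩

lemma ae_ae (hκ : IsContractionKernel κ m) {p : α → Prop} (hp : ∀ᵐ a ∂m, p a) :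
    ∀ᵐ a ∂m, ∀ᵐ b ∂κ a, p b := by
  set N := toMeasurable m {a | ¬ p a}
  have hN : MeasurableSet N := measurableSet_toMeasurable _ _
  have h0 : m N = 0 := by rw [measure_toMeasurable]; exact hp
  have h1 := hκ.lintegral_le (N.indicator 1) (measurable_one.indicator hN)
  rw [lintegral_indicator_one hN, h0, nonpos_iff_eq_zero,
    lintegral_eq_zero_iff (Measurable.lintegral_kernel (measurable_one.indicator hN))] at h1
  filter_upwards [h1] with a ha
  simp only [Pi.zero_apply, lintegral_indicator_one hN] at ha
  exact measure_mono_null (subset_toMeasurable _ _) ha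

lemma ae_memLp (hκ : IsContractionKernel κ m) {f : α → ℝ} (hfm : StronglyMeasurable f)
    (hf : MemLp f 2 m) : ∀ᵐ a ∂m, MemLp f 2 (κ a) := by
  have hm : Measurable fun b ↦ ‖f b‖ₑ ^ 2 := hfm.measurable.enorm.pow_const 2
  have h := ae_lt_top (Measurable.lintegral_kernel (κ := κ) hm)
    ((hκ.lintegral_le _ hm).trans_lt (lintegral_enorm_sq_ne_top hf).lt_top).ne
  filter_upwards [h] with a ha
  refine ⟨hfm.aestronglyMeasurable, ?_⟩
  rw [eLpNorm_lt_top_iff_lintegral_rpow_enorm_lt_top two_ne_zero ENNReal.ofNat_ne_top]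
  simpa using ha

/-- Jensen's inequality for the square and a measure of mass at most one. -/
lemma enorm_integral_sq_le {μ : Measure α} (hμ : μ univ ≤ 1) {f : α → ℝ}
    (hf : AEStronglyMeasurable f μ) : ‖∫ b, f b ∂μ‖ₑ ^ 2 ≤ ∫⁻ b, ‖f b‖ₑ ^ 2 ∂μ := by
  have h1 : ‖∫ b, f b ∂μ‖ₑ ≤ eLpNorm f 2 μ := by
    refine (enorm_integral_le_lintegral_enorm f).trans ?_
    rw [← eLpNorm_one_eq_lintegral_enorm]
    refine (eLpNorm_le_eLpNorm_mul_rpow_measure_univ (q := 2) one_le_two hf).trans ?_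
    refine mul_le_of_le_one_right zero_le (ENNReal.rpow_le_one hμ ?_)
    norm_num
  refine (pow_le_pow_left₀ zero_le h1 2).trans_eq ?_
  rw [eLpNorm_eq_lintegral_rpow_enorm_toReal two_ne_zero ENNReal.ofNat_ne_top]
  simp only [ENNReal.toReal_ofNat, ENNReal.rpow_ofNat, ← ENNReal.rpow_natCast]
  rw [← ENNReal.rpow_mul]
  norm_num

lemma lintegral_enorm_integral_sq_le (hκ : IsContractionKernel κ m) {f : α → ℝ}
    (hfm : StronglyMeasurable f) :
    ∫⁻ a, ‖∫ b, f b ∂κ a‖ₑ ^ 2 ∂m ≤ ∫⁻ a, ‖f a‖ₑ ^ 2 ∂m :=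
  (lintegral_mono fun a ↦ enorm_integral_sq_le (hκ.measure_univ_le a)
    hfm.aestronglyMeasurable).trans (hκ.lintegral_le _ (hfm.measurable.enorm.pow_const 2))

lemma eLpNorm_two_le_iff {f g : α → ℝ} :
    eLpNorm f 2 m ≤ eLpNorm g 2 m ↔ ∫⁻ a, ‖f a‖ₑ ^ 2 ∂m ≤ ∫⁻ a, ‖g a‖ₑ ^ 2 ∂m := by
  rw [eLpNorm_eq_lintegral_rpow_enorm_toReal two_ne_zero ENNReal.ofNat_ne_top,
    eLpNorm_eq_lintegral_rpow_enorm_toReal two_ne_zero ENNReal.ofNat_ne_top,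
    ENNReal.rpow_le_rpow_iff (by norm_num)]
  simp

lemma eLpNorm_integral_le (hκ : IsContractionKernel κ m) {f : α → ℝ}
    (hfm : StronglyMeasurable f) :
    eLpNorm (fun a ↦ ∫ b, f b ∂κ a) 2 m ≤ eLpNorm f 2 m :=
  eLpNorm_two_le_iff.2 (hκ.lintegral_enorm_integral_sq_le hfm)

lemma memLp_integral (hκ : IsContractionKernel κ m) {f : α → ℝ}
    (hfm : StronglyMeasurable f) (hf : MemLp f 2 m) : MemLp (fun a ↦ ∫ b, f b ∂κ a) 2 m :=
  ⟨hfm.integral_kernel.aestronglyMeasurable, (hκ.eLpNorm_integral_le hfm).trans_lt hf.2⟩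

lemma integral_ae_eq (hκ : IsContractionKernel κ m) {f g : α → ℝ} (hfg : f =ᵐ[m] g) :
    (fun a ↦ ∫ b, f b ∂κ a) =ᵐ[m] fun a ↦ ∫ b, g b ∂κ a := by
  filter_upwards [hκ.ae_ae hfg] with a ha using integral_congr_ae ha

/-- The operator `y ↦ ∫ y(b) κ(·, db)` on `L²(m)`. -/
noncomputable def koopman (hκ : IsContractionKernel κ m) : Lp ℝ 2 m →L[ℝ] Lp ℝ 2 m :=
  LinearMap.mkContinuous
    { toFun := fun y ↦ (hκ.memLp_integral (Lp.stronglyMeasurable y) (Lp.memLp y)).toLp _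
      map_add' := by
        intro y z
        rw [← MemLp.toLp_add]
        refine MemLp.toLp_congr _ _ ?_
        refine (hκ.integral_ae_eq (Lp.coeFn_add y z)).trans ?_
        filter_upwards [hκ.ae_memLp (Lp.stronglyMeasurable y) (Lp.memLp y),
          hκ.ae_memLp (Lp.stronglyMeasurable z) (Lp.memLp z)] with a h1 h2
        have := hκ.isFiniteMeasure a
        exact integral_add (h1.integrable one_le_two) (h2.integrable one_le_two)
      map_smul' := by
        intro c y
        rw [RingHom.id_apply, ← MemLp.toLp_const_smul]
        refine MemLp.toLp_congr _ _ ?_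
        refine (hκ.integral_ae_eq (Lp.coeFn_smul c y)).trans ?_
        exact Eventually.of_forall fun a ↦ integral_smul c _ }
    1 (fun y ↦ by
      rw [one_mul]
      simp only [LinearMap.coe_mk, AddHom.coe_mk, Lp.norm_def]
      refine ENNReal.toReal_mono (Lp.memLp y).2.ne ?_
      rw [eLpNorm_congr_ae (MemLp.coeFn_toLp
        (hκ.memLp_integral (Lp.stronglyMeasurable y) (Lp.memLp y)))]
      exact hκ.eLpNorm_integral_le (Lp.stronglyMeasurable y))

lemma coeFn_koopman (hκ : IsContractionKernel κ m) (y : Lp ℝ 2 m) :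
    hκ.koopman y =ᵐ[m] fun a ↦ ∫ b, y b ∂κ a :=
  MemLp.coeFn_toLp (hκ.memLp_integral (Lp.stronglyMeasurable y) (Lp.memLp y))

lemma coeFn_koopman_toLp (hκ : IsContractionKernel κ m) {f : α → ℝ} (hf : MemLp f 2 m) :
    hκ.koopman (hf.toLp f) =ᵐ[m] fun a ↦ ∫ b, f b ∂κ a :=
  (hκ.coeFn_koopman _).trans (hκ.integral_ae_eq (MemLp.coeFn_toLp hf))

lemma norm_koopman_le (hκ : IsContractionKernel κ m) : ‖hκ.koopman‖ ≤ 1 :=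
  LinearMap.mkContinuous_norm_le _ zero_le_one _

lemma koopman_comp {κ₁ κ₂ : Kernel α α} (h₁ : IsContractionKernel κ₁ m)
    (h₂ : IsContractionKernel κ₂ m) (h : IsContractionKernel (κ₂ ∘ₖ κ₁) m) :
    h.koopman = h₁.koopman ∘L h₂.koopman := by
  ext1 y
  refine Lp.ext ?_
  refine (h.coeFn_koopman y).trans (EventuallyEq.trans ?_ (h₁.coeFn_koopman _).symm)
  refine EventuallyEq.trans ?_ (h₁.integral_ae_eq (h₂.coeFn_koopman y)).symm
  filter_upwards [h.ae_memLp (Lp.stronglyMeasurable y) (Lp.memLp y)] with a ha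
  have := h.isFiniteMeasure a
  exact Kernel.integral_comp (ha.integrable one_le_two)

/-- The equality case of Jensen's inequality: if averaging does not decrease the norm of `y`, then
`y` is constant along almost every transition. -/
lemma ae_ae_eq_of_norm_koopman (hκ : IsContractionKernel κ m) {y : Lp ℝ 2 m}
    (hy : ‖hκ.koopman y‖ = ‖y‖) : ∀ᵐ a ∂m, ∀ᵐ b ∂κ a, y b = ∫ b', y b' ∂κ a := by
  have hym := Lp.stronglyMeasurable y
  have hm : Measurable fun b ↦ ‖y b‖ₑ ^ 2 := hym.measurable.enorm.pow_const 2
  have hle : eLpNorm y 2 m ≤ eLpNorm (fun a ↦ ∫ b, y b ∂κ a) 2 m := by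
    rw [← eLpNorm_congr_ae (hκ.coeFn_koopman y)]
    rw [Lp.norm_def, Lp.norm_def, ENNReal.toReal_eq_toReal_iff' (Lp.memLp _).2.ne
      (Lp.memLp _).2.ne] at hy
    exact hy.ge
  have heq := ae_eq_of_ae_le_of_lintegral_le (μ := m)
    (f := fun a ↦ ‖∫ b, y b ∂κ a‖ₑ ^ 2) (g := fun a ↦ ∫⁻ b, ‖y b‖ₑ ^ 2 ∂κ a)
    (Eventually.of_forall fun a ↦ enorm_integral_sq_le (hκ.measure_univ_le a)
      hym.aestronglyMeasurable)
    (lintegral_enorm_sq_ne_top (hκ.memLp_integral hym (Lp.memLp y)))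
    (Measurable.lintegral_kernel hm).aemeasurable
    ((hκ.lintegral_le _ hm).trans (eLpNorm_two_le_iff.1 hle))
  filter_upwards [heq, hκ.ae_memLp hym (Lp.memLp y)] with a ha hmem
  have := hκ.isFiniteMeasure a
  set c := ∫ b, y b ∂κ a with hc
  have hi1 : Integrable y (κ a) := hmem.integrable one_le_two
  have hi2 : Integrable (fun b ↦ y b ^ 2) (κ a) := hmem.integrable_sq
  have hsq : ∫ b, y b ^ 2 ∂κ a = c ^ 2 := by
    rw [integral_eq_lintegral_of_nonneg_ae (Eventually.of_forall fun b ↦ sq_nonneg _) hi2.1]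
    have e : ∀ x : ℝ, ENNReal.ofReal (x ^ 2) = ‖x‖ₑ ^ 2 := fun x ↦ by
      rw [← ofReal_norm, ← ENNReal.ofReal_pow (norm_nonneg _), Real.norm_eq_abs, sq_abs]
    simp only [e]
    rw [← ha, ← e, ENNReal.toReal_ofReal (sq_nonneg _)]
  have hvar : ∫ b, (y b - c) ^ 2 ∂κ a ≤ 0 := by
    have e : ∀ b, (y b - c) ^ 2 = y b ^ 2 - 2 * c * y b + c ^ 2 := fun b ↦ by ring
    simp only [e]
    have hi3 : Integrable (fun b ↦ y b ^ 2 - 2 * c * y b) (κ a) := hi2.sub (hi1.const_mul _)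
    rw [integral_add hi3 (integrable_const _), integral_sub hi2 (hi1.const_mul _),
      integral_const_mul, ← hc, hsq, integral_const, smul_eq_mul]
    have : (κ a).real univ ≤ 1 := ENNReal.toReal_le_of_le_ofReal zero_le_one
      (by simpa using hκ.measure_univ_le a)
    nlinarith [sq_nonneg c]
  have h0 : ∫ b, (y b - c) ^ 2 ∂κ a = 0 :=
    le_antisymm hvar (integral_nonneg fun b ↦ sq_nonneg _)
  have hi4 : Integrable (fun b ↦ (y b - c) ^ 2) (κ a) := (hmem.sub (memLp_const c)).integrable_sq
  rw [integral_eq_zero_iff_of_nonneg (fun b ↦ sq_nonneg _) hi4] at h0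
  filter_upwards [h0] with b hb
  exact sub_eq_zero.1 (pow_eq_zero_iff two_ne_zero |>.1 hb)

end IsContractionKernel

end Koopman

/-! ### The collision chain and its transpose -/

/-- Collision coordinates: a point `(x, θ, s, h)` stands for a particle with direction `θ` whose
next collision happens at the place `x`, at the time `s`, and with impact parameter `h`. Free flight
does not change these coordinates. -/
abbrev Phase : Type := Plane × Circ × ℝ × ℝ

/-- The angle by which a collision with impact parameter `h` turns the velocity. -/
noncomputable def deflection (h : ℝ) : Circ := ((π - 2 * Real.arcsin h : ℝ) : Circ)

lemma continuous_deflection : Continuous deflection :=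
  (AddCircle.continuous_mk' (2 * π)).comp (by fun_prop)

lemma continuous_vel : Continuous vel := by
  unfold vel
  refine (PiLp.continuous_toLp 2 _).comp (continuous_pi fun i ↦ ?_)
  fin_cases i
  · exact Real.Angle.continuous_cos
  · exact Real.Angle.continuous_sin

@[fun_prop]
lemma _root_.Measurable.vel {α : Type*} [MeasurableSpace α] {f : α → Circ} (hf : Measurable f) :
    Measurable fun a ↦ vel (f a) :=
  continuous_vel.measurable.comp hf

@[fun_prop]
lemma _root_.Measurable.deflection {α : Type*} [MeasurableSpace α] {f : α → ℝ} (hf : Measurable f) :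
    Measurable fun a ↦ deflection (f a) :=
  continuous_deflection.measurable.comp hf

lemma lintegral_phase {F : Phase → ℝ≥0∞} (hF : Measurable F) :
    ∫⁻ z, F z = ∫⁻ h : ℝ, ∫⁻ s : ℝ, ∫⁻ θ : Circ, ∫⁻ x : Plane, F (x, θ, s, h) := by
  rw [Measure.volume_eq_prod, lintegral_prod_symm _ hF.aemeasurable, Measure.volume_eq_prod,
    lintegral_prod_symm _ (by fun_prop), Measure.volume_eq_prod,
    lintegral_prod_symm _ (by fun_prop)]

/-- The arrival point of a particle which leaves the collision `z` for a free flight of length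
`p.1` and a next collision with impact parameter `p.2`. -/
noncomputable def arrival (z : Phase) (p : ℝ × ℝ) : Phase :=
  (z.1 + p.1 • vel (z.2.1 - deflection z.2.2.2), z.2.1 - deflection z.2.2.2, z.2.2.1 + p.1, p.2)

lemma measurable_arrival : Measurable fun q : Phase × ℝ × ℝ ↦ arrival q.1 q.2 := by
  unfold arrival; fun_prop

/-- The law of the next collision after the collision `z`. -/
noncomputable def jump : Kernel Phase Phase where
  toFun z := ((volume : Measure (ℝ × ℝ)).withDensity fun p ↦ rate p.1 p.2 z.2.2.2).map (arrival z)
  measurable' := by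
    refine Measure.measurable_of_measurable_coe _ fun A hA ↦ ?_
    have h1 : ∀ z : Phase, Measurable (arrival z) := fun z ↦
      measurable_arrival.comp measurable_prodMk_left
    have h2 : ∀ z : Phase, (((volume : Measure (ℝ × ℝ)).withDensity
        fun p ↦ rate p.1 p.2 z.2.2.2).map (arrival z)) A
        = ∫⁻ p : ℝ × ℝ, (arrival z ⁻¹' A).indicator (fun p ↦ rate p.1 p.2 z.2.2.2) p := fun z ↦ by
      rw [Measure.map_apply (h1 z) hA, withDensity_apply _ (h1 z hA),
        lintegral_indicator (h1 z hA)]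
    simp_rw [h2]
    refine Measurable.lintegral_prod_right' (f := fun q : Phase × ℝ × ℝ ↦
      (arrival q.1 ⁻¹' A).indicator (fun p : ℝ × ℝ ↦ rate p.1 p.2 q.1.2.2.2) q.2) ?_
    exact Measurable.indicator (f := fun q : Phase × ℝ × ℝ ↦ rate q.2.1 q.2.2 q.1.2.2.2)
      (s := (fun q : Phase × ℝ × ℝ ↦ arrival q.1 q.2) ⁻¹' A) (by fun_prop) (measurable_arrival hA)

lemma lintegral_jump {ψ : Phase → ℝ≥0∞} (hψ : Measurable ψ) (z : Phase) :
    ∫⁻ w, ψ w ∂jump z = ∫⁻ p : ℝ × ℝ, rate p.1 p.2 z.2.2.2 * ψ (arrival z p) := by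
  have h1 : Measurable (arrival z) := measurable_arrival.comp measurable_prodMk_left
  change ∫⁻ w, ψ w ∂(((volume : Measure (ℝ × ℝ)).withDensity
    fun p ↦ rate p.1 p.2 z.2.2.2).map (arrival z)) = _
  rw [lintegral_map hψ h1]
  exact lintegral_withDensity_eq_lintegral_mul _ (by fun_prop) (hψ.comp h1)

lemma jump_univ_le (z : Phase) : jump z univ ≤ 1 := by
  have := lintegral_jump measurable_one z
  simp only [Pi.one_apply, lintegral_one, mul_one] at this
  rw [this, Measure.volume_eq_prod, lintegral_prod_symm _ (by fun_prop)]
  exact lintegral_lintegral_rate_le_one z.2.2.2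

instance : IsFiniteKernel jump := ⟨1, ENNReal.one_lt_top, jump_univ_le⟩

/-- The transpose of `jump` with respect to Lebesgue measure: the density of the collisions which
follow collisions of density `f`. -/
noncomputable def jumpDual (f : Phase → ℝ≥0∞) (z : Phase) : ℝ≥0∞ :=
  ∫⁻ p : ℝ × ℝ, rate p.1 z.2.2.2 p.2 *
    f (z.1 - p.1 • vel z.2.1, z.2.1 + deflection p.2, z.2.2.1 - p.1, p.2)

lemma measurable_jumpDual {f : Phase → ℝ≥0∞} (hf : Measurable f) : Measurable (jumpDual f) := by
  unfold jumpDual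
  exact Measurable.lintegral_prod_right' (f := fun q : Phase × ℝ × ℝ ↦ rate q.2.1 q.1.2.2.2 q.2.2 *
    f (q.1.1 - q.2.1 • vel q.1.2.1, q.1.2.1 + deflection q.2.2, q.1.2.2.1 - q.2.1, q.2.2))
    (by fun_prop)

lemma lintegral_mul_jump {f ψ : Phase → ℝ≥0∞} (hf : Measurable f) (hψ : Measurable ψ) :
    ∫⁻ z, f z * ∫⁻ w, ψ w ∂jump z = ∫⁻ z, jumpDual f z * ψ z := by
  have hl : ∫⁻ z, f z * ∫⁻ w, ψ w ∂jump z = ∫⁻ r : ℝ, ∫⁻ h' : ℝ, ∫⁻ h : ℝ, ∫⁻ s : ℝ, ∫⁻ θ : Circ,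
      ∫⁻ x : Plane, rate r h' h * f (x - r • vel θ, θ + deflection h, s - r, h)
        * ψ (x, θ, s, h') := by
    have ha := measurable_arrival
    simp_rw [lintegral_jump hψ]
    have e1 : ∀ z, f z * ∫⁻ p : ℝ × ℝ, rate p.1 p.2 z.2.2.2 * ψ (arrival z p)
        = ∫⁻ p : ℝ × ℝ, f z * (rate p.1 p.2 z.2.2.2 * ψ (arrival z p)) := fun z ↦
      (lintegral_const_mul _ (by fun_prop)).symm
    simp_rw [e1]
    rw [lintegral_lintegral_swap (by fun_prop), Measure.volume_eq_prod,
      lintegral_prod _ (by fun_prop)]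
    refine lintegral_congr fun r ↦ lintegral_congr fun h' ↦ ?_
    rw [lintegral_phase (by fun_prop)]
    refine lintegral_congr fun h ↦ ?_
    unfold arrival
    simp only
    rw [← lintegral_sub_right_eq_self (fun s : ℝ ↦ ∫⁻ θ : Circ, ∫⁻ x : Plane, _) r]
    refine lintegral_congr fun s ↦ ?_
    rw [← lintegral_add_right_eq_self (fun θ : Circ ↦ ∫⁻ x : Plane, _) (deflection h)]
    refine lintegral_congr fun θ ↦ ?_
    rw [← lintegral_sub_right_eq_self (fun x : Plane ↦ _) (r • vel θ)]
    refine lintegral_congr fun x ↦ ?_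
    simp only [add_sub_cancel_right, sub_add_cancel]
    ring
  have hr : ∫⁻ z, jumpDual f z * ψ z = ∫⁻ r : ℝ, ∫⁻ h : ℝ, ∫⁻ h' : ℝ, ∫⁻ s : ℝ, ∫⁻ θ : Circ,
      ∫⁻ x : Plane, rate r h' h * f (x - r • vel θ, θ + deflection h, s - r, h)
        * ψ (x, θ, s, h') := by
    unfold jumpDual
    have e1 : ∀ z : Phase, (∫⁻ p : ℝ × ℝ, rate p.1 z.2.2.2 p.2 *
        f (z.1 - p.1 • vel z.2.1, z.2.1 + deflection p.2, z.2.2.1 - p.1, p.2)) * ψ z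
        = ∫⁻ p : ℝ × ℝ, rate p.1 z.2.2.2 p.2 *
        f (z.1 - p.1 • vel z.2.1, z.2.1 + deflection p.2, z.2.2.1 - p.1, p.2) * ψ z := fun z ↦
      (lintegral_mul_const _ (by fun_prop)).symm
    simp_rw [e1]
    rw [lintegral_lintegral_swap (by fun_prop), Measure.volume_eq_prod,
      lintegral_prod _ (by fun_prop)]
    refine lintegral_congr fun r ↦ lintegral_congr fun h ↦ ?_
    rw [lintegral_phase (by fun_prop)]
  rw [hl, hr]
  refine lintegral_congr fun r ↦ ?_
  rw [lintegral_lintegral_swap]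
  fun_prop

/-! ### The first collision after a time, and the Markov process -/

/-- Translation of the collision time by `a`. -/
def delay (a : ℝ) (z : Phase) : Phase := (z.1, z.2.1, z.2.2.1 + a, z.2.2.2)

lemma measurable_delay (a : ℝ) : Measurable (delay a) := by unfold delay; fun_prop

lemma _root_.Measurable.comp_delay {F : Phase → ℝ≥0∞} (hF : Measurable F) (a : ℝ) :
    Measurable fun z ↦ F (delay a z) := hF.comp (measurable_delay a)

lemma delay_delay (a b : ℝ) (z : Phase) : delay a (delay b z) = delay (b + a) z := by
  simp [delay, add_assoc]

lemma lintegral_delay {F : Phase → ℝ≥0∞} (hF : Measurable F) (a : ℝ) :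
    ∫⁻ z, F (delay a z) = ∫⁻ z, F z := by
  rw [lintegral_phase (hF.comp_delay a), lintegral_phase hF]
  refine lintegral_congr fun h ↦ ?_
  exact lintegral_add_right_eq_self (fun s : ℝ ↦ ∫⁻ θ : Circ, ∫⁻ x : Plane, F (x, θ, s, h)) a

lemma measurePreserving_of_lintegral {f : Phase → Phase} (hf : Measurable f)
    (h : ∀ F : Phase → ℝ≥0∞, Measurable F → ∫⁻ z, F (f z) = ∫⁻ z, F z) :
    MeasurePreserving f volume volume := by
  refine ⟨hf, Measure.ext fun A hA ↦ ?_⟩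
  rw [Measure.map_apply hf hA, ← lintegral_indicator_one hA, ← lintegral_indicator_one (hf hA),
    ← h _ (measurable_one.indicator hA)]
  rfl

lemma measurePreserving_delay (a : ℝ) : MeasurePreserving (delay a) volume volume :=
  measurePreserving_of_lintegral (measurable_delay a) fun _ hF ↦ lintegral_delay hF a

lemma lintegral_jump_delay {ψ : Phase → ℝ≥0∞} (hψ : Measurable ψ) (a : ℝ) (z : Phase) :
    ∫⁻ w, ψ w ∂jump (delay a z) = ∫⁻ w, ψ (delay a w) ∂jump z := by
  rw [lintegral_jump hψ, lintegral_jump (hψ.comp_delay a)]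
  simp only [arrival, delay, add_right_comm]

lemma measurableSet_le_time (t : ℝ) : MeasurableSet {z : Phase | t ≤ z.2.2.1} :=
  measurableSet_le measurable_const measurable_snd.snd.fst

/-- The first collision at or after the time `t`, on the event that it is the `n`-th one in the
chain of collisions which starts with the given one. -/
noncomputable def hitAt (t : ℝ) : ℕ → Kernel Phase Phase
  | 0 => Kernel.piecewise (measurableSet_le_time t) Kernel.id 0
  | n + 1 => Kernel.piecewise (measurableSet_le_time t) 0 (hitAt t n ∘ₖ jump)

lemma lintegral_hitAt_zero (t : ℝ) {ψ : Phase → ℝ≥0∞} (hψ : Measurable ψ) (z : Phase) :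
    ∫⁻ w, ψ w ∂hitAt t 0 z = if t ≤ z.2.2.1 then ψ z else 0 := by
  rw [hitAt, Kernel.lintegral_piecewise]
  simp [Kernel.id_apply, lintegral_dirac' _ hψ]

lemma lintegral_hitAt_succ (t : ℝ) (n : ℕ) {ψ : Phase → ℝ≥0∞} (hψ : Measurable ψ) (z : Phase) :
    ∫⁻ w, ψ w ∂hitAt t (n + 1) z
      = if t ≤ z.2.2.1 then 0 else ∫⁻ w, ∫⁻ w', ψ w' ∂hitAt t n w ∂jump z := by
  rw [hitAt, Kernel.lintegral_piecewise]
  simp [Kernel.lintegral_comp _ _ _ hψ]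

lemma sum_lintegral_hitAt (t : ℝ) (N : ℕ) {ψ : Phase → ℝ≥0∞} (hψ : Measurable ψ) (z : Phase) :
    ∑ n ∈ Finset.range (N + 1), ∫⁻ w, ψ w ∂hitAt t n z = if t ≤ z.2.2.1 then ψ z else
      ∫⁻ w, ∑ n ∈ Finset.range N, ∫⁻ w', ψ w' ∂hitAt t n w ∂jump z := by
  rw [Finset.sum_range_succ']
  simp_rw [lintegral_hitAt_succ t _ hψ, lintegral_hitAt_zero t hψ]
  split_ifs with h
  · simp
  · rw [add_zero, lintegral_finsetSum _ fun n _ ↦ hψ.lintegral_kernel]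

/-- The first collision at or after the time `t`. -/
noncomputable def hit (t : ℝ) : Kernel Phase Phase := Kernel.sum (hitAt t)

lemma lintegral_hit (t : ℝ) (ψ : Phase → ℝ≥0∞) (z : Phase) :
    ∫⁻ w, ψ w ∂hit t z = ∑' n, ∫⁻ w, ψ w ∂hitAt t n z := by
  rw [hit, Kernel.sum_apply, lintegral_sum_measure]

lemma lintegral_hit_eq (t : ℝ) {ψ : Phase → ℝ≥0∞} (hψ : Measurable ψ) (z : Phase) :
    ∫⁻ w, ψ w ∂hit t z = if t ≤ z.2.2.1 then ψ z else ∫⁻ w, ∫⁻ w', ψ w' ∂hit t w ∂jump z := by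
  rw [lintegral_hit, tsum_eq_zero_add' ENNReal.summable]
  simp_rw [lintegral_hitAt_succ t _ hψ, lintegral_hitAt_zero t hψ, lintegral_hit]
  split_ifs with h
  · simp
  · rw [zero_add, lintegral_tsum fun n ↦ hψ.lintegral_kernel.aemeasurable]

/-- An induction principle: bounds for the time of the first collision after `t` follow from those
for finitely many collisions. -/
lemma lintegral_hit_le {t : ℝ} {ψ Ψ : Phase → ℝ≥0∞} (hψ : Measurable ψ)
    (h0 : ∀ z : Phase, t ≤ z.2.2.1 → ψ z ≤ Ψ z)
    (h1 : ∀ z : Phase, z.2.2.1 < t → ∫⁻ w, Ψ w ∂jump z ≤ Ψ z) (z : Phase) :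
    ∫⁻ w, ψ w ∂hit t z ≤ Ψ z := by
  rw [lintegral_hit]
  refine ENNReal.tsum_le_of_sum_range_le fun N ↦ ?_
  induction N generalizing z with
  | zero => simp
  | succ N ih =>
    rw [sum_lintegral_hitAt t N hψ]
    split_ifs with h
    · exact h0 z h
    · exact (lintegral_mono ih).trans (h1 z (not_le.1 h))

lemma hit_univ_le (t : ℝ) (z : Phase) : hit t z univ ≤ 1 := by
  have := lintegral_hit_le (t := t) (ψ := 1) (Ψ := 1) measurable_one (fun _ _ ↦ le_rfl)
    (fun z _ ↦ by simpa using jump_univ_le z) z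
  simpa using this

instance (t : ℝ) : IsFiniteKernel (hit t) := ⟨1, ENNReal.one_lt_top, hit_univ_le t⟩

/-- The strong Markov property at the first collision after `a`. -/
lemma lintegral_hit_hit {a b : ℝ} (hab : a ≤ b) {ψ : Phase → ℝ≥0∞} (hψ : Measurable ψ)
    (z : Phase) : ∫⁻ w, ∫⁻ w', ψ w' ∂hit b w ∂hit a z = ∫⁻ w, ψ w ∂hit b z := by
  have hm : Measurable fun w ↦ ∫⁻ w', ψ w' ∂hit b w := hψ.lintegral_kernel
  refine le_antisymm ?_ ?_
  · refine lintegral_hit_le hm (fun z _ ↦ le_rfl) (fun z hz ↦ ?_) z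
    rw [lintegral_hit_eq b hψ z, if_neg (not_le.2 (hz.trans_le hab))]
  · refine lintegral_hit_le (Ψ := fun z ↦ ∫⁻ w, ∫⁻ w', ψ w' ∂hit b w ∂hit a z) hψ
      (fun z hz ↦ ?_) (fun z hz ↦ ?_) z
    · rw [lintegral_hit_eq a hm, if_pos (hab.trans hz), lintegral_hit_eq b hψ, if_pos hz]
    · rw [lintegral_hit_eq a hm z]
      split_ifs with h
      · rw [lintegral_hit_eq b hψ z, if_neg (not_le.2 hz)]
        refine lintegral_mono fun w ↦ ?_
        refine lintegral_hit_le hm (fun z _ ↦ le_rfl) (fun z hz ↦ ?_) w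
        rw [lintegral_hit_eq b hψ z, if_neg (not_le.2 (hz.trans_le hab))]
      · exact le_rfl

lemma lintegral_hit_delay (t a : ℝ) {ψ : Phase → ℝ≥0∞} (hψ : Measurable ψ) (z : Phase) :
    ∫⁻ w, ψ w ∂hit (t + a) (delay a z) = ∫⁻ w, ψ (delay a w) ∂hit t z := by
  have hd := hψ.comp_delay a
  rw [lintegral_hit, lintegral_hit]
  congr 1
  ext n
  induction n generalizing z with
  | zero =>
    rw [lintegral_hitAt_zero _ hψ, lintegral_hitAt_zero t hd]
    simp [delay]
  | succ n ih =>
    rw [lintegral_hitAt_succ _ n hψ, lintegral_hitAt_succ t n hd,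
      lintegral_jump_delay hψ.lintegral_kernel]
    simp_rw [ih]
    simp [delay]

/-- The Markov process of the Lorentz gas in collision coordinates: after the time `t`, time being
counted afresh. -/
noncomputable def flow (t : ℝ) : Kernel Phase Phase := (hit t).map (delay (-t))

lemma lintegral_flow (t : ℝ) {φ : Phase → ℝ≥0∞} (hφ : Measurable φ) (z : Phase) :
    ∫⁻ w, φ w ∂flow t z = ∫⁻ w, φ (delay (-t) w) ∂hit t z := by
  rw [flow, Kernel.lintegral_map _ (measurable_delay _) _ hφ]

lemma flow_univ_le (t : ℝ) (z : Phase) : flow t z univ ≤ 1 := by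
  have := lintegral_flow t (φ := 1) measurable_one z
  simp only [Pi.one_apply, lintegral_one] at this
  rw [this]
  exact hit_univ_le t z

lemma lintegral_flow_flow (s : ℝ) {t : ℝ} (ht : 0 ≤ t) {φ : Phase → ℝ≥0∞} (hφ : Measurable φ)
    (z : Phase) : ∫⁻ w, ∫⁻ w', φ w' ∂flow t w ∂flow s z = ∫⁻ w, φ w ∂flow (s + t) z := by
  have hφt : Measurable fun w ↦ φ (delay (-t) w) := hφ.comp_delay _
  have hφst : Measurable fun w ↦ φ (delay (-(s + t)) w) := hφ.comp_delay _
  rw [lintegral_flow s hφ.lintegral_kernel, lintegral_flow _ hφ]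
  simp_rw [lintegral_flow t hφ]
  have e : ∀ w, ∫⁻ w', φ (delay (-t) w') ∂hit t (delay (-s) w)
      = ∫⁻ w', φ (delay (-(s + t)) w') ∂hit (s + t) w := by
    intro w
    have := lintegral_hit_delay (s + t) (-s) hφt w
    rw [add_neg_cancel_comm] at this
    rw [this]
    simp_rw [delay_delay, neg_add]
  simp_rw [e]
  exact lintegral_hit_hit (by linarith) hφst z

lemma flow_comp_flow (s : ℝ) {t : ℝ} (ht : 0 ≤ t) : flow t ∘ₖ flow s = flow (s + t) := by
  ext z A hA
  rw [← lintegral_indicator_one hA, ← lintegral_indicator_one hA,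
    Kernel.lintegral_comp _ _ _ (measurable_one.indicator hA),
    lintegral_flow_flow s ht (measurable_one.indicator hA)]

lemma lintegral_flow_of_le {t : ℝ} {φ : Phase → ℝ≥0∞} (hφ : Measurable φ) {z : Phase}
    (hz : t ≤ z.2.2.1) : ∫⁻ w, φ w ∂flow t z = φ (delay (-t) z) := by
  rw [lintegral_flow t hφ, lintegral_hit_eq t (hφ.comp_delay _), if_pos hz]

lemma lintegral_flow_le_const (t : ℝ) {φ : Phase → ℝ≥0∞} {C : ℝ≥0∞} (hC : ∀ z, φ z ≤ C)
    (z : Phase) : ∫⁻ w, φ w ∂flow t z ≤ C :=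
  calc ∫⁻ w, φ w ∂flow t z ≤ ∫⁻ _, C ∂flow t z := lintegral_mono hC
    _ = C * flow t z univ := lintegral_const C
    _ ≤ C := mul_le_of_le_one_right zero_le (flow_univ_le t z)

/-- One step of the transposition of `hit` to densities: `g` is the density of the collisions before
the time `t`. -/
lemma lintegral_mul_jump_hitAt_eq {t : ℝ} {f g ψ : Phase → ℝ≥0∞} (hf : Measurable f)
    (hg : Measurable g) (hψ : Measurable ψ) (n : ℕ) :
    ∫⁻ z, (f z + jumpDual g z) * ∫⁻ w, ψ w ∂hitAt t n z
      = (∫⁻ z, f z * ∫⁻ w, ψ w ∂hitAt t n z)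
        + ∫⁻ z, g z * ∫⁻ w, ∫⁻ w', ψ w' ∂hitAt t n w ∂jump z := by
  have hm : Measurable fun z ↦ ∫⁻ w, ψ w ∂hitAt t n z := hψ.lintegral_kernel
  rw [lintegral_mul_jump hg hm]
  simp_rw [add_mul]
  exact lintegral_add_left (hf.mul hm) _

/-- The balance between the densities `f` of first collisions, `g` of collisions before the time
`t`, and of first collisions after the time `t`, as an upper bound. -/
lemma lintegral_add_jumpDual_mul_le {t : ℝ} {f g ψ : Phase → ℝ≥0∞} (hf : Measurable f)
    (hg : Measurable g) (hψ : Measurable ψ) (hg0 : ∀ z : Phase, t ≤ z.2.2.1 → g z = 0)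
    (hle : ∀ᵐ z : Phase, z.2.2.1 < t → g z ≤ f z + jumpDual g z) (N : ℕ) :
    ∫⁻ z, (f z + jumpDual g z) * (if t ≤ z.2.2.1 then ψ z else 0)
      ≤ ∑ n ∈ Finset.range (N + 1), (∫⁻ z, f z * ∫⁻ w, ψ w ∂hitAt t n z)
        + ∫⁻ z, g z * ∫⁻ w, ∫⁻ w', ψ w' ∂hitAt t N w ∂jump z := by
  induction N with
  | zero =>
    simp_rw [← lintegral_hitAt_zero t hψ]
    rw [lintegral_mul_jump_hitAt_eq hf hg hψ]
    simp
  | succ N ih =>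
    refine ih.trans ?_
    rw [Finset.sum_range_succ _ (N + 1), add_assoc]
    gcongr
    rw [← lintegral_mul_jump_hitAt_eq hf hg hψ]
    refine lintegral_mono_ae ?_
    filter_upwards [hle] with z hz
    rw [lintegral_hitAt_succ t N hψ]
    split_ifs with h
    · simp [hg0 z h]
    · gcongr
      exact hz (not_le.1 h)

/-- The same balance as a lower bound. -/
lemma sum_lintegral_mul_hitAt_le {t : ℝ} {f g ψ : Phase → ℝ≥0∞} (hf : Measurable f)
    (hg : Measurable g) (hψ : Measurable ψ)
    (hle : ∀ z : Phase, z.2.2.1 < t → f z + jumpDual g z ≤ g z) (N : ℕ) :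
    ∑ n ∈ Finset.range (N + 1), (∫⁻ z, f z * ∫⁻ w, ψ w ∂hitAt t n z)
        + ∫⁻ z, g z * ∫⁻ w, ∫⁻ w', ψ w' ∂hitAt t N w ∂jump z
      ≤ ∫⁻ z, (f z + jumpDual g z) * (if t ≤ z.2.2.1 then ψ z else 0) := by
  induction N with
  | zero =>
    simp_rw [← lintegral_hitAt_zero t hψ]
    rw [lintegral_mul_jump_hitAt_eq hf hg hψ]
    simp
  | succ N ih =>
    refine le_trans ?_ ih
    rw [Finset.sum_range_succ _ (N + 1), add_assoc]
    gcongr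
    rw [← lintegral_mul_jump_hitAt_eq hf hg hψ]
    refine lintegral_mono fun z ↦ ?_
    rw [lintegral_hitAt_succ t N hψ]
    split_ifs with h
    · simp
    · gcongr
      exact hle z (not_le.1 h)

lemma lintegral_mul_hit {t : ℝ} {f ψ : Phase → ℝ≥0∞} (hf : Measurable f) (hψ : Measurable ψ) :
    ∫⁻ z, f z * ∫⁻ w, ψ w ∂hit t z = ∑' n, ∫⁻ z, f z * ∫⁻ w, ψ w ∂hitAt t n z := by
  simp_rw [lintegral_hit, ← ENNReal.tsum_mul_left]
  exact lintegral_tsum fun n ↦ (hf.mul hψ.lintegral_kernel).aemeasurable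

/-- If the collisions before the time `t` have a finite density `g`, which satisfies the collision
balance with the density `f` of first collisions, then the first collisions after the time `t` are
bounded by `hit t`. -/
lemma lintegral_add_jumpDual_mul_le_hit {t : ℝ} {f g ψ : Phase → ℝ≥0∞} (hf : Measurable f)
    (hg : Measurable g) (hψ : Measurable ψ) (hg0 : ∀ z : Phase, t ≤ z.2.2.1 → g z = 0)
    (hle : ∀ᵐ z : Phase, z.2.2.1 < t → g z ≤ f z + jumpDual g z)
    (hgfin : ∫⁻ z, g z ≠ ∞) {C : ℝ≥0∞} (hC : C ≠ ∞) (hψC : ∀ z, ψ z ≤ C) :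
    ∫⁻ z, (f z + jumpDual g z) * (if t ≤ z.2.2.1 then ψ z else 0)
      ≤ ∫⁻ z, f z * ∫⁻ w, ψ w ∂hit t z := by
  rw [lintegral_mul_hit hf hψ]
  -- the remainders are summable, because `hit t` has finite mass
  have hrem : Tendsto (fun n ↦ ∫⁻ z, g z * ∫⁻ w, ∫⁻ w', ψ w' ∂hitAt t n w ∂jump z) atTop
      (𝓝 0) := by
    refine ENNReal.tendsto_atTop_zero_of_tsum_ne_top ?_
    refine ne_top_of_le_ne_top (b := ∫⁻ z, g z * C) ?_ ((lintegral_tsum fun n ↦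
      (hg.mul hψ.lintegral_kernel.lintegral_kernel).aemeasurable).symm.trans_le
        (lintegral_mono fun z ↦ ?_))
    · rw [lintegral_mul_const _ hg]
      exact ENNReal.mul_ne_top hgfin hC
    · simp only [Pi.mul_apply]
      rw [ENNReal.tsum_mul_left, ← lintegral_tsum fun n ↦ hψ.lintegral_kernel.aemeasurable]
      simp_rw [← lintegral_hit]
      gcongr
      calc ∫⁻ w, ∫⁻ w', ψ w' ∂hit t w ∂jump z ≤ ∫⁻ _, C ∂jump z := by
            refine lintegral_mono fun w ↦ ?_
            exact (lintegral_mono hψC).trans ((lintegral_const C).trans_le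
              (mul_le_of_le_one_right zero_le (hit_univ_le t w)))
        _ ≤ C := (lintegral_const C).trans_le (mul_le_of_le_one_right zero_le (jump_univ_le z))
  have hlim := hrem.const_add (∑' n, ∫⁻ z, f z * ∫⁻ w, ψ w ∂hitAt t n z)
  rw [add_zero] at hlim
  refine ge_of_tendsto' hlim fun N ↦ ?_
  refine (lintegral_add_jumpDual_mul_le hf hg hψ hg0 hle N).trans ?_
  gcongr
  exact ENNReal.sum_le_tsum _

/-! ### The equilibrium measure -/

/-- The mass of the free flights which are longer than `s` and end with impact parameter `h`; it is
zero for `s < 0`. This is the equilibrium density of the Lorentz gas. -/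
noncomputable def survival (s h : ℝ) : ℝ≥0∞ :=
  ∫⁻ p : ℝ × ℝ, if 0 ≤ s ∧ s < p.1 then rate p.1 h p.2 else 0

lemma measurable_survival_integrand : Measurable fun q : (ℝ × ℝ) × ℝ × ℝ ↦
    if 0 ≤ q.1.1 ∧ q.1.1 < q.2.1 then rate q.2.1 q.1.2 q.2.2 else 0 := by
  refine Measurable.ite ?_ (by fun_prop) measurable_const
  exact (measurableSet_le measurable_const measurable_fst.fst).inter
    (measurableSet_lt measurable_fst.fst measurable_snd.fst)

lemma measurable_survival : Measurable fun p : ℝ × ℝ ↦ survival p.1 p.2 :=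
  Measurable.lintegral_prod_right' measurable_survival_integrand

@[fun_prop]
lemma _root_.Measurable.survival {α : Type*} [MeasurableSpace α] {f g : α → ℝ} (hf : Measurable f)
    (hg : Measurable g) : Measurable fun a ↦ survival (f a) (g a) :=
  measurable_survival.comp (hf.prodMk hg)

lemma lintegral_rate_le_one (h : ℝ) : ∫⁻ p : ℝ × ℝ, rate p.1 h p.2 ≤ 1 := by
  simp_rw [fun p : ℝ × ℝ ↦ rate_symm p.1 h p.2]
  rw [Measure.volume_eq_prod, lintegral_prod_symm _ (by fun_prop)]
  exact lintegral_lintegral_rate_le_one h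

lemma survival_le_one (s h : ℝ) : survival s h ≤ 1 := by
  refine le_trans (lintegral_mono fun p ↦ ?_) (lintegral_rate_le_one h)
  split_ifs
  · exact le_rfl
  · exact zero_le

lemma survival_of_notMem {h : ℝ} (hh : h ∉ Ioo (-1 : ℝ) 1) (s : ℝ) : survival s h = 0 := by
  simp [survival, rate_of_notMem hh]

lemma survival_of_neg {s : ℝ} (hs : s < 0) (h : ℝ) : survival s h = 0 := by
  simp [survival, not_le.2 hs]

lemma le_survival {s h : ℝ} (hs0 : 0 ≤ s) (hs : s ≤ 1 / 4) (hh : h ∈ Ioo (-1 : ℝ) 1) :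
    ENNReal.ofReal (3 / π ^ 2) ≤ survival s h := by
  have hle : ∀ p : ℝ × ℝ, (Ioc (1 / 4 : ℝ) (1 / 2) ×ˢ Ioo (-1 : ℝ) 1).indicator
      (fun _ ↦ ENNReal.ofReal (6 / π ^ 2)) p
        ≤ if 0 ≤ s ∧ s < p.1 then rate p.1 h p.2 else 0 := by
    intro p
    by_cases hp : p ∈ Ioc (1 / 4 : ℝ) (1 / 2) ×ˢ Ioo (-1 : ℝ) 1
    · have h1 := hp.1.1
      rw [indicator_of_mem hp, if_pos ⟨hs0, by linarith⟩,
        rate_of_le_half (by linarith) hp.1.2 hh hp.2]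
    · rw [indicator_of_notMem hp]
      exact zero_le
  refine le_trans (le_of_eq ?_) (lintegral_mono hle)
  rw [lintegral_indicator_const (measurableSet_Ioc.prod measurableSet_Ioo), Measure.volume_eq_prod,
    Measure.prod_prod, Real.volume_Ioc, Real.volume_Ioo, ← ENNReal.ofReal_mul (by norm_num),
    ← ENNReal.ofReal_mul (by positivity)]
  congr 1
  ring

/-- The equilibrium measure of the Lorentz gas on the plane, in collision coordinates. -/
noncomputable def equilibrium : Measure Phase :=
  (volume : Measure Phase).withDensity fun z ↦ survival z.2.2.1 z.2.2.2

lemma lintegral_equilibrium {f : Phase → ℝ≥0∞} (hf : Measurable f) :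
    ∫⁻ z, f z ∂equilibrium = ∫⁻ z, survival z.2.2.1 z.2.2.2 * f z :=
  lintegral_withDensity_eq_lintegral_mul _ (by fun_prop) hf

/-- By Fubini's theorem, the total mass of `survival` is the first moment of the flight times. -/
lemma lintegral_survival_lt_top : ∫⁻ h : ℝ, ∫⁻ s : ℝ, survival s h < ∞ := by
  refine lt_of_eq_of_lt ?_ lintegral_mul_rate_lt_top
  refine lintegral_congr fun h ↦ ?_
  unfold survival
  have hm : Measurable fun q : ℝ × ℝ × ℝ ↦
      if 0 ≤ q.1 ∧ q.1 < q.2.1 then rate q.2.1 h q.2.2 else 0 :=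
    measurable_survival_integrand.comp
      (f := fun q : ℝ × ℝ × ℝ ↦ ((q.1, h), q.2)) (by fun_prop)
  rw [lintegral_lintegral_swap hm.aemeasurable, Measure.volume_eq_prod, lintegral_prod_symm]
  · refine lintegral_congr fun h' ↦ lintegral_congr fun r ↦ ?_
    have : ∀ s : ℝ, (if 0 ≤ s ∧ s < r then rate r h h' else 0)
        = (Ico 0 r).indicator (fun _ ↦ rate r h h') s := fun s ↦ by
      simp only [indicator, mem_Ico]
    simp only [this]
    rw [lintegral_indicator_const measurableSet_Ico, Real.volume_Ico, sub_zero, mul_comm]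
  · exact (Measurable.lintegral_prod_left' hm).aemeasurable

/-- The equilibrium is subinvariant: together with the constant density `1` of collisions, it
satisfies the collision balance as an inequality, because the rates have total mass at most one. -/
lemma lintegral_lintegral_flow_le {t : ℝ} (ht : 0 ≤ t) {φ : Phase → ℝ≥0∞} (hφ : Measurable φ) :
    ∫⁻ z, ∫⁻ w, φ w ∂flow t z ∂equilibrium ≤ ∫⁻ z, φ z ∂equilibrium := by
  set f : Phase → ℝ≥0∞ := fun z ↦ survival z.2.2.1 z.2.2.2 with hf
  set g : Phase → ℝ≥0∞ := fun z ↦ if 0 ≤ z.2.2.1 ∧ z.2.2.1 < t ∧ z.2.2.2 ∈ Ioo (-1 : ℝ) 1 then 1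
    else 0 with hg
  have hfm : Measurable f := by rw [hf]; fun_prop
  have hgm : Measurable g := by
    refine Measurable.ite ?_ measurable_const measurable_const
    refine (measurableSet_le measurable_const measurable_snd.snd.fst).inter
      ((measurableSet_lt measurable_snd.snd.fst measurable_const).inter ?_)
    exact measurable_snd.snd.snd measurableSet_Ioo
  have hψ : Measurable fun z ↦ φ (delay (-t) z) := hφ.comp_delay _
  have hsum : ∀ z : Phase, f z + jumpDual g z = ∫⁻ p : ℝ × ℝ,
      ((if 0 ≤ z.2.2.1 ∧ z.2.2.1 < p.1 then rate p.1 z.2.2.2 p.2 else 0) + rate p.1 z.2.2.2 p.2 *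
        (if 0 ≤ z.2.2.1 - p.1 ∧ z.2.2.1 - p.1 < t ∧ p.2 ∈ Ioo (-1 : ℝ) 1 then 1 else 0)) := by
    intro z
    refine (lintegral_add_left ?_ _).symm
    exact measurable_survival_integrand.comp
      (f := fun q : ℝ × ℝ ↦ ((z.2.2.1, z.2.2.2), q)) (by fun_prop)
  have hlow : ∀ z : Phase, z.2.2.1 < t → f z + jumpDual g z ≤ g z := by
    intro z hz
    rw [hsum]
    by_cases hh : z.2.2.2 ∈ Ioo (-1 : ℝ) 1
    swap
    · simp [rate_of_notMem hh]
    rcases lt_or_ge z.2.2.1 0 with h0 | h0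
    · refine le_of_eq_of_le ?_ (zero_le : 0 ≤ g z)
      have : ∀ p : ℝ × ℝ, ((if 0 ≤ z.2.2.1 ∧ z.2.2.1 < p.1 then rate p.1 z.2.2.2 p.2 else 0)
          + rate p.1 z.2.2.2 p.2 * (if 0 ≤ z.2.2.1 - p.1 ∧ z.2.2.1 - p.1 < t ∧
            p.2 ∈ Ioo (-1 : ℝ) 1 then 1 else 0)) = 0 := by
        intro p
        rw [if_neg fun h ↦ absurd h.1 (not_le.2 h0), zero_add]
        split_ifs with h1
        · rw [rate_of_neg (by linarith [h1.1]), zero_mul]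
        · rw [mul_zero]
      simp_rw [this]
      exact lintegral_zero
    · rw [hg]
      simp only [if_pos (And.intro h0 (And.intro hz hh))]
      refine le_trans (lintegral_mono fun p ↦ ?_) (lintegral_rate_le_one z.2.2.2)
      split_ifs with h1 h2 h2
      · linarith [h1.2, h2.1]
      · simp
      · simp
      · simp
  have hhigh : ∀ z : Phase, t ≤ z.2.2.1 → f z + jumpDual g z ≤ f (delay (-t) z) := by
    intro z hz
    rw [hsum]
    have hd : f (delay (-t) z) = survival (z.2.2.1 - t) z.2.2.2 := rfl
    rw [hd]
    refine lintegral_mono fun p ↦ ?_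
    by_cases h1 : z.2.2.1 - t < p.1
    · simp only [if_pos (show 0 ≤ z.2.2.1 - t ∧ z.2.2.1 - t < p.1 from ⟨by linarith, h1⟩)]
      split_ifs with h2 h3 h3
      · linarith [h2.2, h3.1]
      · simp
      · simp
      · simp
    · rw [if_neg fun h ↦ h1 (by linarith [h.2]), if_neg fun h ↦ h1 (by linarith [h.2.1])]
      simp
  have hkey := sum_lintegral_mul_hitAt_le hfm hgm hψ hlow
  rw [lintegral_equilibrium hφ.lintegral_kernel, lintegral_equilibrium hφ]
  simp_rw [lintegral_flow t hφ]
  rw [lintegral_mul_hit hfm hψ]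
  rw [← lintegral_delay (F := fun z ↦ f z * φ z) (hfm.mul hφ) (-t)]
  refine ENNReal.tsum_le_of_sum_range_le fun N ↦ ?_
  refine le_trans ?_ ((hkey N).trans (lintegral_mono fun z ↦ ?_))
  · rw [Finset.sum_range_succ, add_assoc]
    exact le_self_add
  · simp only
    split_ifs with h
    · gcongr
      exact hhigh z h
    · simp

lemma isContractionKernel_flow {t : ℝ} (ht : 0 ≤ t) : IsContractionKernel (flow t) equilibrium :=
  ⟨flow_univ_le t, fun _ hφ ↦ lintegral_lintegral_flow_le ht hφ⟩

/-! ### Paths with two collisions -/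

/-- A square integrable function on the plane which is invariant under a nontrivial translation
vanishes: by Poincaré recurrence, the finite measure `‖f‖² dx` does not charge any ball. -/
lemma ae_eq_zero_of_translation_invariant {f : Plane → ℝ} (hf : Measurable f)
    (hfin : ∫⁻ x, ‖f x‖ₑ ^ 2 < ∞) {a : Plane} (ha : a ≠ 0) (hinv : ∀ᵐ x, f (x + a) = f x) :
    ∀ᵐ x, f x = 0 := by
  set u : Plane → ℝ≥0∞ := fun x ↦ ‖f x‖ₑ ^ 2 with hu
  have hum : Measurable u := hf.enorm.pow_const 2
  set ν : Measure Plane := volume.withDensity u with hν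
  have hνfin : IsFiniteMeasure ν := isFiniteMeasure_withDensity hfin.ne
  have hm : Measurable fun x : Plane ↦ x + a := measurable_add_const a
  have hpres : MeasurePreserving (fun x ↦ x + a) ν ν := by
    refine ⟨hm, ?_⟩
    ext A hA
    rw [Measure.map_apply hm hA, withDensity_apply _ (hm hA), withDensity_apply _ hA,
      ← lintegral_indicator hA, ← lintegral_indicator (hm hA),
      ← lintegral_add_right_eq_self (fun x ↦ A.indicator u x) a]
    refine lintegral_congr_ae ?_
    filter_upwards [hinv] with x hx
    by_cases h : x + a ∈ A
    · rw [indicator_of_mem h, indicator_of_mem (show x ∈ (fun x ↦ x + a) ⁻¹' A from h), hu]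
      simp only [hx]
    · rw [indicator_of_notMem h, indicator_of_notMem (show x ∉ (fun x ↦ x + a) ⁻¹' A from h)]
  have hball : ∀ R : ℕ, ∀ᵐ x ∂ν, x ∉ Metric.ball (0 : Plane) R := by
    intro R
    filter_upwards [hpres.conservative.ae_mem_imp_frequently_image_mem
      (measurableSet_ball (x := (0 : Plane)) (ε := R)).nullMeasurableSet] with x hx hxR
    have hit : ∀ n : ℕ, (fun x : Plane ↦ x + a)^[n] x = x + n • a := fun n ↦
      congrFun (add_right_iterate a n) x
    have hlim : Tendsto (fun n : ℕ ↦ (n : ℝ) * ‖a‖ - ‖x‖) atTop atTop :=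
      tendsto_atTop_add_const_right _ _
        (tendsto_natCast_atTop_atTop.atTop_mul_const (norm_pos_iff.2 ha))
    obtain ⟨n, hn1, hn2⟩ := ((hx hxR).and_eventually (hlim.eventually_ge_atTop R)).exists
    rw [hit, mem_ball_zero_iff] at hn1
    have h1 : ‖n • a‖ ≤ ‖x + n • a‖ + ‖x‖ := by
      simpa using norm_sub_le (x + n • a) x
    rw [← Nat.cast_smul_eq_nsmul ℝ, norm_smul, Real.norm_natCast] at h1
    rw [← Nat.cast_smul_eq_nsmul ℝ] at hn1
    linarith
  have hfalse : ∀ᵐ x ∂ν, u x = 0 := by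
    filter_upwards [ae_all_iff.2 hball] with x hx
    obtain ⟨n, hn⟩ := exists_nat_gt ‖x‖
    exact absurd (mem_ball_zero_iff.2 hn) (hx n)
  rw [hν, ae_withDensity_iff hum] at hfalse
  filter_upwards [hfalse] with x hx
  by_contra h
  have h0 : u x ≠ 0 := by simpa [hu] using h
  exact h0 (hx h0)

lemma vel_injective : Function.Injective vel := by
  intro α β h
  have h0 : Real.Angle.cos α = Real.Angle.cos β := congrFun (congrArg WithLp.ofLp h) 0
  have h1 : Real.Angle.sin α = Real.Angle.sin β := congrFun (congrArg WithLp.ofLp h) 1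
  induction α using QuotientAddGroup.induction_on with | H a => ?_
  induction β using QuotientAddGroup.induction_on with | H b => ?_
  exact Real.Angle.cos_sin_inj h0 h1

lemma deflection_ne_zero {h : ℝ} (hh : h ∈ Ioo (-1 : ℝ) 1) : deflection h ≠ 0 := by
  have h1 : Real.arcsin h < π / 2 := Real.arcsin_lt_pi_div_two.2 hh.2
  have h2 : -(π / 2) < Real.arcsin h := Real.neg_pi_div_two_lt_arcsin.2 hh.1
  intro h0
  obtain ⟨n, hn⟩ := (AddCircle.coe_eq_zero_iff (2 * π)).1 h0
  rw [zsmul_eq_mul] at hn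
  have hπ := Real.pi_pos
  have h3 : (0 : ℝ) < n := by
    by_contra h
    nlinarith
  have h4 : (n : ℝ) < 1 := by
    by_contra h
    nlinarith
  have h5 : (0 : ℤ) < n := by exact_mod_cast h3
  have h6 : n < (1 : ℤ) := by exact_mod_cast h4
  omega

lemma ae_of_ae_jump {P : Phase → Prop} {z : Phase} (h : ∀ᵐ w ∂jump z, P w) :
    ∀ᵐ p : ℝ × ℝ, rate p.1 p.2 z.2.2.2 ≠ 0 → P (arrival z p) := by
  have h1 : Measurable (arrival z) := measurable_arrival.comp measurable_prodMk_left
  have h2 := ae_of_ae_map h1.aemeasurable h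
  exact (ae_withDensity_iff (by fun_prop)).1 h2

lemma ae_of_ae_hit {t : ℝ} {P : Phase → Prop} {z : Phase} (hz : z.2.2.1 < t)
    (h : ∀ᵐ w ∂hit t z, P w) : ∀ᵐ w ∂jump z, ∀ᵐ w' ∂hit t w, P w' := by
  have e : hit t z = (hit t ∘ₖ jump) z := by
    ext A hA
    rw [← lintegral_indicator_one hA, ← lintegral_indicator_one hA,
      Kernel.lintegral_comp _ _ _ (measurable_one.indicator hA),
      lintegral_hit_eq t (measurable_one.indicator hA), if_neg (not_le.2 hz)]
  rw [e, Kernel.comp_apply] at h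
  exact Measure.ae_ae_of_ae_bind (hit t).aemeasurable h

lemma of_ae_hit {t : ℝ} {P : Phase → Prop} {z : Phase} (hz : t ≤ z.2.2.1)
    (h : ∀ᵐ w ∂hit t z, P w) : P z := by
  have e : hit t z = Measure.dirac z := by
    ext A hA
    rw [← lintegral_indicator_one hA, lintegral_hit_eq t (measurable_one.indicator hA), if_pos hz,
      ← lintegral_indicator_one hA, lintegral_dirac' _ (measurable_one.indicator hA)]
  rw [e] at h
  by_contra hP
  obtain ⟨B, hB, hBm, hB0⟩ := exists_measurable_superset_of_null h
  have : z ∈ B := hB hP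
  rw [Measure.dirac_apply' _ hBm, indicator_of_mem this] at hB0
  simp at hB0

/-- The paths with two collisions. -/
lemma ae_ae_of_ae_flow {t : ℝ} {P : Phase → Prop} {z : Phase} (hz : z.2.2.1 < t)
    (h : ∀ᵐ w ∂flow t z, P w) : ∀ᵐ p : ℝ × ℝ, ∀ᵐ q : ℝ × ℝ,
      rate p.1 p.2 z.2.2.2 ≠ 0 → z.2.2.1 + p.1 < t → rate q.1 q.2 p.2 ≠ 0 →
        t ≤ z.2.2.1 + p.1 + q.1 → P (delay (-t) (arrival (arrival z p) q)) := by
  have h1 : ∀ᵐ w ∂hit t z, P (delay (-t) w) := by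
    rw [flow, Kernel.map_apply _ (measurable_delay _)] at h
    exact ae_of_ae_map (measurable_delay _).aemeasurable h
  filter_upwards [ae_of_ae_jump (ae_of_ae_hit hz h1)] with p hp
  by_cases c : rate p.1 p.2 z.2.2.2 ≠ 0 ∧ z.2.2.1 + p.1 < t
  swap
  · exact Eventually.of_forall fun q c1 c2 ↦ absurd ⟨c1, c2⟩ c
  have h2 := hp c.1
  filter_upwards [ae_of_ae_jump (ae_of_ae_hit (z := arrival z p) c.2 h2)] with q hq _ _ c3 c4
  exact of_ae_hit (z := arrival (arrival z p) q) c4 (hq c3)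

lemma ae_eq_zero_of_lintegral {α : Type*} [MeasurableSpace α] {μ : Measure α} {F : α → ℝ≥0∞}
    (hF : Measurable F) (h : ∫⁻ a, F a ∂μ = 0) : ∀ᵐ a ∂μ, F a = 0 :=
  (lintegral_eq_zero_iff hF).1 h

lemma ae_phase_of_ae {P : Phase → Prop} (hP : MeasurableSet {z | P z})
    (h : ∀ᵐ h : ℝ, ∀ᵐ s : ℝ, ∀ᵐ θ : Circ, ∀ᵐ x : Plane, P (x, θ, s, h)) : ∀ᵐ z : Phase, P z := by
  have hm : Measurable ({z : Phase | P z}ᶜ.indicator (1 : Phase → ℝ≥0∞)) :=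
    measurable_one.indicator hP.compl
  have h0 : ∫⁻ z : Phase, {z : Phase | P z}ᶜ.indicator 1 z = 0 := by
    rw [lintegral_phase hm]
    refine lintegral_eq_zero_of_ae_eq_zero ?_
    filter_upwards [h] with a ha
    refine lintegral_eq_zero_of_ae_eq_zero ?_
    filter_upwards [ha] with b hb
    refine lintegral_eq_zero_of_ae_eq_zero ?_
    filter_upwards [hb] with c hc
    refine lintegral_eq_zero_of_ae_eq_zero ?_
    filter_upwards [hc] with d hd
    exact indicator_of_notMem (fun H : (d, c, b, a) ∈ {z : Phase | P z}ᶜ ↦ H hd) _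
  filter_upwards [ae_eq_zero_of_lintegral hm h0] with z hz
  by_contra H
  rw [indicator_of_mem (show z ∈ {z : Phase | P z}ᶜ from H)] at hz
  exact one_ne_zero hz

/-- Fubini's theorem for properties of paths with two collisions; the time left to the next
collision, at the time `t`, is used as a coordinate in place of the last free flight time. -/
lemma ae_paths {S : Phase → ℝ × ℝ → ℝ × ℝ → Prop}
    (hS : MeasurableSet {q : Phase × (ℝ × ℝ) × ℝ × ℝ | S q.1 q.2.1 q.2.2})
    (h : ∀ᵐ z, ∀ᵐ p, ∀ᵐ q, S z p q) (t : ℝ) :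
    ∀ᵐ r₁ : ℝ, ∀ᵐ h₁ : ℝ, ∀ᵐ h₂ : ℝ, ∀ᵐ h₀ : ℝ, ∀ᵐ s : ℝ, ∀ᵐ σ : ℝ, ∀ᵐ θ : Circ, ∀ᵐ x : Plane,
      S (x, θ, s, h₀) (r₁, h₁) (σ + (t - s - r₁), h₂) := by
  set F : Phase × (ℝ × ℝ) × ℝ × ℝ → ℝ≥0∞ :=
    {q : Phase × (ℝ × ℝ) × ℝ × ℝ | S q.1 q.2.1 q.2.2}ᶜ.indicator 1 with hF
  have hFm : Measurable F := measurable_one.indicator hS.compl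
  have hFS : ∀ z p q, F (z, p, q) = 0 ↔ S z p q := by
    intro z p q
    by_cases H : S z p q
    · simp [hF, H]
    · simp [hF, H]
  have h0 : ∫⁻ z, ∫⁻ p, ∫⁻ q, F (z, p, q) = 0 := by
    refine lintegral_eq_zero_of_ae_eq_zero ?_
    filter_upwards [h] with a ha
    refine lintegral_eq_zero_of_ae_eq_zero ?_
    filter_upwards [ha] with b hb
    refine lintegral_eq_zero_of_ae_eq_zero ?_
    filter_upwards [hb] with c hc
    exact (hFS _ _ _).2 hc
  rw [lintegral_lintegral_swap (by fun_prop)] at h0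
  simp_rw [fun p : ℝ × ℝ ↦ lintegral_lintegral_swap (μ := (volume : Measure Phase))
    (ν := (volume : Measure (ℝ × ℝ))) (f := fun z q ↦ F (z, p, q)) (by fun_prop)] at h0
  simp_rw [fun p q : ℝ × ℝ ↦ lintegral_phase (F := fun z ↦ F (z, p, q)) (by fun_prop)] at h0
  rw [Measure.volume_eq_prod, lintegral_prod _ (by fun_prop)] at h0
  simp_rw [fun r₁ h₁ : ℝ ↦ lintegral_prod_symm (μ := (volume : Measure ℝ))
    (ν := (volume : Measure ℝ)) (fun q : ℝ × ℝ ↦ ∫⁻ h₀ : ℝ, ∫⁻ s : ℝ, ∫⁻ θ : Circ, ∫⁻ x : Plane,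
      F ((x, θ, s, h₀), (r₁, h₁), q)) (by fun_prop)] at h0
  have h1 : ∀ r₁ h₁ h₂ : ℝ, ∫⁻ r₂ : ℝ, ∫⁻ h₀ : ℝ, ∫⁻ s : ℝ, ∫⁻ θ : Circ, ∫⁻ x : Plane,
      F ((x, θ, s, h₀), (r₁, h₁), (r₂, h₂)) = ∫⁻ h₀ : ℝ, ∫⁻ s : ℝ, ∫⁻ σ : ℝ, ∫⁻ θ : Circ,
        ∫⁻ x : Plane, F ((x, θ, s, h₀), (r₁, h₁), (σ + (t - s - r₁), h₂)) := by
    intro r₁ h₁ h₂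
    rw [lintegral_lintegral_swap (by fun_prop)]
    refine lintegral_congr fun h₀ ↦ ?_
    rw [lintegral_lintegral_swap (by fun_prop)]
    refine lintegral_congr fun s ↦ ?_
    exact (lintegral_add_right_eq_self (fun r₂ : ℝ ↦ ∫⁻ θ : Circ, ∫⁻ x : Plane,
      F ((x, θ, s, h₀), (r₁, h₁), (r₂, h₂))) (t - s - r₁)).symm
  simp_rw [h1] at h0
  filter_upwards [ae_eq_zero_of_lintegral (by fun_prop) h0] with r₁ h0
  filter_upwards [ae_eq_zero_of_lintegral (by fun_prop) h0] with h₁ h0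
  filter_upwards [ae_eq_zero_of_lintegral (by fun_prop) h0] with h₂ h0
  filter_upwards [ae_eq_zero_of_lintegral (by fun_prop) h0] with h₀ h0
  filter_upwards [ae_eq_zero_of_lintegral (by fun_prop) h0] with s h0
  filter_upwards [ae_eq_zero_of_lintegral (by fun_prop) h0] with σ h0
  filter_upwards [ae_eq_zero_of_lintegral (by fun_prop) h0] with θ h0
  filter_upwards [ae_eq_zero_of_lintegral (by fun_prop) h0] with x h0
  exact (hFS _ _ _).1 h0

/-! ### Rigidity -/

lemma ae_of_ae_equilibrium {P : Phase → Prop} (h : ∀ᵐ z ∂equilibrium, P z) :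
    ∀ᵐ z : Phase, 0 ≤ z.2.2.1 → z.2.2.1 ≤ 1 / 4 → z.2.2.2 ∈ Ioo (-1 : ℝ) 1 → P z := by
  have h1 := (ae_withDensity_iff (by fun_prop)).1 h
  filter_upwards [h1] with z hz h2 h3 h4
  refine hz (ne_of_gt (lt_of_lt_of_le ?_ (le_survival h2 h3 h4)))
  rw [ENNReal.ofReal_pos]
  positivity

lemma ae_lintegral_sq_lt_top {y : Phase → ℝ} (hy : Measurable y)
    (hfin : ∫⁻ z, ‖y z‖ₑ ^ 2 ∂equilibrium < ∞) :
    ∀ᵐ h : ℝ, ∀ᵐ s : ℝ, ∀ᵐ θ : Circ, 0 ≤ s → s ≤ 1 / 4 → h ∈ Ioo (-1 : ℝ) 1 →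
      ∫⁻ x : Plane, ‖y (x, θ, s, h)‖ₑ ^ 2 < ∞ := by
  rw [lintegral_equilibrium (by fun_prop), lintegral_phase (by fun_prop)] at hfin
  filter_upwards [ae_lt_top (by fun_prop) hfin.ne] with h hfin
  filter_upwards [ae_lt_top (by fun_prop) hfin.ne] with s hfin
  filter_upwards [ae_lt_top (by fun_prop) hfin.ne] with θ hfin hs0 hs hh
  rw [lintegral_const_mul _ (by fun_prop)] at hfin
  refine ENNReal.lt_top_of_mul_ne_top_right hfin.ne
    (ne_of_gt (lt_of_lt_of_le ?_ (le_survival hs0 hs hh)))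
  rw [ENNReal.ofReal_pos]
  positivity

lemma exists_mem_Ioo_of_ae {P : ℝ → Prop} (h : ∀ᵐ x : ℝ, P x) {a b : ℝ} (hab : a < b) :
    ∃ x ∈ Ioo a b, P x := by
  have h1 : ∃ᵐ x : ℝ, x ∈ Ioo a b := by
    rw [frequently_ae_mem_iff, Real.volume_Ioo]
    exact (ENNReal.ofReal_pos.2 (sub_pos.2 hab)).ne'
  exact (h1.and_eventually h).exists

/-- The rigidity behind the decay. If `y` takes a single value on the paths which start from a given
collision, then so it does on paths with two collisions; sliding the intermediate flight, these
meet the same direction `β` at places which differ by a multiple of `vel α - vel β`. Therefore `y`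
is invariant under translations, and it vanishes because it is square integrable. -/
lemma ae_eq_zero_of_ae_flow_const {y c : Phase → ℝ} (hy : Measurable y) (hc : Measurable c)
    (hfin : ∫⁻ z, ‖y z‖ₑ ^ 2 ∂equilibrium < ∞)
    (h : ∀ᵐ z ∂equilibrium, ∀ᵐ w ∂flow (1 / 4) z, y w = c z) :
    ∀ᵐ z : Phase, 0 ≤ z.2.2.1 → z.2.2.1 ≤ 1 / 4 → z.2.2.2 ∈ Ioo (-1 : ℝ) 1 → y z = 0 := by
  have hI : MeasurableSet (Ioo (-1 : ℝ) 1) := measurableSet_Ioo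
  set C : Phase × (ℝ × ℝ) × ℝ × ℝ → Prop := fun v ↦
    ((0 ≤ v.1.2.2.1 ∧ v.1.2.2.1 < 1 / 8 ∧ v.1.2.2.2 ∈ Ioo (-1 : ℝ) 1) ∧
      0 ≤ v.2.1.1 ∧ v.2.1.1 < 1 / 8 ∧ v.2.1.2 ∈ Ioo (-1 : ℝ) 1) ∧
      0 ≤ v.2.2.1 ∧ v.2.2.1 ≤ 1 / 2 ∧ v.2.2.2 ∈ Ioo (-1 : ℝ) 1 ∧
        1 / 4 ≤ v.1.2.2.1 + v.2.1.1 + v.2.2.1 with hC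
  have hCm : MeasurableSet {v | C v} := by
    refine ((?_ : MeasurableSet _).inter ?_).inter ?_
    · exact (measurableSet_le measurable_const
        (g := fun v : Phase × (ℝ × ℝ) × ℝ × ℝ ↦ v.1.2.2.1) (by fun_prop)).inter
        ((measurableSet_lt (f := fun v : Phase × (ℝ × ℝ) × ℝ × ℝ ↦ v.1.2.2.1) (by fun_prop)
          measurable_const).inter
        (measurableSet_preimage (f := fun v : Phase × (ℝ × ℝ) × ℝ × ℝ ↦ v.1.2.2.2)
          (by fun_prop) hI))
    · exact (measurableSet_le measurable_const
        (g := fun v : Phase × (ℝ × ℝ) × ℝ × ℝ ↦ v.2.1.1) (by fun_prop)).inter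
        ((measurableSet_lt (f := fun v : Phase × (ℝ × ℝ) × ℝ × ℝ ↦ v.2.1.1) (by fun_prop)
          measurable_const).inter
        (measurableSet_preimage (f := fun v : Phase × (ℝ × ℝ) × ℝ × ℝ ↦ v.2.1.2)
          (by fun_prop) hI))
    · exact (measurableSet_le measurable_const
        (g := fun v : Phase × (ℝ × ℝ) × ℝ × ℝ ↦ v.2.2.1) (by fun_prop)).inter
        ((measurableSet_le (f := fun v : Phase × (ℝ × ℝ) × ℝ × ℝ ↦ v.2.2.1) (by fun_prop)
          measurable_const).inter
        ((measurableSet_preimage (f := fun v : Phase × (ℝ × ℝ) × ℝ × ℝ ↦ v.2.2.2)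
          (by fun_prop) hI).inter (measurableSet_le measurable_const
            (g := fun v : Phase × (ℝ × ℝ) × ℝ × ℝ ↦ v.1.2.2.1 + v.2.1.1 + v.2.2.1)
            (by fun_prop))))
  set e : Phase × (ℝ × ℝ) × ℝ × ℝ → Phase := fun v ↦
    delay (-(1 / 4)) (arrival (arrival v.1 v.2.1) v.2.2) with he
  have hem : Measurable e := by
    have h1 : Measurable fun v : Phase × (ℝ × ℝ) × ℝ × ℝ ↦ arrival v.1 v.2.1 :=
      measurable_arrival.comp (by fun_prop : Measurable fun v : Phase × (ℝ × ℝ) × ℝ × ℝ ↦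
        (v.1, v.2.1))
    exact (measurable_delay _).comp (measurable_arrival.comp (h1.prodMk (by fun_prop)))
  have hS : MeasurableSet {v : Phase × (ℝ × ℝ) × ℝ × ℝ | C v → y (e v) = c v.1} := by
    have : {v : Phase × (ℝ × ℝ) × ℝ × ℝ | C v → y (e v) = c v.1}
        = {v | C v}ᶜ ∪ {v | y (e v) = c v.1} := by
      ext v
      simp only [mem_ofPred_eq, mem_union, mem_compl_iff, imp_iff_not_or]
    rw [this]
    exact hCm.compl.union (measurableSet_eq_fun (hy.comp hem) (hc.comp measurable_fst))
  have hrate : ENNReal.ofReal (6 / π ^ 2) ≠ 0 := by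
    rw [Ne, ENNReal.ofReal_eq_zero, not_le]; positivity
  have hpaths : ∀ᵐ z : Phase, ∀ᵐ p : ℝ × ℝ, ∀ᵐ q : ℝ × ℝ,
      C (z, p, q) → y (e (z, p, q)) = c z := by
    filter_upwards [ae_of_ae_equilibrium h] with z hz
    by_cases h0 : 0 ≤ z.2.2.1 ∧ z.2.2.1 < 1 / 8 ∧ z.2.2.2 ∈ Ioo (-1 : ℝ) 1
    swap
    · exact Eventually.of_forall fun p ↦ Eventually.of_forall fun q H ↦ absurd H.1.1 h0
    have h1 : z.2.2.1 < 1 / 4 := by linarith [h0.2.1]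
    filter_upwards [ae_ae_of_ae_flow h1 (hz h0.1 h1.le h0.2.2)] with p hp
    filter_upwards [hp] with q hq H
    obtain ⟨⟨⟨a1, a2, a3⟩, b1, b2, b3⟩, c1, c2, c3, c4⟩ := H
    refine hq ?_ ?_ ?_ c4
    · rw [rate_of_le_half b1 (by linarith) b3 a3]; exact hrate
    · simp only at *; linarith
    · rw [rate_of_le_half c1 c2 c3 b3]; exact hrate
  have hfub := ae_paths hS hpaths (1 / 4)
  -- two different lengths of the intermediate flight
  obtain ⟨a, ha, hfa⟩ := exists_mem_Ioo_of_ae hfub (show (0 : ℝ) < 1 / 16 by norm_num)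
  obtain ⟨b, hb, hfb⟩ := exists_mem_Ioo_of_ae hfub (show (1 / 16 : ℝ) < 1 / 8 by norm_num)
  obtain ⟨h₁, hh₁, hfab⟩ := exists_mem_Ioo_of_ae (hfa.and hfb) (show (-1 : ℝ) < 1 by norm_num)
  refine ae_phase_of_ae ?_ ?_
  · have hs : Measurable fun z : Phase ↦ z.2.2.1 := by fun_prop
    have h0 : MeasurableSet {z : Phase | 0 ≤ z.2.2.1 ∧ z.2.2.1 ≤ 1 / 4 ∧
        z.2.2.2 ∈ Ioo (-1 : ℝ) 1} :=
      (measurableSet_le measurable_const hs).inter ((measurableSet_le hs measurable_const).inter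
        (measurable_snd.snd.snd hI))
    have : {z : Phase | 0 ≤ z.2.2.1 → z.2.2.1 ≤ 1 / 4 → z.2.2.2 ∈ Ioo (-1 : ℝ) 1 → y z = 0}
        = {z : Phase | 0 ≤ z.2.2.1 ∧ z.2.2.1 ≤ 1 / 4 ∧ z.2.2.2 ∈ Ioo (-1 : ℝ) 1}ᶜ
          ∪ {z | y z = 0} := by
      ext z
      simp only [mem_ofPred_eq, mem_union, mem_compl_iff]
      tauto
    rw [this]
    exact h0.compl.union (hy (measurableSet_singleton 0))
  filter_upwards [hfab.1, hfab.2, ae_lintegral_sq_lt_top hy hfin] with h₂ hfa hfb hL2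
  by_cases hh₂ : h₂ ∈ Ioo (-1 : ℝ) 1
  swap
  · exact Eventually.of_forall fun _ ↦ Eventually.of_forall fun _ ↦ Eventually.of_forall
      fun _ _ _ H ↦ absurd H hh₂
  obtain ⟨h₀, hh₀, hfab⟩ := exists_mem_Ioo_of_ae (hfa.and hfb) (show (-1 : ℝ) < 1 by norm_num)
  obtain ⟨s, hs, hfa, hfb⟩ :=
    exists_mem_Ioo_of_ae (hfab.1.and hfab.2) (show (0 : ℝ) < 1 / 8 by norm_num)
  filter_upwards [hfa, hfb, hL2] with σ hfa hfb hL2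
  by_cases hσ : 0 ≤ σ ∧ σ ≤ 1 / 4
  swap
  · exact Eventually.of_forall fun _ ↦ Eventually.of_forall fun _ H1 H2 _ ↦ absurd ⟨H1, H2⟩ hσ
  -- the direction `β` of the last flight as a coordinate
  have hshift := (measurePreserving_add_right (volume : Measure Circ)
    (deflection h₁ + deflection h₀)).quasiMeasurePreserving.ae (hfa.and hfb)
  filter_upwards [hshift, hL2] with β hβ hL2
  have hα : β + (deflection h₁ + deflection h₀) - deflection h₀ = β + deflection h₁ := by abel
  have hend : ∀ r x, e ((x, β + (deflection h₁ + deflection h₀), s, h₀), (r, h₁),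
      (σ + (1 / 4 - s - r), h₂)) = (x + r • vel (β + deflection h₁)
        + (σ + (1 / 4 - s - r)) • vel β, β, σ, h₂) := by
    intro r x
    simp only [he, arrival, delay, hα, add_sub_cancel_right]
    congr 3
    ring
  have hcond : ∀ r x, 0 ≤ r → r < 1 / 8 → C ((x, β + (deflection h₁ + deflection h₀), s, h₀),
      (r, h₁), (σ + (1 / 4 - s - r), h₂)) := by
    intro r x hr0 hr
    have := hs.1
    have := hs.2
    refine ⟨⟨⟨hs.1.le, hs.2, hh₀⟩, hr0, hr, hh₁⟩, ?_, ?_, hh₂, ?_⟩ <;> simp only <;> linarith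
  have hinv : ∀ᵐ x : Plane, y (x + (a - b) • (vel (β + deflection h₁) - vel β), β, σ, h₂)
      = y (x, β, σ, h₂) := by
    have h1 : ∀ᵐ x : Plane, y (x + a • vel (β + deflection h₁)
        + (σ + (1 / 4 - s - a)) • vel β, β, σ, h₂) = y (x + b • vel (β + deflection h₁)
        + (σ + (1 / 4 - s - b)) • vel β, β, σ, h₂) := by
      filter_upwards [hβ.1, hβ.2] with x h1 h2
      have h1 := h1 (hcond a x ha.1.le (by linarith [ha.2]))
      have h2 := h2 (hcond b x (by linarith [hb.1]) hb.2)
      rw [hend] at h1 h2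
      exact h1.trans h2.symm
    have h2 := (measurePreserving_sub_right (volume : Measure Plane)
      (b • vel (β + deflection h₁) + (σ + (1 / 4 - s - b)) • vel β)).quasiMeasurePreserving.ae h1
    filter_upwards [h2] with x hx
    convert! hx using 3
    · module
    · module
  have hne : (a - b) • (vel (β + deflection h₁) - vel β) ≠ 0 := by
    refine smul_ne_zero (by linarith [ha.2, hb.1] : a - b < 0).ne (sub_ne_zero.2 fun H ↦ ?_)
    exact deflection_ne_zero hh₁ (by simpa using vel_injective H)
  filter_upwards [ae_eq_zero_of_translation_invariant (f := fun x ↦ y (x, β, σ, h₂)) (by fun_prop)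
    (hL2 hσ.1 hσ.2 hh₂) hne hinv] with x hx _ _ _
  exact hx

/-! ### Weak convergence of the Markov process to zero -/

lemma flow_eq_dirac {t : ℝ} {z : Phase} (hz : t ≤ z.2.2.1) :
    flow t z = Measure.dirac (delay (-t) z) := by
  ext A hA
  rw [← lintegral_indicator_one hA, lintegral_flow_of_le (measurable_one.indicator hA) hz,
    ← lintegral_indicator_one hA, lintegral_dirac' _ (measurable_one.indicator hA)]

lemma ae_equilibrium_of_ae {P : Phase → Prop}
    (h : ∀ᵐ z : Phase, 0 ≤ z.2.2.1 → z.2.2.2 ∈ Ioo (-1 : ℝ) 1 → P z) :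
    ∀ᵐ z ∂equilibrium, P z := by
  refine (ae_withDensity_iff (by fun_prop)).2 ?_
  filter_upwards [h] with z hz h0
  refine hz (not_lt.1 fun H ↦ h0 (survival_of_neg H _)) ?_
  by_contra H
  exact h0 (survival_of_notMem H _)

/-- The semigroup of contractions of `L²(equilibrium)` which is given by `flow`; it is continued by
zero to negative times. -/
noncomputable def flowSemigroup (t : ℝ) : Lp ℝ 2 equilibrium →L[ℝ] Lp ℝ 2 equilibrium :=
  if ht : 0 ≤ t then (isContractionKernel_flow ht).koopman else 0

lemma flowSemigroup_of_nonneg {t : ℝ} (ht : 0 ≤ t) :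
    flowSemigroup t = (isContractionKernel_flow ht).koopman := dif_pos ht

lemma norm_flowSemigroup_le {t : ℝ} (ht : 0 ≤ t) : ‖flowSemigroup t‖ ≤ 1 := by
  rw [flowSemigroup_of_nonneg ht]
  exact (isContractionKernel_flow ht).norm_koopman_le

lemma flowSemigroup_add {s t : ℝ} (hs : 0 ≤ s) (ht : 0 ≤ t) :
    flowSemigroup (s + t) = flowSemigroup s ∘L flowSemigroup t := by
  have h : IsContractionKernel (flow t ∘ₖ flow s) equilibrium := by
    rw [flow_comp_flow s ht]; exact isContractionKernel_flow (add_nonneg hs ht)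
  rw [flowSemigroup_of_nonneg hs, flowSemigroup_of_nonneg ht,
    ← IsContractionKernel.koopman_comp _ _ h, flowSemigroup_of_nonneg (add_nonneg hs ht)]
  congr 1
  exact (flow_comp_flow s ht).symm

/-- A vector with an isometric past vanishes: the rigidity applies to its past at time `k / 4` near
the collision time `0`, and free flight moves this to the collision times near `k / 4`. -/
lemma eq_zero_of_isometric_past {y : Lp ℝ 2 equilibrium}
    (hy : ∀ k, 0 ≤ k → ∃ z, flowSemigroup k z = y ∧
      ∀ s, 0 ≤ s → ‖flowSemigroup s z‖ = ‖z‖) : y = 0 := by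
  refine Lp.ext ((?_ : _ =ᵐ[equilibrium] (0 : Phase → ℝ)).trans (Lp.coeFn_zero _ _ _).symm)
  have hk : ∀ k : ℕ, ∀ᵐ z ∂equilibrium, (k : ℝ) / 4 ≤ z.2.2.1 →
      z.2.2.1 ≤ ((k : ℝ) + 1) / 4 →
      y z = 0 := by
    intro k
    have hk0 : (0 : ℝ) ≤ (k : ℝ) / 4 := by positivity
    obtain ⟨x, hx, hiso⟩ := hy (k / 4) hk0
    have h14 : (0 : ℝ) ≤ 1 / 4 := by norm_num
    have hiso := hiso (1 / 4) h14
    rw [flowSemigroup_of_nonneg h14] at hiso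
    have hxm := Lp.stronglyMeasurable x
    have hrig := ae_eq_zero_of_ae_flow_const hxm.measurable
      (hxm.integral_kernel (κ := flow (1 / 4))).measurable
      (lintegral_enorm_sq_ne_top (Lp.memLp x)).lt_top
      ((isContractionKernel_flow h14).ae_ae_eq_of_norm_koopman hiso)
    have hrig' := (measurePreserving_delay (-((k : ℝ) / 4))).quasiMeasurePreserving.ae hrig
    rw [flowSemigroup_of_nonneg hk0] at hx
    have hcoe := (isContractionKernel_flow hk0).coeFn_koopman x
    rw [hx] at hcoe
    filter_upwards [hcoe, ae_equilibrium_of_ae (P := fun z ↦ z.2.2.2 ∈ Ioo (-1 : ℝ) 1 ∧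
      (0 ≤ z.2.2.1 + -((k : ℝ) / 4) → z.2.2.1 + -((k : ℝ) / 4) ≤ 1 / 4 →
        z.2.2.2 ∈ Ioo (-1 : ℝ) 1 → x (delay (-((k : ℝ) / 4)) z) = 0))
        (hrig'.mono fun z hz _ hh ↦ ⟨hh, hz⟩)] with z h1 h2 h3 h4
    rw [h1, flow_eq_dirac h3, integral_dirac' _ _ hxm]
    exact h2.2 (by linarith) (by linarith) h2.1
  filter_upwards [ae_all_iff.2 hk, ae_equilibrium_of_ae (P := fun z ↦ 0 ≤ z.2.2.1)
    (Eventually.of_forall fun z h _ ↦ h)] with z hz h0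
  have h4 : 0 ≤ 4 * z.2.2.1 := by linarith
  refine hz ⌊4 * z.2.2.1⌋₊ ?_ ?_
  · have := Nat.floor_le h4; linarith
  · have := Nat.lt_floor_add_one (4 * z.2.2.1); linarith

lemma tendsto_inner_flowSemigroup (g φ : Lp ℝ 2 equilibrium) :
    Tendsto (fun t ↦ ⟪g, flowSemigroup t φ⟫_ℝ) atTop (𝓝 0) :=
  tendsto_inner_of_contraction_semigroup (fun _ ht ↦ norm_flowSemigroup_le ht)
    (fun _ _ hs ht ↦ flowSemigroup_add hs ht) (fun _ hy ↦ eq_zero_of_isometric_past hy) g φ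

lemma memLp_toReal_of_lintegral_sq {α : Type*} [MeasurableSpace α] {m : Measure α}
    {f : α → ℝ≥0∞} (hf : Measurable f) (hfin : ∫⁻ z, f z ^ 2 ∂m ≠ ∞) :
    MemLp (fun z ↦ (f z).toReal) 2 m := by
  refine ⟨hf.ennreal_toReal.aestronglyMeasurable, ?_⟩
  rw [eLpNorm_lt_top_iff_lintegral_rpow_enorm_lt_top two_ne_zero ENNReal.ofNat_ne_top]
  refine lt_of_le_of_lt (lintegral_mono fun z ↦ ?_) hfin.lt_top
  simp only [ENNReal.toReal_ofNat, ENNReal.rpow_ofNat]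
  gcongr
  rw [← ofReal_norm, Real.norm_of_nonneg ENNReal.toReal_nonneg]
  exact ENNReal.ofReal_toReal_le

section

variable {φ : Phase → ℝ≥0∞} {C : ℝ≥0∞}

/-- Weak convergence, for bounded initial densities which are supported near the collision time
zero, where the equilibrium density is bounded below. -/
lemma tendsto_lintegral_mul_flow_of_bounded (hφ : Measurable φ) (hC : C ≠ ∞) (hφC : ∀ z, φ z ≤ C)
    (hφ2 : ∫⁻ z, φ z ^ 2 ∂equilibrium ≠ ∞) {f : Phase → ℝ≥0∞} (hf : Measurable f)
    (hfin : ∫⁻ z, f z ≠ ∞) {N : ℝ≥0∞} (hN : N ≠ ∞) (hfN : ∀ z, f z ≤ N)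
    (hsupp : ∀ z, f z ≠ 0 → 0 ≤ z.2.2.1 ∧ z.2.2.1 ≤ 1 / 4 ∧ z.2.2.2 ∈ Ioo (-1 : ℝ) 1) :
    Tendsto (fun t ↦ ∫⁻ z, f z * ∫⁻ w, φ w ∂flow t z) atTop (𝓝 0) := by
  set ρ : Phase → ℝ≥0∞ := fun z ↦ survival z.2.2.1 z.2.2.2 with hρ
  have hρm : Measurable ρ := by rw [hρ]; fun_prop
  have hρtop : ∀ z, ρ z ≠ ∞ := fun z ↦ ((survival_le_one _ _).trans_lt ENNReal.one_lt_top).ne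
  set c : ℝ≥0∞ := ENNReal.ofReal (3 / π ^ 2) with hc
  have hc0 : c ≠ 0 := by rw [hc, Ne, ENNReal.ofReal_eq_zero, not_le]; positivity
  have hρc : ∀ z, f z ≠ 0 → c ≤ ρ z := fun z hz ↦
    le_survival (hsupp z hz).1 (hsupp z hz).2.1 (hsupp z hz).2.2
  have hcancel : ∀ z, ρ z * (f z / ρ z) = f z := by
    intro z
    by_cases hz : f z = 0
    · simp [hz]
    · refine ENNReal.mul_div_cancel (fun H ↦ hc0 ?_) (hρtop z)
      exact le_antisymm (H ▸ hρc z hz) zero_le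
  set g : Phase → ℝ≥0∞ := fun z ↦ f z / ρ z with hg
  have hgm : Measurable g := hf.div hρm
  have hgle : ∀ z, g z ≤ N / c := by
    intro z
    by_cases hz : f z = 0
    · simp [hg, hz]
    · exact ENNReal.div_le_div (hfN z) (hρc z hz)
  have hNc : N / c ≠ ∞ := ENNReal.div_ne_top hN hc0
  have hg2 : ∫⁻ z, g z ^ 2 ∂equilibrium ≠ ∞ := by
    rw [lintegral_equilibrium (hgm.pow_const 2)]
    refine ne_top_of_le_ne_top (b := ∫⁻ z, f z * (N / c)) ?_ (lintegral_mono fun z ↦ ?_)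
    · rw [lintegral_mul_const _ hf]
      exact ENNReal.mul_ne_top hfin hNc
    · calc ρ z * g z ^ 2 = (ρ z * g z) * g z := by ring
        _ ≤ f z * (N / c) := by rw [hcancel z]; gcongr; exact hgle z
  have hgL := memLp_toReal_of_lintegral_sq hgm hg2
  have hφL := memLp_toReal_of_lintegral_sq hφ hφ2
  have hlim := tendsto_inner_flowSemigroup (hgL.toLp _) (hφL.toLp _)
  have hlim' := ENNReal.tendsto_ofReal hlim
  rw [ENNReal.ofReal_zero] at hlim'
  refine hlim'.congr' ?_
  filter_upwards [eventually_ge_atTop 0] with t ht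
  have hum : Measurable fun z ↦ ∫⁻ w, φ w ∂flow t z := hφ.lintegral_kernel
  have hule : ∀ z, ∫⁻ w, φ w ∂flow t z ≤ C := fun z ↦ lintegral_flow_le_const t hφC z
  have hgum : Measurable fun z ↦ g z * ∫⁻ w, φ w ∂flow t z := hgm.mul hum
  have e1 : ⟪hgL.toLp _, flowSemigroup t (hφL.toLp _)⟫_ℝ
      = ∫ z, (g z * ∫⁻ w, φ w ∂flow t z).toReal ∂equilibrium := by
    rw [L2.inner_def]
    refine integral_congr_ae ?_
    rw [flowSemigroup_of_nonneg ht]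
    filter_upwards [hgL.coeFn_toLp, (isContractionKernel_flow ht).coeFn_koopman_toLp hφL]
      with z h1 h2
    rw [h1, h2, integral_toReal hφ.aemeasurable
      (Eventually.of_forall fun w ↦ (hφC w).trans_lt hC.lt_top), ENNReal.toReal_mul]
    exact mul_comm _ _
  rw [e1, integral_toReal hgum.aemeasurable (Eventually.of_forall fun z ↦
      ENNReal.mul_lt_top ((hgle z).trans_lt hNc.lt_top) ((hule z).trans_lt hC.lt_top)),
    lintegral_equilibrium hgum]
  have e2 : ∀ z, survival z.2.2.1 z.2.2.2 * (g z * ∫⁻ w, φ w ∂flow t z)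
      = f z * ∫⁻ w, φ w ∂flow t z := fun z ↦ by
    rw [← mul_assoc]; congr 1; exact hcancel z
  simp_rw [e2]
  refine ENNReal.ofReal_toReal (ne_top_of_le_ne_top (b := ∫⁻ z, f z * C) ?_
    (lintegral_mono fun z ↦ by gcongr; exact hule z))
  rw [lintegral_mul_const _ hf]
  exact ENNReal.mul_ne_top hfin hC

lemma lintegral_flow_delay (hφ : Measurable φ) {a t : ℝ} (hat : a ≤ t) {z : Phase}
    (hz : 0 ≤ z.2.2.1) : ∫⁻ w, φ w ∂flow t (delay a z) = ∫⁻ w, φ w ∂flow (t - a) z := by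
  have h := lintegral_flow_flow a (sub_nonneg.2 hat) hφ (delay a z)
  rw [add_sub_cancel] at h
  rw [← h, lintegral_flow_of_le hφ.lintegral_kernel
    (show a ≤ z.2.2.1 + a by linarith), delay_delay, add_neg_cancel]
  simp [delay]

/-- The initial densities which are supported away from the collision time zero: until then, the
particles fly freely. -/
lemma tendsto_lintegral_mul_flow_of_bounded_of_le (hφ : Measurable φ) (hC : C ≠ ∞)
    (hφC : ∀ z, φ z ≤ C) (hφ2 : ∫⁻ z, φ z ^ 2 ∂equilibrium ≠ ∞) {f : Phase → ℝ≥0∞}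
    (hf : Measurable f) (hfin : ∫⁻ z, f z ≠ ∞) {N : ℝ≥0∞} (hN : N ≠ ∞) (hfN : ∀ z, f z ≤ N)
    {a : ℝ} (hsupp : ∀ z, f z ≠ 0 → a ≤ z.2.2.1 ∧ z.2.2.1 ≤ a + 1 / 4 ∧
      z.2.2.2 ∈ Ioo (-1 : ℝ) 1) :
    Tendsto (fun t ↦ ∫⁻ z, f z * ∫⁻ w, φ w ∂flow t z) atTop (𝓝 0) := by
  have hsupp' : ∀ z, f (delay a z) ≠ 0 →
      0 ≤ z.2.2.1 ∧ z.2.2.1 ≤ 1 / 4 ∧ z.2.2.2 ∈ Ioo (-1 : ℝ) 1 := by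
    intro z hz
    have h : a ≤ z.2.2.1 + a ∧ z.2.2.1 + a ≤ a + 1 / 4 ∧ _ := hsupp _ hz
    exact ⟨by linarith [h.1], by linarith [h.2.1], h.2.2⟩
  have h := tendsto_lintegral_mul_flow_of_bounded hφ hC hφC hφ2 (hf.comp_delay a)
    (by rwa [lintegral_delay hf]) hN (fun z ↦ hfN _) hsupp'
  refine (h.comp (tendsto_atTop_add_const_right atTop (-a) tendsto_id)).congr' ?_
  filter_upwards [eventually_ge_atTop a] with t ht
  have hfu : Measurable fun z ↦ f z * ∫⁻ w, φ w ∂flow t z := hf.mul hφ.lintegral_kernel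
  rw [← lintegral_delay hfu a]
  refine lintegral_congr fun z ↦ ?_
  by_cases hz : f (delay a z) = 0
  · simp [hz]
  · rw [lintegral_flow_delay hφ ht (hsupp' z hz).1, sub_eq_add_neg]
    rfl

/-- Weak convergence to zero for all integrable initial densities. -/
theorem tendsto_lintegral_mul_flow (hφ : Measurable φ) (hC : C ≠ ∞)
    (hφC : ∀ z, φ z ≤ C) (hφ2 : ∫⁻ z, φ z ^ 2 ∂equilibrium ≠ ∞) {f : Phase → ℝ≥0∞}
    (hf : Measurable f) (hfin : ∫⁻ z, f z ≠ ∞)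
    (hsupp : ∀ z, f z ≠ 0 → 0 ≤ z.2.2.1 ∧ z.2.2.2 ∈ Ioo (-1 : ℝ) 1) :
    Tendsto (fun t ↦ ∫⁻ z, f z * ∫⁻ w, φ w ∂flow t z) atTop (𝓝 0) := by
  have hmI : ∀ k : ℕ, MeasurableSet {z : Phase | (k : ℝ) / 4 ≤ z.2.2.1 ∧
      z.2.2.1 < (k + 1) / 4} := fun k ↦
    (measurableSet_le measurable_const measurable_snd.snd.fst).inter
      (measurableSet_lt measurable_snd.snd.fst measurable_const)
  set piece : ℕ → ℕ → Phase → ℝ≥0∞ := fun n k ↦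
    {z : Phase | (k : ℝ) / 4 ≤ z.2.2.1 ∧ z.2.2.1 < (k + 1) / 4}.indicator
      (fun z ↦ min (f z) n) with hpiece
  have hpm : ∀ n k, Measurable (piece n k) := fun n k ↦
    (hf.min measurable_const).indicator (hmI k)
  have hple : ∀ n k z, piece n k z ≤ min (f z) n := fun n k z ↦
    indicator_le_self' (fun _ _ ↦ zero_le) z
  have hplim : ∀ n k, Tendsto (fun t ↦ ∫⁻ z, piece n k z * ∫⁻ w, φ w ∂flow t z) atTop (𝓝 0) := by
    intro n k
    refine tendsto_lintegral_mul_flow_of_bounded_of_le hφ hC hφC hφ2 (hpm n k)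
      (ne_top_of_le_ne_top hfin (lintegral_mono fun z ↦ (hple n k z).trans (min_le_left _ _)))
      (ENNReal.natCast_ne_top n) (fun z ↦ (hple n k z).trans (min_le_right _ _)) (a := k / 4) ?_
    intro z hz
    have h1 := mem_of_indicator_ne_zero hz
    have h2 : f z ≠ 0 := fun H ↦ hz (le_antisymm
      ((hple n k z).trans ((min_le_left _ _).trans H.le)) zero_le)
    exact ⟨h1.1, by linarith [h1.2], (hsupp z h2).2⟩
  -- the truncations of `f` converge in mean
  have hrem : Tendsto (fun n : ℕ ↦ ∫⁻ z, (f z - ∑ k ∈ Finset.range n, piece n k z)) atTop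
      (𝓝 0) := by
    have := tendsto_lintegral_of_dominated_convergence (μ := (volume : Measure Phase))
      (F := fun (n : ℕ) z ↦ f z - ∑ k ∈ Finset.range n, piece n k z) (f := fun _ ↦ 0) f
      (fun n ↦ hf.sub (Finset.measurable_fun_sum _ fun k _ ↦ hpm n k))
      (fun n ↦ Eventually.of_forall fun z ↦ tsub_le_self) hfin ?_
    · simpa using this
    filter_upwards [ae_lt_top hf hfin] with z hz
    refine tendsto_const_nhds.congr' ?_
    obtain ⟨M, hM⟩ := ENNReal.exists_nat_gt hz.ne
    filter_upwards [eventually_ge_atTop M, eventually_gt_atTop ⌊4 * z.2.2.1⌋₊] with n h1 h2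
    symm
    rw [tsub_eq_zero_iff_le]
    by_cases h0 : f z = 0
    · rw [h0]; exact zero_le
    have h4 : 0 ≤ 4 * z.2.2.1 := by linarith [(hsupp z h0).1]
    refine le_trans (le_of_eq ?_) (Finset.single_le_sum (f := fun k ↦ piece n k z)
      (fun _ _ ↦ zero_le) (Finset.mem_range.2 h2))
    simp only [hpiece]
    rw [indicator_of_mem, min_eq_left]
    · exact hM.le.trans (by exact_mod_cast h1)
    · exact ⟨by linarith [Nat.floor_le h4], by linarith [Nat.lt_floor_add_one (4 * z.2.2.1)]⟩
  rw [ENNReal.tendsto_nhds_zero]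
  intro ε hε
  have hremC : Tendsto (fun n : ℕ ↦ C * ∫⁻ z, (f z - ∑ k ∈ Finset.range n, piece n k z)) atTop
      (𝓝 0) := by
    simpa using ENNReal.Tendsto.const_mul hrem (Or.inr hC)
  have hε2 : 0 < ε / 2 := ENNReal.half_pos hε.ne'
  obtain ⟨n, hn⟩ := (ENNReal.tendsto_nhds_zero.1 hremC _ hε2).exists
  have hsum : Tendsto (fun t ↦ ∑ k ∈ Finset.range n,
      ∫⁻ z, piece n k z * ∫⁻ w, φ w ∂flow t z) atTop (𝓝 0) := by
    simpa using tendsto_finsetSum (Finset.range n) fun k _ ↦ hplim n k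
  filter_upwards [ENNReal.tendsto_nhds_zero.1 hsum _ hε2] with t ht
  have hum : Measurable fun z ↦ ∫⁻ w, φ w ∂flow t z := hφ.lintegral_kernel
  have hsub : Measurable fun z ↦ f z - ∑ k ∈ Finset.range n, piece n k z :=
    hf.sub (Finset.measurable_fun_sum _ fun k _ ↦ hpm n k)
  have hpu : ∀ k, Measurable fun z ↦ piece n k z * ∫⁻ w, φ w ∂flow t z := fun k ↦ (hpm n k).mul hum
  calc ∫⁻ z, f z * ∫⁻ w, φ w ∂flow t z
      ≤ ∫⁻ z, ((∑ k ∈ Finset.range n, piece n k z * ∫⁻ w, φ w ∂flow t z)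
          + C * (f z - ∑ k ∈ Finset.range n, piece n k z)) := by
        refine lintegral_mono fun z ↦ ?_
        rw [← Finset.sum_mul]
        calc f z * ∫⁻ w, φ w ∂flow t z
            ≤ ((∑ k ∈ Finset.range n, piece n k z) + (f z - ∑ k ∈ Finset.range n, piece n k z))
                * ∫⁻ w, φ w ∂flow t z := by gcongr; exact le_add_tsub
          _ ≤ _ := by
              rw [add_mul, mul_comm C]
              gcongr
              exact lintegral_flow_le_const t hφC z
    _ = (∑ k ∈ Finset.range n, ∫⁻ z, piece n k z * ∫⁻ w, φ w ∂flow t z)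
          + C * ∫⁻ z, (f z - ∑ k ∈ Finset.range n, piece n k z) := by
        rw [lintegral_add_left (Finset.measurable_fun_sum _ fun k _ ↦ hpu k),
          lintegral_finsetSum _ fun k _ ↦ hpu k, lintegral_const_mul _ hsub]
    _ ≤ ε / 2 + ε / 2 := add_le_add ht hn
    _ = ε := ENNReal.add_halves ε

end

/-! ### The Duhamel formula in collision coordinates -/

lemma phaseMeasure_eq (S : Set ℝ) : phaseMeasure S
    = (volume : Measure Phase).restrict {z | z.2.2.1 ∈ S ∧ z.2.2.2 ∈ Ioo (-1 : ℝ) 1} := by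
  have e : {z : Phase | z.2.2.1 ∈ S ∧ z.2.2.2 ∈ Ioo (-1 : ℝ) 1}
      = univ ×ˢ (univ ×ˢ (S ×ˢ Ioo (-1 : ℝ) 1)) := by ext; simp
  rw [e, phaseMeasure, angularMeasure, impactMeasure, ← restrict_Ioo_eq_restrict_Icc,
    Measure.volume_eq_prod, ← Measure.prod_restrict, Measure.volume_eq_prod,
    ← Measure.prod_restrict, Measure.volume_eq_prod, ← Measure.prod_restrict]
  simp

lemma measurableSet_time_impact {S : Set ℝ} (hS : MeasurableSet S) :
    MeasurableSet {z : Phase | z.2.2.1 ∈ S ∧ z.2.2.2 ∈ Ioo (-1 : ℝ) 1} :=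
  (measurable_snd.snd.fst hS).inter (measurable_snd.snd.snd measurableSet_Ioo)

lemma ae_phaseMeasure_iff {S : Set ℝ} (hS : MeasurableSet S) {p : Phase → Prop} :
    (∀ᵐ z ∂phaseMeasure S, p z) ↔ ∀ᵐ z : Phase, z.2.2.1 ∈ S ∧ z.2.2.2 ∈ Ioo (-1 : ℝ) 1 → p z := by
  rw [phaseMeasure_eq, ae_restrict_iff' (measurableSet_time_impact hS)]
  rfl

/-- The change from the position of a particle to the place of its collision (`c = 1`) or back
(`c = -1`), composed with a translation of the collision time. -/
noncomputable def shear (c a : ℝ) (z : Phase) : Phase :=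
  (z.1 + (c * z.2.2.1) • vel z.2.1, z.2.1, z.2.2.1 + a, z.2.2.2)

lemma measurable_shear (c a : ℝ) : Measurable (shear c a) := by unfold shear; fun_prop

lemma lintegral_shear {F : Phase → ℝ≥0∞} (hF : Measurable F) (c a : ℝ) :
    ∫⁻ z, F (shear c a z) = ∫⁻ z, F z := by
  have h : Measurable fun z ↦ F (shear c a z) := hF.comp (measurable_shear c a)
  rw [lintegral_phase h, lintegral_phase hF]
  refine lintegral_congr fun h ↦ ?_
  rw [← lintegral_add_right_eq_self (fun s : ℝ ↦ ∫⁻ θ : Circ, ∫⁻ x : Plane, F (x, θ, s, h)) a]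
  refine lintegral_congr fun s ↦ lintegral_congr fun θ ↦ ?_
  exact lintegral_add_right_eq_self (fun x : Plane ↦ F (x, θ, s + a, h)) ((c * s) • vel θ)

lemma measurePreserving_shear (c a : ℝ) : MeasurePreserving (shear c a) volume volume :=
  measurePreserving_of_lintegral (measurable_shear c a) fun _ hF ↦ lintegral_shear hF c a

/-- A measurable version on the whole space of a function which is integrable on part of it. -/
lemma exists_measurable_version {A : Set Phase} (hA : MeasurableSet A) {f : Phase → ℝ}
    (hf : IntegrableOn f A) : ∃ m : Phase → ℝ, Measurable m ∧ ∫⁻ z, ‖m z‖ₑ ≠ ∞ ∧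
      (∀ z, z ∉ A → m z = 0) ∧ ∀ᵐ z, z ∈ A → f z = m z := by
  refine ⟨A.indicator (hf.1.mk f), hf.1.stronglyMeasurable_mk.measurable.indicator hA, ?_,
    fun z hz ↦ indicator_of_notMem hz _, ?_⟩
  · simp_rw [enorm_indicator_eq_indicator_enorm]
    rw [lintegral_indicator hA, lintegral_congr_ae (hf.1.ae_eq_mk.symm.mono fun z hz ↦ by rw [hz])]
    exact hf.2.ne
  · filter_upwards [(ae_restrict_iff' hA).1 hf.1.ae_eq_mk] with z hz hzA
    rw [indicator_of_mem hzA, hz hzA]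

/-- The initial datum in collision coordinates. -/
lemma exists_initial_density {μ₀ : Phase → ℝ} (hμ₀ : Integrable μ₀ (phaseMeasure (Ici 0))) :
    ∃ m : Phase → ℝ, Measurable m ∧ ∫⁻ z, ‖m z‖ₑ ≠ ∞ ∧
      (∀ z, m z ≠ 0 → 0 ≤ z.2.2.1 ∧ z.2.2.2 ∈ Ioo (-1 : ℝ) 1) ∧
      ∀ᵐ z : Phase, 0 ≤ z.2.2.1 ∧ z.2.2.2 ∈ Ioo (-1 : ℝ) 1 → μ₀ (shear (-1) 0 z) = m z := by
  rw [phaseMeasure_eq] at hμ₀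
  obtain ⟨m, hm, hfin, hsupp, hae⟩ :=
    exists_measurable_version (measurableSet_time_impact measurableSet_Ici) hμ₀
  refine ⟨fun z ↦ m (shear (-1) 0 z), hm.comp (measurable_shear _ _), ?_, fun z hz ↦ ?_, ?_⟩
  · rwa [lintegral_shear (F := fun z ↦ ‖m z‖ₑ) hm.enorm]
  · have := not_imp_comm.1 (hsupp _) hz
    simpa [shear] using this
  · filter_upwards [(measurePreserving_shear (-1) 0).quasiMeasurePreserving.ae hae] with z hz h
    exact hz (by simpa [shear] using h)

/-- Null sets of collisions are not seen by the following collisions. -/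
lemma ae_ae_notMem_of_null {N : Set Phase} (hN : MeasurableSet N) (h0 : volume N = 0) :
    ∀ᵐ z : Phase, ∀ᵐ r : ℝ, ∀ᵐ h' : ℝ, rate r z.2.2.2 h' ≠ 0 →
      (z.1 - r • vel z.2.1, z.2.1 + deflection h', z.2.2.1 - r, h') ∉ N := by
  have hm : Measurable (N.indicator (1 : Phase → ℝ≥0∞)) := measurable_one.indicator hN
  have h1 : ∫⁻ z, jumpDual (N.indicator 1) z = 0 := by
    have := lintegral_mul_jump hm (ψ := 1) measurable_one
    simp only [Pi.one_apply, mul_one] at this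
    rw [← this]
    refine (lintegral_congr_ae (g := 0) ?_).trans lintegral_zero
    filter_upwards [measure_eq_zero_iff_ae_notMem.1 h0] with z hz
    simp [hz]
  rw [lintegral_eq_zero_iff (measurable_jumpDual hm)] at h1
  filter_upwards [h1] with z hz
  simp only [jumpDual, Pi.zero_apply] at hz
  rw [lintegral_eq_zero_iff (by fun_prop), Measure.volume_eq_prod] at hz
  filter_upwards [Measure.ae_ae_of_ae_prod hz] with r hr
  filter_upwards [hr] with h' hh' hrate hmem
  simp [hmem, hrate] at hh'

/-- The gain term of the Duhamel formula in collision coordinates: the signed counterpart of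
`jumpDual`, as an iterated integral. -/
noncomputable def gain (τ : Phase → ℝ) (z : Phase) : ℝ :=
  ∫ r : ℝ, ∫ h' : ℝ, (rate r z.2.2.2 h').toReal *
    τ (z.1 - r • vel z.2.1, z.2.1 + deflection h', z.2.2.1 - r, h')

lemma stronglyMeasurable_gain {τ : Phase → ℝ} (hτ : Measurable τ) :
    StronglyMeasurable (gain τ) := by
  have h : Measurable fun q : (Phase × ℝ) × ℝ ↦ (rate q.1.2 q.1.1.2.2.2 q.2).toReal *
      τ (q.1.1.1 - q.1.2 • vel q.1.1.2.1, q.1.1.2.1 + deflection q.2,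
        q.1.1.2.2.1 - q.1.2, q.2) := by
    fun_prop
  exact (h.stronglyMeasurable.integral_prod_right').integral_prod_right'

lemma rate_ne_top (s h h' : ℝ) : rate s h h' ≠ ∞ := by
  unfold rate; split_ifs <;> simp

lemma enorm_gain_le {τ : Phase → ℝ} (hτ : Measurable τ) (z : Phase) :
    ‖gain τ z‖ₑ ≤ jumpDual (fun w ↦ ‖τ w‖ₑ) z := by
  have h : Measurable fun p : ℝ × ℝ ↦ rate p.1 z.2.2.2 p.2 *
      ‖τ (z.1 - p.1 • vel z.2.1, z.2.1 + deflection p.2, z.2.2.1 - p.1, p.2)‖ₑ := by fun_prop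
  unfold gain jumpDual
  rw [Measure.volume_eq_prod, lintegral_prod _ h.aemeasurable]
  refine (enorm_integral_le_lintegral_enorm _).trans (lintegral_mono fun r ↦ ?_)
  refine (enorm_integral_le_lintegral_enorm _).trans_eq (lintegral_congr fun h' ↦ ?_)
  rw [enorm_mul, Real.enorm_of_nonneg ENNReal.toReal_nonneg,
    ENNReal.ofReal_toReal (rate_ne_top _ _ _)]

/-- The Duhamel formula in collision coordinates, where the free flight time `r = s + t - t'`
replaces the time `t'` of the last collision. It is used for `s = 0`, as an equation for the
collisions before the time `T`, and for `t = T`; contributions of times `t' > t` vanish because of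
the rate in the first case, and because of `τ` in the second case. The hypothesis `hN` says that the
exceptional set `N`, outside which `τ` is the trace of `μ`, is negligible in the integral. -/
lemma duhamel_eq_gain {μ₀ : Phase → ℝ} {μ : ℝ → Phase → ℝ} {T t s h : ℝ} (ht : 0 ≤ t) (hs : 0 ≤ s)
    (htT : t = T ∨ s = 0) (htT' : t ≤ T) (hh : h ∈ Ioo (-1 : ℝ) 1) {τ : Phase → ℝ} {N : Set Phase}
    (hτ0 : ∀ z, ¬ (z.2.2.1 ∈ Ioo 0 T ∧ z.2.2.2 ∈ Ioo (-1 : ℝ) 1) → τ z = 0)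
    (hτ : ∀ z ∉ N, z.2.2.1 ∈ Ioo 0 T ∧ z.2.2.2 ∈ Ioo (-1 : ℝ) 1 →
      μ z.2.2.1 (z.1, z.2.1, 0, z.2.2.2) = τ z) {x : Plane} {θ : Circ}
    (hN : ∀ᵐ r : ℝ, ∀ᵐ h' : ℝ, rate r h h' ≠ 0 →
      (x + s • vel θ - r • vel θ, θ + deflection h', s + t - r, h') ∉ N) :
    duhamel μ₀ μ t x θ s h
      = μ₀ (x - t • vel θ, θ, s + t, h) + gain τ (x + s • vel θ, θ, s + t, h) := by
  unfold duhamel gain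
  congr 1
  rw [intervalIntegral.integral_of_le ht, integral_Ioc_eq_integral_Ioo,
    ← integral_indicator measurableSet_Ioo, ← integral_sub_left_eq_self _ _ (s + t)]
  refine integral_congr_ae ?_
  -- collisions exactly at the time `t`, where `r = s`, are counted on one side only
  have hne : ∀ᵐ r : ℝ, r ≠ s := by simp [ae_iff]
  filter_upwards [hN, hne] with r hr hrs
  have e2 : x - (t - (s + t - r)) • vel θ = x + s • vel θ - r • vel θ := by
    module
  by_cases hrt : s + t - r ∈ Ioo 0 t
  · rw [indicator_of_mem hrt, intervalIntegral.integral_of_le (by norm_num),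
      integral_Ioc_eq_integral_Ioo, ← integral_indicator measurableSet_Ioo]
    refine integral_congr_ae ?_
    filter_upwards [hr] with h' hh'
    by_cases hI : h' ∈ Ioo (-1 : ℝ) 1
    · rw [indicator_of_mem hI, sub_sub_cancel, e2, rate, if_pos ⟨hh, hI⟩,
        ENNReal.toReal_ofReal (Q_nonneg _ _ _)]
      rcases eq_or_ne (rate r h h') 0 with h0 | h0
      · rw [rate, if_pos ⟨hh, hI⟩, ENNReal.ofReal_eq_zero] at h0
        rw [le_antisymm h0 (Q_nonneg _ _ _), zero_mul, zero_mul]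
      · congr 1
        exact hτ _ (hh' h0) ⟨⟨hrt.1, hrt.2.trans_le htT'⟩, hI⟩
    · rw [indicator_of_notMem hI, rate_symm, rate_of_notMem hI]
      simp
  · rw [indicator_of_notMem hrt]
    symm
    refine integral_eq_zero_of_ae (Eventually.of_forall fun h' ↦ ?_)
    rcases lt_or_ge r 0 with h0 | h0
    · simp [rate_of_neg h0]
    · beta_reduce
      rw [hτ0, mul_zero, Pi.zero_apply]
      rintro ⟨⟨k1, k2⟩, -⟩
      simp only at k1 k2
      refine hrt ⟨k1, ?_⟩
      rcases htT with rfl | rfl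
      · exact k2
      · have := lt_of_le_of_ne h0 (Ne.symm hrs)
        linarith

/-- The solution at time `T` in collision coordinates: it is obtained from the initial density `m`
and from the density `τ` of the collisions before `T`, which solves an equation of its own. -/
lemma exists_collision_density {μ₀ : Phase → ℝ} {μ : ℝ → Phase → ℝ} (hμ : IsMildSolution μ₀ μ)
    {m : Phase → ℝ}
    (hm : ∀ᵐ z : Phase, 0 ≤ z.2.2.1 ∧ z.2.2.2 ∈ Ioo (-1 : ℝ) 1 → μ₀ (shear (-1) 0 z) = m z)
    {T : ℝ} (hT : 0 < T) :
    ∃ τ : Phase → ℝ, Measurable τ ∧ ∫⁻ z, ‖τ z‖ₑ ≠ ∞ ∧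
      (∀ z, ¬ (z.2.2.1 ∈ Ioo 0 T ∧ z.2.2.2 ∈ Ioo (-1 : ℝ) 1) → τ z = 0) ∧
      (∀ᵐ z : Phase, z.2.2.1 ∈ Ioo 0 T ∧ z.2.2.2 ∈ Ioo (-1 : ℝ) 1 → τ z = m z + gain τ z) ∧
      ∀ᵐ z ∂phaseMeasure (Ici 0), μ T z = m (shear 1 T z) + gain τ (shear 1 T z) := by
  have hint := hμ.trace_integrable T hT
  rw [phaseMeasure_eq] at hint
  obtain ⟨τ, hτ, hfin, hτ0, hae⟩ := exists_measurable_version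
    (measurableSet_time_impact (measurableSet_Ioo (a := 0) (b := T)))
    (IntegrableOn.mono_set hint fun z hz ↦ ⟨Ioo_subset_Icc_self hz.1, hz.2⟩)
  obtain ⟨N, hsub, hN, hN0⟩ := exists_measurable_superset_of_null (ae_iff.1 hae)
  have hτN : ∀ z ∉ N, z.2.2.1 ∈ Ioo 0 T ∧ z.2.2.2 ∈ Ioo (-1 : ℝ) 1 →
      μ z.2.2.1 (z.1, z.2.1, 0, z.2.2.2) = τ z := fun z hz hzA ↦ by
    by_contra hne
    exact hz (hsub fun H ↦ hne (H hzA))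
  have hnull := ae_ae_notMem_of_null hN hN0
  refine ⟨τ, hτ, hfin, hτ0, ?_, ?_⟩
  · filter_upwards [(ae_phaseMeasure_iff measurableSet_Ici).1 hμ.trace_eq, hnull, hae, hm]
      with z h1 h2 h3 h4 hz
    have hz0 : z.2.2.1 ∈ Ici (0 : ℝ) := hz.1.1.le
    have h5 := duhamel_eq_gain (μ₀ := μ₀) (μ := μ) (x := z.1) (θ := z.2.1) (s := 0) hz0
      le_rfl (Or.inr rfl) hz.1.2.le hz.2 hτ0 hτN (by simpa using h2)
    rw [← h3 hz, h1 ⟨hz0, hz.2⟩, h5, ← h4 ⟨hz0, hz.2⟩]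
    simp [shear, sub_eq_add_neg]
  · rw [ae_phaseMeasure_iff measurableSet_Ici]
    have hq := (measurePreserving_shear 1 T).quasiMeasurePreserving
    filter_upwards [(ae_phaseMeasure_iff measurableSet_Ici).1 (hμ.eq T hT.le), hq.ae hnull,
      hq.ae hm]
      with z h1 h2 h3 hz
    have hz0 : 0 ≤ z.2.2.1 := hz.1
    have h5 := duhamel_eq_gain (μ₀ := μ₀) (μ := μ) (x := z.1) (θ := z.2.1) hT.le hz0
      (Or.inl rfl) le_rfl hz.2 hτ0 hτN (by simpa [shear] using h2)
    rw [h1 hz, h5, ← h3 ⟨by simp only [shear]; linarith, hz.2⟩]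
    simp only [shear, one_mul, add_zero]
    congr 3
    module

/-! ### Domination of the solution, and decay -/

section Solution

variable {μ₀ : Phase → ℝ} {μ : ℝ → Phase → ℝ} {m : Phase → ℝ}

lemma aestronglyMeasurable_solution (hμ : IsMildSolution μ₀ μ) (hm : Measurable m)
    (hae : ∀ᵐ z : Phase, 0 ≤ z.2.2.1 ∧ z.2.2.2 ∈ Ioo (-1 : ℝ) 1 → μ₀ (shear (-1) 0 z) = m z)
    {T : ℝ} (hT : 0 < T) : AEStronglyMeasurable (μ T) (phaseMeasure (Ici 0)) := by
  obtain ⟨τ, hτ, -, -, -, h⟩ := exists_collision_density hμ hae hT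
  refine AEStronglyMeasurable.congr (Measurable.aestronglyMeasurable ?_) (EventuallyEq.symm h)
  exact (hm.comp (measurable_shear 1 T)).add
    ((stronglyMeasurable_gain hτ).measurable.comp (measurable_shear 1 T))

/-- The absolute value of the solution is dominated by the evolution, under the Markov process, of
the absolute value of the initial density. -/
lemma lintegral_solution_mul_le (hμ : IsMildSolution μ₀ μ) (hm : Measurable m)
    (hae : ∀ᵐ z : Phase, 0 ≤ z.2.2.1 ∧ z.2.2.2 ∈ Ioo (-1 : ℝ) 1 → μ₀ (shear (-1) 0 z) = m z)
    {T : ℝ} (hT : 0 < T) {φ : Phase → ℝ≥0∞} (hφ : Measurable φ) {C : ℝ≥0∞} (hC : C ≠ ∞)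
    (hφC : ∀ z, φ z ≤ C) :
    ∫⁻ z, ‖μ T z‖ₑ * φ (shear 1 0 z) ∂phaseMeasure (Ici 0)
      ≤ ∫⁻ z, ‖m z‖ₑ * ∫⁻ w, φ w ∂flow T z := by
  obtain ⟨τ, hτ, hfin, hτ0, h1, h2⟩ := exists_collision_density hμ hae hT
  -- `g` bounds the density of the collisions before `T`
  set f : Phase → ℝ≥0∞ := fun z ↦ ‖m z‖ₑ
  set g : Phase → ℝ≥0∞ := fun z ↦ ‖τ z‖ₑ
  have hf : Measurable f := hm.enorm
  have hg : Measurable g := hτ.enorm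
  have hbound : ∀ z, ‖m z + gain τ z‖ₑ ≤ f z + jumpDual g z := fun z ↦
    (enorm_add_le _ _).trans (add_le_add le_rfl (enorm_gain_le hτ z))
  have hg0 : ∀ z : Phase, T ≤ z.2.2.1 → g z = 0 := fun z hz ↦ by
    simp only [g]
    rw [hτ0 z fun H ↦ absurd H.1.2 (not_lt.2 hz), enorm_zero]
  have hle : ∀ᵐ z : Phase, z.2.2.1 < T → g z ≤ f z + jumpDual g z := by
    filter_upwards [h1] with z hz _
    by_cases hA : z.2.2.1 ∈ Ioo 0 T ∧ z.2.2.2 ∈ Ioo (-1 : ℝ) 1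
    · simp only [g]
      rw [hz hA]
      exact hbound z
    · simp [g, hτ0 z hA]
  have hH : Measurable fun z : Phase ↦ (f z + jumpDual g z) *
      (if T ≤ z.2.2.1 then φ (delay (-T) z) else 0) :=
    (hf.add (measurable_jumpDual hg)).mul
      (Measurable.ite (measurableSet_le_time T) (hφ.comp_delay _) measurable_const)
  calc ∫⁻ z, ‖μ T z‖ₑ * φ (shear 1 0 z) ∂phaseMeasure (Ici 0)
      ≤ ∫⁻ z, (fun z : Phase ↦ (f z + jumpDual g z) *
          (if T ≤ z.2.2.1 then φ (delay (-T) z) else 0)) (shear 1 T z) ∂phaseMeasure (Ici 0) := by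
        refine lintegral_mono_ae ?_
        filter_upwards [h2, (ae_phaseMeasure_iff measurableSet_Ici).2
          (Eventually.of_forall fun z h ↦ h.1)] with z hz hz0
        have e : T ≤ (shear 1 T z).2.2.1 := le_add_of_nonneg_left hz0
        rw [if_pos e, hz]
        refine mul_le_mul' (hbound _) (le_of_eq ?_)
        simp [shear, delay]
    _ ≤ ∫⁻ z, (fun z : Phase ↦ (f z + jumpDual g z) *
          (if T ≤ z.2.2.1 then φ (delay (-T) z) else 0)) (shear 1 T z) := by
        rw [phaseMeasure_eq]
        exact lintegral_mono' Measure.restrict_le_self le_rfl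
    _ = ∫⁻ z, (f z + jumpDual g z) * (if T ≤ z.2.2.1 then φ (delay (-T) z) else 0) :=
        lintegral_shear hH 1 T
    _ ≤ ∫⁻ z, f z * ∫⁻ w, φ (delay (-T) w) ∂hit T z :=
        lintegral_add_jumpDual_mul_le_hit hf hg (hφ.comp_delay _) hg0 hle hfin hC fun z ↦ hφC _
    _ = _ := by simp_rw [lintegral_flow T hφ]; rfl

lemma integrable_solution (hμ : IsMildSolution μ₀ μ) (hm : Measurable m)
    (hfin : ∫⁻ z, ‖m z‖ₑ ≠ ∞)
    (hae : ∀ᵐ z : Phase, 0 ≤ z.2.2.1 ∧ z.2.2.2 ∈ Ioo (-1 : ℝ) 1 → μ₀ (shear (-1) 0 z) = m z)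
    {T : ℝ} (hT : 0 < T) : Integrable (μ T) (phaseMeasure (Ici 0)) := by
  refine ⟨aestronglyMeasurable_solution hμ hm hae hT, ?_⟩
  have h := lintegral_solution_mul_le hμ hm hae hT (φ := fun _ ↦ 1) measurable_const
    ENNReal.one_ne_top fun _ ↦ le_rfl
  simp only [mul_one] at h
  refine lt_of_le_of_lt (h.trans (lintegral_mono fun z ↦ ?_)) hfin.lt_top
  exact mul_le_of_le_one_right zero_le (lintegral_flow_le_const T (fun _ ↦ le_rfl) z)

lemma solution_zero_ae_eq (hμ : IsMildSolution μ₀ μ) : μ 0 =ᵐ[phaseMeasure (Ici 0)] μ₀ := by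
  filter_upwards [hμ.eq 0 le_rfl] with z hz
  simpa [duhamel] using hz

end Solution

/-- An integrable function of the position is integrable at equilibrium. -/
lemma lintegral_equilibrium_shear_ne_top {ξ : Plane → ℝ≥0∞} (hξ : Measurable ξ)
    (hfin : ∫⁻ x, ξ x ≠ ∞) : ∫⁻ z, ξ (shear (-1) 0 z).1 ∂equilibrium ≠ ∞ := by
  have h1 : Measurable fun z ↦ ξ (shear (-1) 0 z).1 := hξ.comp (measurable_shear _ _).fst
  rw [lintegral_equilibrium h1, lintegral_phase (by fun_prop)]
  have e : ∀ h s : ℝ, ∫⁻ θ : Circ, ∫⁻ x : Plane, survival s h * ξ (shear (-1) 0 (x, θ, s, h)).1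
      = survival s h * ((∫⁻ x, ξ x) * volume (univ : Set Circ)) := fun h s ↦ by
    have e2 : ∀ θ : Circ, ∫⁻ x : Plane, survival s h * ξ (shear (-1) 0 (x, θ, s, h)).1
        = survival s h * ∫⁻ x, ξ x := fun θ ↦ by
      rw [lintegral_const_mul]
      · congr 1
        exact lintegral_add_right_eq_self (μ := volume) ξ ((-1 * s) • vel θ)
      · unfold shear; fun_prop
    simp_rw [e2]
    rw [lintegral_const, mul_assoc]
  simp only
  simp_rw [e]
  have h2 : ∀ h : ℝ, ∫⁻ s : ℝ, survival s h * ((∫⁻ x, ξ x) * volume (univ : Set Circ))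
      = (∫⁻ s : ℝ, survival s h) * ((∫⁻ x, ξ x) * volume (univ : Set Circ)) := fun h ↦
    lintegral_mul_const _ (by fun_prop)
  simp_rw [h2]
  rw [lintegral_mul_const _ (Measurable.lintegral_prod_left' (f := fun p : ℝ × ℝ ↦ survival p.1 p.2)
    (by fun_prop))]
  exact ENNReal.mul_ne_top lintegral_survival_lt_top.ne
    (ENNReal.mul_ne_top hfin (measure_ne_top _ _))

theorem IsMildSolution.integrable {μ₀ : Phase → ℝ} {μ : ℝ → Phase → ℝ} (hμ : IsMildSolution μ₀ μ)
    (hμ₀ : Integrable μ₀ (phaseMeasure (Ici 0))) {t : ℝ} (ht : 0 ≤ t) :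
    Integrable (μ t) (phaseMeasure (Ici 0)) := by
  obtain ⟨m, hm, hfin, -, hae⟩ := exists_initial_density hμ₀
  rcases ht.eq_or_lt with rfl | ht
  · exact hμ₀.congr (solution_zero_ae_eq hμ).symm
  · exact integrable_solution hμ hm hfin hae ht

theorem IsMildSolution.tendsto_eLpNorm_integral {μ₀ : Phase → ℝ} {μ : ℝ → Phase → ℝ}
    (hμ : IsMildSolution μ₀ μ) (hμ₀ : Integrable μ₀ (phaseMeasure (Ici 0))) (η : 𝓢(Plane, ℂ)) :
    Tendsto (fun t : ℝ ↦ eLpNorm (fun w : Circ × ℝ × ℝ ↦ ∫ x : Plane, η x * ((μ t (x, w) : ℝ) : ℂ))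
      1 (angularMeasure (Ici 0))) atTop (𝓝 0) := by
  obtain ⟨m, hm, hfin, hsupp, hae⟩ := exists_initial_density hμ₀
  have hη : Measurable fun x ↦ ‖η x‖ₑ := η.continuous.measurable.enorm
  -- the observable `|η|`, read at the position of the particle
  set φ : Phase → ℝ≥0∞ := fun z ↦ ‖η (shear (-1) 0 z).1‖ₑ
  have hφ : Measurable φ := hη.comp (measurable_shear _ _).fst
  obtain ⟨C, hC⟩ : ∃ C : ℝ, ∀ x, ‖η x‖ ≤ C :=
    ⟨_, fun x ↦ η.toBoundedContinuousFunction.norm_coe_le_norm x⟩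
  have hφC : ∀ z, φ z ≤ ENNReal.ofReal C := fun z ↦ by
    simp only [φ]
    rw [← ofReal_norm]
    exact ENNReal.ofReal_le_ofReal (hC _)
  have hφ2 : ∫⁻ z, φ z ^ 2 ∂equilibrium ≠ ∞ :=
    lintegral_equilibrium_shear_ne_top (hη.pow_const 2)
      (lintegral_enorm_sq_ne_top (η.memLp 2))
  have hlim := tendsto_lintegral_mul_flow hφ ENNReal.ofReal_ne_top hφC hφ2 hm.enorm hfin
    fun z hz ↦ hsupp z (by simpa using hz)
  refine tendsto_of_tendsto_of_tendsto_of_le_of_le' tendsto_const_nhds hlim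
    (Eventually.of_forall fun _ ↦ zero_le) ?_
  filter_upwards [eventually_gt_atTop 0] with t ht
  refine le_trans ?_ (lintegral_solution_mul_le hμ hm hae ht hφ ENNReal.ofReal_ne_top hφC)
  have hmeas : AEMeasurable (fun z ↦ ‖μ t z‖ₑ * φ (shear 1 0 z)) (phaseMeasure (Ici 0)) :=
    (aestronglyMeasurable_solution hμ hm hae ht).enorm.mul
      (hφ.comp (measurable_shear 1 0)).aemeasurable
  have : SFinite (angularMeasure (Ici 0)) := by unfold angularMeasure impactMeasure; infer_instance
  rw [eLpNorm_one_eq_lintegral_enorm, phaseMeasure, lintegral_prod_symm _ hmeas]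
  refine lintegral_mono fun w ↦ (enorm_integral_le_lintegral_enorm _).trans_eq ?_
  refine lintegral_congr fun x ↦ ?_
  have hre : ‖((μ t (x, w) : ℝ) : ℂ)‖ₑ = ‖μ t (x, w)‖ₑ := by
    rw [← ofReal_norm, ← ofReal_norm, Complex.norm_real]
  rw [enorm_mul, mul_comm, hre]
  simp [φ, shear]

end PeriodicLorentz

theorem theorem4
    (μ₀ : PeriodicLorentz.Plane × PeriodicLorentz.Circ × ℝ × ℝ → ℝ)
    (hμ₀ : Integrable μ₀ (PeriodicLorentz.phaseMeasure (Ici 0)))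
    (μ : ℝ → PeriodicLorentz.Plane × PeriodicLorentz.Circ × ℝ × ℝ → ℝ)
    (hμ : PeriodicLorentz.IsMildSolution μ₀ μ) :
    (∀ t : ℝ, 0 ≤ t → Integrable (μ t) (PeriodicLorentz.phaseMeasure (Ici 0))) ∧
    ∀ η : 𝓢(PeriodicLorentz.Plane, ℂ),
      Tendsto
        (fun t : ℝ ↦ eLpNorm
          (fun w : PeriodicLorentz.Circ × ℝ × ℝ ↦
            ∫ x : PeriodicLorentz.Plane, η x * ((μ t (x, w) : ℝ) : ℂ))
          1 (PeriodicLorentz.angularMeasure (Ici 0)))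
        atTop (𝓝 0) :=
  ⟨fun _ ht ↦ hμ.integrable hμ₀ ht, fun η ↦ hμ.tendsto_eLpNorm_integral hμ₀ η⟩
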